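/- Work with compactly generated Hausdorff spaces (products are compactly generated products, mapping spaces carry the compactly generated refinement of the compact-open topology). Let $\eta : O \to O'$ be a map of symmetric topological operads with unit (nothing else is assumed about $O$, $O'$). **Trees.** A tree with $n$ leaves is a planar rooted tree, possibly without vertices, whose leaves are labelled bijectively by $\{1,\dots,n\}$; vertices may have any number $|v|\ge 0$ of inputs. **The resolution $\mathcal{BV}(O)$.** A point of $\mathcal{BV}(O)(n)$ is a class of trees with $n$ leaves, whose vertices $v$ are labelled by points of $O(|v|)$ and whose inner edges have a length in $[0,1]$, modulo: (i) a vertex labelled by the unit is removed (two inner edges which become one get the maximum of their lengths); (ii) compatibility with the symmetric group actions at a vertex; (iii) an inner edge of length $0$ is contracted by composing in $O$. The symmetric groups act by relabelling leaves, composition is grafting, the new inner edge getting length $1$. Let $\iota : O \to \mathcal{BV}(O)$ send a point to the corolla it labels, and $\mu : \mathcal{BV}(O) \to O$ compose all the labels. **The bimodule $\mathcal{WB}(O)$.** A point of $\mathcal{WB}(O)(n)$ is a class $[T;\{t_v\};\{x_v\}]$ of trees $T$ with $n$ leaves, each vertex $v$ labelled by $x_v\in\mathcal{BV}(O)(|v|)$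 and $t_v\in[0,1]$, the $t_v$ being weakly increasing from the root to the leaves, modulo: (i) a vertex with $x_v=\iota(*_1)$ is removed; (ii) compatibility with the symmetric group actions at a vertex; (iii) an edge between two vertices with the same parameter $t$ is contracted by composing in $\mathcal{BV}(O)$, the result having parameter $t$; (iv) if $t_v\in\{0,1\}$, then $x_v$ may be replaced by $\iota\mu(x_v)$. It has the quotient topology. A right operation by $a_1,\dots,a_n\in O$ grafts the corollas $(\iota(a_i);1)$ on the leaves; the left operation by $a\in O$ grafts trees on the leaves of the corolla $(\iota(a);0)$. **Filtration.** Represent the labels $x_v$ by ("auxiliary") trees. Let $\mathcal{WB}_k(O)\subset\mathcal{WB}(O)$ consist of the points having a representative such that, after removal of the vertices of the main tree with parameter $0$ or $1$, every remaining component (including components without vertices, i.e. an edge from a vertex with parameter $0$, or from the trunk, to a vertex with parameter $1$ or to a leaf) has at most $k$ geometrical inputs, that is leaves of the component plus univalent vertices of its auxiliary trees. It is topologized as the quotient of the space of these representatives. **Mapping spaces.** $Bimod_O(\mathcal{WB}(O);O')$ is the space of families of continuous maps $\mathcal{WB}(O)(n)\to O'(n)$ compatible with the symmetric group actions and with the left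 and right operations of $O$, where $O$ acts on $O'$ through $\eta$. For $k\ge 0$, $T_kBimod_O(T_k\mathcal{WB}_k(O);T_kO')$ is the space of such families for $0\le n\le k$, compatible with the symmetric group actions and with those operations all of whose arguments in, and whose value in, the bimodule have arity at most $k$. **The maps $\alpha_n$.** $\mathcal{C}_1$ is the operad of little intervals: $\mathcal{C}_1(n)$ is the space of $n$-tuples $c=\langle c_1,\dots,c_n\rangle$ of increasing affine embeddings of $[0,1]$ in itself whose images have disjoint interiors. Let $c\in\mathcal{C}_1(n)$ be numbered from left to right, with gaps $[0,c_1(0)],[c_1(1),c_2(0)],\dots,[c_n(1),1]$ (the gap is $[0,1]$ if $n=0$), and let $f_1,\dots,f_n$ be maps of bimodules. Given a tree $T$ with parameters $t_v$ and labels $x_v$ representing a point $y$, cut $T$ into the maximal sub-trees whose parameters are in the first gap, in $]c_1(0),c_1(1)[$, in the second gap, in $]c_2(0),c_2(1)[$, and so on up to the last gap (trivial sub-trees are inserted, so that each path from the root to a leaf meets exactly one sub-tree of each kind, and each path from the root to a univalent vertex meets exactly one sub-tree of each kind until it ends). Apply $f_i$ to each sub-tree belonging to $c_i$, after replacing its parameters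 $t_v$ by $c_i^{-1}(t_v)$; apply to each sub-tree belonging to a gap $\eta$ to the composite in $O$ of the points $\mu(x_v)$; compose the results in $O'$ along the way the sub-trees are put together in $T$, and label the inputs by the leaves of $T$. The result is denoted $\alpha_n(c;f_1,\dots,f_n)(y)$. **Claim.** (1) There is exactly one $\mathcal{C}_1$-algebra structure on the space $Bimod_O(\mathcal{WB}(O);O')$, i.e. exactly one family of continuous maps $$\alpha_n:\mathcal{C}_1(n)\times Bimod_O(\mathcal{WB}(O);O')^{n}\to Bimod_O(\mathcal{WB}(O);O')$$ compatible with the unit, the compositions and the symmetric group actions, which for all $c$ numbered from left to right is given by the formula above, for every representative of every point $y$ (so that the formula is well defined). (2) For every $k\ge 0$ there is likewise exactly one $\mathcal{C}_1$-algebra structure on $T_kBimod_O(T_k\mathcal{WB}_k(O);T_kO')$ which is given by the same formula, for every $y\in\mathcal{WB}_k(O)(m)$ with $m\le k$ and every representative of $y$ in $\mathcal{WB}(O)(m)$. Here the $f_i$, which are defined on $T_k\mathcal{WB}_k(O)$ only, are extended to functions $\mathcal{WB}(O)(q)\to O'(q)$, $q\ge 0$, in an arbitrary way, and the formula holds for every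 choice of the extensions. -/

import Mathlib

open TopologicalSpace

universe u v w

namespace OperadBimod

/-! ### Compactly generated continuity

Products of spaces are formed in compactly generated spaces: a map out of a product is required to
be continuous for the compactly generated refinement of the product topology. -/

/-- Continuity for the compactly generated refinement of the topology of the source. -/
def KContinuous {X : Type v} {Y : Type w} [TopologicalSpace X] [TopologicalSpace Y]
    (f : X → Y) : Prop :=
  @Continuous X Y (compactlyGenerated.{u} X) _ f

/-! ### Reindexing of inputs -/

/-- Block sum of bijections. -/
def sumEquiv {n : ℕ} {m m' : Fin n → ℕ} (e : ∀ i, Fin (m i) ≃ Fin (m' i)) :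
    Fin (∑ i, m i) ≃ Fin (∑ i, m' i) :=
  finSigmaFinEquiv.symm.trans ((Equiv.sigmaCongrRight e).trans finSigmaFinEquiv)

/-- Block permutation: the block of `i` is moved to the block of `e i`. -/
def blockEquiv {n n' : ℕ} (e : Fin n ≃ Fin n') (m : Fin n' → ℕ) :
    Fin (∑ i, m (e i)) ≃ Fin (∑ i, m i) :=
  finSigmaFinEquiv.symm.trans
    ((Equiv.sigmaCongrLeft (β := fun i => Fin (m i)) e).trans finSigmaFinEquiv)

/-- A single block. -/
def oneBlockEquiv (n : ℕ) : Fin (∑ _i : Fin 1, n) ≃ Fin n :=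
  finSigmaFinEquiv.symm.trans (Equiv.uniqueSigma fun _ : Fin 1 => Fin n)

/-- Blocks of size one. -/
def unitBlocksEquiv (n : ℕ) : Fin (∑ _i : Fin n, 1) ≃ Fin n :=
  finSigmaFinEquiv.symm.trans (Equiv.sigmaUnique (Fin n) fun _ => Fin 1)

/-- Blocks of blocks. -/
def assocEquiv {n : ℕ} (m : Fin n → ℕ) (p : Fin (∑ i, m i) → ℕ) :
    Fin (∑ j, p j) ≃ Fin (∑ i, ∑ k, p (finSigmaFinEquiv ⟨i, k⟩)) :=
  finSigmaFinEquiv.symm.trans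
    ((Equiv.sigmaCongrLeft (β := fun j => Fin (p j)) finSigmaFinEquiv).symm.trans
      ((Equiv.sigmaAssoc fun i k => Fin (p (finSigmaFinEquiv ⟨i, k⟩))).trans
        ((Equiv.sigmaCongrRight fun _ => finSigmaFinEquiv).trans finSigmaFinEquiv)))

theorem sumEquiv_apply {n : ℕ} {m m' : Fin n → ℕ} (e : ∀ i, Fin (m i) ≃ Fin (m' i))
    (s : Σ i, Fin (m i)) :
    sumEquiv e (finSigmaFinEquiv s) = finSigmaFinEquiv ⟨s.1, e s.1 s.2⟩ := by
  simp [sumEquiv, Equiv.sigmaCongrRight]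

theorem blockEquiv_apply {n n' : ℕ} (e : Fin n ≃ Fin n') (m : Fin n' → ℕ)
    (s : Σ i, Fin (m (e i))) :
    blockEquiv e m (finSigmaFinEquiv s) = finSigmaFinEquiv ⟨e s.1, s.2⟩ := by
  simp [blockEquiv, Equiv.sigmaCongrLeft]

theorem oneBlockEquiv_apply (n : ℕ) (s : Σ _i : Fin 1, Fin n) :
    oneBlockEquiv n (finSigmaFinEquiv s) = s.2 := by
  simp only [oneBlockEquiv, Equiv.trans_apply, Equiv.symm_apply_apply]
  obtain ⟨i, k⟩ := s
  obtain rfl := Subsingleton.elim i default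
  rfl

theorem unitBlocksEquiv_apply (n : ℕ) (s : Σ _i : Fin n, Fin 1) :
    unitBlocksEquiv n (finSigmaFinEquiv s) = s.1 := by
  simp only [unitBlocksEquiv, Equiv.trans_apply, Equiv.symm_apply_apply]
  rfl

theorem assocEquiv_apply {n : ℕ} (m : Fin n → ℕ) (p : Fin (∑ i, m i) → ℕ) (i : Fin n)
    (k : Fin (m i)) (l : Fin (p (finSigmaFinEquiv ⟨i, k⟩))) :
    assocEquiv m p (finSigmaFinEquiv ⟨finSigmaFinEquiv ⟨i, k⟩, l⟩) =
      finSigmaFinEquiv ⟨i, finSigmaFinEquiv ⟨k, l⟩⟩ := by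
  have h : (Equiv.sigmaCongrLeft (β := fun j => Fin (p j)) finSigmaFinEquiv).symm
      ⟨finSigmaFinEquiv ⟨i, k⟩, l⟩ = ⟨⟨i, k⟩, l⟩ := by
    rw [Equiv.symm_apply_eq]; rfl
  simp only [assocEquiv, Equiv.trans_apply, Equiv.symm_apply_apply, h]
  rfl

/-! ### Topological operads -/

/-- A (symmetric, unital) operad in compactly generated Hausdorff spaces.

The right actions of the symmetric groups are packaged as an action of all bijections
`Fin m ≃ Fin n` (such a bijection exists only for `m = n`, so this is exactly a right action of
`Σ_n` on `obj n` for each `n`); the input `j` of `act e x` is the input `e j` of `x`.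
`comp x y` is the total composition `x(y_1, …, y_n)`; the partial composition `x ∘_i y` is
`x(1, …, y, …, 1)`. -/
structure TopOperad where
  obj : ℕ → Type u
  [top : ∀ n, TopologicalSpace (obj n)]
  [t2 : ∀ n, T2Space (obj n)]
  [cg : ∀ n, CompactlyGeneratedSpace (obj n)]
  act : ∀ {m n : ℕ}, (Fin m ≃ Fin n) → obj n → obj m
  unit : obj 1
  comp : ∀ {n : ℕ} {m : Fin n → ℕ}, obj n → (∀ i, obj (m i)) → obj (∑ i, m i)
  continuous_act : ∀ {m n : ℕ} (e : Fin m ≃ Fin n), Continuous (act e)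
  continuous_comp : ∀ {n : ℕ} {m : Fin n → ℕ},
    KContinuous.{u} fun p : obj n × (∀ i, obj (m i)) => comp p.1 p.2
  act_refl : ∀ {n : ℕ} (x : obj n), act (Equiv.refl _) x = x
  act_act : ∀ {l m n : ℕ} (e : Fin l ≃ Fin m) (e' : Fin m ≃ Fin n) (x : obj n),
    act e (act e' x) = act (e.trans e') x
  unit_comp : ∀ {n : ℕ} (x : obj n), comp unit (fun _ : Fin 1 => x) = act (oneBlockEquiv n) x
  comp_unit : ∀ {n : ℕ} (x : obj n), comp x (fun _ => unit) = act (unitBlocksEquiv n) x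
  act_comp : ∀ {n n' : ℕ} (e : Fin n ≃ Fin n') {m : Fin n' → ℕ} (x : obj n')
    (y : ∀ i, obj (m i)), comp (act e x) (fun i => y (e i)) = act (blockEquiv e m) (comp x y)
  comp_act : ∀ {n : ℕ} {m m' : Fin n → ℕ} (e : ∀ i, Fin (m i) ≃ Fin (m' i)) (x : obj n)
    (y : ∀ i, obj (m' i)), comp x (fun i => act (e i) (y i)) = act (sumEquiv e) (comp x y)
  comp_comp : ∀ {n : ℕ} {m : Fin n → ℕ} {p : Fin (∑ i, m i) → ℕ} (x : obj n)
    (y : ∀ i, obj (m i)) (z : ∀ j, obj (p j)),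
    comp (comp x y) z =
      act (assocEquiv m p) (comp x fun i => comp (y i) fun k => z (finSigmaFinEquiv ⟨i, k⟩))

attribute [instance] TopOperad.top TopOperad.t2 TopOperad.cg

/-- Maps of topological operads. -/
structure TopOperad.Hom (O P : TopOperad.{u}) where
  toFun : ∀ n, O.obj n → P.obj n
  continuous : ∀ n, Continuous (toFun n)
  map_act : ∀ {m n : ℕ} (e : Fin m ≃ Fin n) (x : O.obj n),
    toFun m (O.act e x) = P.act e (toFun n x)
  map_unit : toFun 1 O.unit = P.unit
  map_comp : ∀ {n : ℕ} {m : Fin n → ℕ} (x : O.obj n) (y : ∀ i, O.obj (m i)),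
    toFun _ (O.comp x y) = P.comp (toFun n x) fun i => toFun _ (y i)

/-- Algebras over a topological operad. -/
structure OperadAlgebra (P : TopOperad.{w}) (X : Type v) [TopologicalSpace X] where
  map : ∀ n, P.obj n → (Fin n → X) → X
  continuous_map : ∀ n, KContinuous.{max w v} fun q : P.obj n × (Fin n → X) => map n q.1 q.2
  map_act : ∀ {m n : ℕ} (e : Fin m ≃ Fin n) (p : P.obj n) (x : Fin n → X),
    map m (P.act e p) (fun j => x (e j)) = map n p x
  map_unit : ∀ x : Fin 1 → X, map 1 P.unit x = x 0
  map_comp : ∀ {n : ℕ} {m : Fin n → ℕ} (p : P.obj n) (q : ∀ i, P.obj (m i))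
    (x : Fin (∑ i, m i) → X),
    map _ (P.comp p q) x = map n p fun i => map (m i) (q i) fun k => x (finSigmaFinEquiv ⟨i, k⟩)

/-! ### The little intervals operad -/

/-- A one dimensional little cube `c`, recorded as the pair `(c 0, c 1)`. -/
def LittleInterval : Type := {p : ℝ × ℝ // 0 ≤ p.1 ∧ p.1 < p.2 ∧ p.2 ≤ 1}

instance : TopologicalSpace LittleInterval :=
  inferInstanceAs (TopologicalSpace {p : ℝ × ℝ // 0 ≤ p.1 ∧ p.1 < p.2 ∧ p.2 ≤ 1})

namespace LittleInterval

def left (c : LittleInterval) : ℝ := c.1.1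

def right (c : LittleInterval) : ℝ := c.1.2

/-- The affine embedding. -/
def toFun (c : LittleInterval) (t : ℝ) : ℝ := c.left + (c.right - c.left) * t

/-- The composite `c ∘ d`. -/
def comp (c d : LittleInterval) : LittleInterval :=
  ⟨(c.toFun d.left, c.toFun d.right), by
    obtain ⟨⟨a, b⟩, h0, h1, h2⟩ := c
    obtain ⟨⟨a', b'⟩, h0', h1', h2'⟩ := d
    simp only [toFun, left, right] at *
    refine ⟨by nlinarith, by nlinarith, by nlinarith⟩⟩

/-- The identity of `[0,1]`. -/
def id : LittleInterval := ⟨(0, 1), by norm_num⟩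

/-- The inverse `t ↦ c⁻¹ t`; only its values on the image of `c` matter. -/
noncomputable def inv (c : LittleInterval) (t : unitInterval) : unitInterval :=
  Set.projIcc 0 1 zero_le_one (((t : ℝ) - c.left) / (c.right - c.left))

theorem inv_mono (c : LittleInterval) : Monotone c.inv := by
  intro s t h
  refine Set.monotone_projIcc _ ?_
  have : 0 ≤ c.right - c.left := sub_nonneg.2 c.2.2.1.le
  have h' : (s : ℝ) ≤ t := h
  gcongr

/-- The interior of the image. -/
def interior (c : LittleInterval) : Set ℝ := Set.Ioo c.left c.right

end LittleInterval

/-- Configurations of `n` little intervals with pairwise disjoint interiors. -/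
def LittleIntervals (n : ℕ) : Type :=
  {c : Fin n → LittleInterval // ∀ i j, i ≠ j → Disjoint (c i).interior (c j).interior}

instance (n : ℕ) : TopologicalSpace (LittleIntervals n) :=
  inferInstanceAs (TopologicalSpace
    {c : Fin n → LittleInterval // ∀ i j, i ≠ j → Disjoint (c i).interior (c j).interior})

/-- The intervals of the configuration are numbered from left to right. -/
def LittleIntervals.IsOrdered {n : ℕ} (c : LittleIntervals n) : Prop :=
  ∀ i j, i < j → (c.1 i).right ≤ (c.1 j).left

theorem LittleInterval.ext' {c d : LittleInterval} (h1 : c.left = d.left)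
    (h2 : c.right = d.right) : c = d := Subtype.ext (Prod.ext h1 h2)

theorem LittleInterval.interior_comp (c d : LittleInterval) :
    (c.comp d).interior = c.toFun '' d.interior := by
  have hc : 0 < c.right - c.left := sub_pos.2 c.2.2.1
  ext x
  simp only [interior, Set.mem_Ioo, Set.mem_image]
  change (c.toFun d.left < x ∧ x < c.toFun d.right) ↔ _
  simp only [toFun]
  constructor
  · rintro ⟨h1, h2⟩
    refine ⟨(x - c.left) / (c.right - c.left), ⟨?_, ?_⟩, ?_⟩
    · rw [lt_div_iff₀ hc]; linarith
    · rw [div_lt_iff₀ hc]; linarith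
    · field_simp; ring
  · rintro ⟨y, ⟨h1, h2⟩, rfl⟩
    constructor <;> nlinarith

theorem LittleInterval.toFun_injective (c : LittleInterval) : Function.Injective c.toFun := by
  have hc : 0 < c.right - c.left := sub_pos.2 c.2.2.1
  intro x y h
  simp only [toFun] at h
  have : (c.right - c.left) * (x - y) = 0 := by linarith
  rcases mul_eq_zero.1 this with h | h <;> linarith

theorem LittleInterval.interior_comp_subset (c d : LittleInterval) :
    (c.comp d).interior ⊆ c.interior := by
  obtain ⟨⟨a, b⟩, h0, h1, h2⟩ := c
  obtain ⟨⟨a', b'⟩, h0', h1', h2'⟩ := d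
  simp only [interior, comp, toFun, left, right] at *
  apply Set.Ioo_subset_Ioo <;> nlinarith

namespace LittleIntervals

/-- The `k`-th interval of `d i` inside the `i`-th interval of `c`, for `s = (i, k)`. -/
def joint {n : ℕ} {m : Fin n → ℕ} (c : LittleIntervals n) (d : ∀ i, LittleIntervals (m i))
    (s : Σ i, Fin (m i)) : LittleInterval :=
  (c.1 s.1).comp ((d s.1).1 s.2)

theorem joint_disjoint {n : ℕ} {m : Fin n → ℕ} (c : LittleIntervals n)
    (d : ∀ i, LittleIntervals (m i)) (a b : Σ i, Fin (m i)) (hne : a ≠ b) :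
    Disjoint (joint c d a).interior (joint c d b).interior := by
  obtain ⟨i, k⟩ := a
  obtain ⟨i', k'⟩ := b
  by_cases hi : i = i'
  · subst hi
    have hk : k ≠ k' := fun h => hne (by rw [h])
    simp only [joint, LittleInterval.interior_comp]
    exact (Set.disjoint_image_iff (LittleInterval.toFun_injective _)).2 ((d i).2 k k' hk)
  · exact (c.2 i i' hi).mono (LittleInterval.interior_comp_subset _ _)
      (LittleInterval.interior_comp_subset _ _)

/-- Composition: the intervals of `d i` are placed inside the `i`-th interval of `c`. -/
def comp {n : ℕ} {m : Fin n → ℕ} (c : LittleIntervals n) (d : ∀ i, LittleIntervals (m i)) :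
    LittleIntervals (∑ i, m i) :=
  ⟨fun j => joint c d (finSigmaFinEquiv.symm j), fun _ _ hj =>
    joint_disjoint c d _ _ fun h => hj (finSigmaFinEquiv.symm.injective h)⟩

theorem comp_apply {n : ℕ} {m : Fin n → ℕ} (c : LittleIntervals n)
    (d : ∀ i, LittleIntervals (m i)) (s : Σ i, Fin (m i)) :
    (comp c d).1 (finSigmaFinEquiv s) = joint c d s := by
  simp [comp]

end LittleIntervals

theorem LittleInterval.continuous_comp :
    Continuous fun p : LittleInterval × LittleInterval => p.1.comp p.2 := by
  refine Continuous.subtype_mk ?_ _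
  unfold LittleInterval.toFun LittleInterval.left LittleInterval.right
  have h1 : Continuous fun p : LittleInterval × LittleInterval => p.1.1 :=
    continuous_subtype_val.comp continuous_fst
  have h2 : Continuous fun p : LittleInterval × LittleInterval => p.2.1 :=
    continuous_subtype_val.comp continuous_snd
  fun_prop

theorem KContinuous.of_continuous {X : Type v} {Y : Type w} [TopologicalSpace X]
    [TopologicalSpace Y] {f : X → Y} (hf : Continuous f) : KContinuous.{u} f :=
  continuous_from_compactlyGenerated f fun _ g => hf.comp g.continuous

theorem LittleInterval.comp_id (c : LittleInterval) : c.comp LittleInterval.id = c := by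
  apply LittleInterval.ext' <;>
    simp [LittleInterval.comp, LittleInterval.id, LittleInterval.toFun, LittleInterval.left,
      LittleInterval.right]

theorem LittleInterval.id_comp (c : LittleInterval) : LittleInterval.id.comp c = c := by
  apply LittleInterval.ext' <;>
    simp [LittleInterval.comp, LittleInterval.id, LittleInterval.toFun, LittleInterval.left,
      LittleInterval.right]

theorem LittleInterval.comp_assoc (c d e : LittleInterval) :
    (c.comp d).comp e = c.comp (d.comp e) := by
  apply LittleInterval.ext' <;>
    simp only [LittleInterval.comp, LittleInterval.toFun, LittleInterval.left,
      LittleInterval.right] <;> ring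

instance : T2Space LittleInterval :=
  inferInstanceAs (T2Space {p : ℝ × ℝ // 0 ≤ p.1 ∧ p.1 < p.2 ∧ p.2 ≤ 1})

instance : FirstCountableTopology LittleInterval :=
  inferInstanceAs (FirstCountableTopology {p : ℝ × ℝ // 0 ≤ p.1 ∧ p.1 < p.2 ∧ p.2 ≤ 1})

instance (n : ℕ) : T2Space (LittleIntervals n) :=
  inferInstanceAs (T2Space
    {c : Fin n → LittleInterval // ∀ i j, i ≠ j → Disjoint (c i).interior (c j).interior})

instance (n : ℕ) : FirstCountableTopology (LittleIntervals n) :=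
  TopologicalSpace.Subtype.firstCountableTopology
    (fun c : Fin n → LittleInterval =>
      ∀ i j, i ≠ j → Disjoint (c i).interior (c j).interior)

/-- The one dimensional little cubes operad. -/
def littleIntervals : TopOperad.{0} where
  obj := LittleIntervals
  cg := fun n => inferInstance
  act e c := ⟨fun j => c.1 (e j), fun i j h => c.2 _ _ (e.injective.ne h)⟩
  unit := ⟨fun _ => LittleInterval.id, fun i j h => absurd (Subsingleton.elim i j) h⟩
  comp := LittleIntervals.comp
  continuous_act e := by
    refine Continuous.subtype_mk ?_ _
    exact continuous_pi fun j => (continuous_apply (e j)).comp continuous_subtype_val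
  continuous_comp := by
    intro n m
    refine KContinuous.of_continuous (Continuous.subtype_mk (continuous_pi fun j => ?_) _)
    refine LittleInterval.continuous_comp.comp (Continuous.prodMk ?_ ?_)
    · exact (continuous_apply _).comp (continuous_subtype_val.comp continuous_fst)
    · exact (continuous_apply _).comp
        (continuous_subtype_val.comp ((continuous_apply _).comp continuous_snd))
  act_refl x := rfl
  act_act e e' x := rfl
  unit_comp x := by
    refine Subtype.ext (funext fun j => ?_)
    obtain ⟨s, rfl⟩ := finSigmaFinEquiv.surjective j
    refine (LittleIntervals.comp_apply _ _ s).trans ?_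
    simp only [LittleIntervals.joint, LittleInterval.id_comp, oneBlockEquiv_apply]
  comp_unit x := by
    refine Subtype.ext (funext fun j => ?_)
    obtain ⟨s, rfl⟩ := finSigmaFinEquiv.surjective j
    refine (LittleIntervals.comp_apply _ _ s).trans ?_
    simp only [LittleIntervals.joint, LittleInterval.comp_id, unitBlocksEquiv_apply]
  act_comp e m x y := by
    refine Subtype.ext (funext fun j => ?_)
    obtain ⟨s, rfl⟩ := finSigmaFinEquiv.surjective j
    refine (LittleIntervals.comp_apply _ _ s).trans ?_
    simp only [LittleIntervals.comp_apply, LittleIntervals.joint, blockEquiv_apply]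
  comp_act e x y := by
    refine Subtype.ext (funext fun j => ?_)
    obtain ⟨s, rfl⟩ := finSigmaFinEquiv.surjective j
    refine (LittleIntervals.comp_apply _ _ s).trans ?_
    simp only [LittleIntervals.comp_apply, LittleIntervals.joint, sumEquiv_apply]
  comp_comp {n m p} x y z := by
    refine Subtype.ext (funext fun j => ?_)
    obtain ⟨⟨q, l⟩, rfl⟩ := finSigmaFinEquiv.surjective j
    obtain ⟨⟨i, k⟩, rfl⟩ := finSigmaFinEquiv.surjective q
    simp only [LittleIntervals.comp_apply, LittleIntervals.joint, assocEquiv_apply,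
      LittleInterval.comp_assoc]

/-! ### Labelled trees -/

/-- Planar trees whose vertices of arity `n` carry a label in `A n` and a parameter in `[0,1]`, and
whose leaves carry a label in `α`. A tree `(T ; σ)` with `n` leaves is a planar tree whose leaves
are labelled bijectively by `Fin n`. The tree without vertices is allowed. -/
inductive DTree (A : ℕ → Type u) (α : Type v) : Type (max u v)
  | leaf : α → DTree A α
  | node : {n : ℕ} → A n → unitInterval → (Fin n → DTree A α) → DTree A α

namespace DTree

variable {A : ℕ → Type u} {B : ℕ → Type u} {α : Type v} {β : Type w}

/-- Number of leaves. -/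
def numLeaves : DTree A α → ℕ
  | leaf _ => 1
  | node _ _ c => ∑ i, (c i).numLeaves

/-- The labels of the leaves, from left to right. -/
def label : (T : DTree A α) → Fin T.numLeaves → α
  | leaf a => fun _ => a
  | node _ _ c => fun j =>
      (c (finSigmaFinEquiv.symm j).1).label (finSigmaFinEquiv.symm j).2

/-- The leaves are labelled bijectively. -/
def IsLabelled (T : DTree A α) : Prop := Function.Bijective T.label

/-- Replace the labels of the leaves. -/
def relabel : (T : DTree A α) → (Fin T.numLeaves → β) → DTree A β
  | leaf _, f => leaf (f (0 : Fin 1))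
  | node x t c, f => node x t fun i => (c i).relabel fun k => f (finSigmaFinEquiv ⟨i, k⟩)

/-- The underlying planar tree, with its leaves numbered from left to right. -/
def planar (T : DTree A α) : DTree A (Fin T.numLeaves) := T.relabel fun j => j

/-- Graft the tree `f a` on the leaves labelled by `a`. -/
def bind : DTree A α → (α → DTree A β) → DTree A β
  | leaf a, f => f a
  | node x t c, f => node x t fun i => (c i).bind f

/-- Apply a function to the labels of the leaves. -/
def map (g : α → β) (T : DTree A α) : DTree A β := T.bind fun a => leaf (g a)

/-- Apply functions to the labels of the vertices. -/
def mapVert (g : ∀ n, A n → B n) : DTree A α → DTree B α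
  | leaf a => leaf a
  | node x t c => node (g _ x) t fun i => (c i).mapVert g

/-- Apply a function to the parameters of the vertices. -/
def mapParam (r : unitInterval → unitInterval) : DTree A α → DTree A α
  | leaf a => leaf a
  | node x t c => node x (r t) fun i => (c i).mapParam r

/-- Replace the parameter `t` of the root by `max s t`. -/
def raise (s : unitInterval) : DTree A α → DTree A α
  | leaf a => leaf a
  | node x t c => node x (max s t) c

/-- The parameter of the root, if there is one, is `1`. -/
def RootOne : DTree A α → Prop
  | leaf _ => True
  | node _ t _ => t = 1

/-- The parameter of the root, if there is one, is at least `s`. -/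
def RootGE (s : unitInterval) : DTree A α → Prop
  | leaf _ => True
  | node _ t _ => s ≤ t

/-- The parameters increase from the root to the leaves. -/
def Mono : DTree A α → Prop
  | leaf _ => True
  | node _ t c => ∀ i, (c i).RootGE t ∧ (c i).Mono

/-- The number of univalent vertices, i.e. vertices without inputs. -/
def univalents : DTree A α → ℕ
  | leaf _ => 0
  | node (n := n) _ _ c => (if n = 0 then 1 else 0) + ∑ i, (c i).univalents

/-- The composite in `P` of the (images of the) labels of the vertices; the inputs of the result are
the leaves, from left to right. -/
def eval (P : TopOperad.{w}) (g : ∀ n, A n → P.obj n) : (T : DTree A α) → P.obj T.numLeaves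
  | leaf _ => P.unit
  | node x _ c => P.comp (g _ x) fun i => (c i).eval P g

/-- `Absorb u τ T y d`: either the root of `T` has label `y`, parameter `τ` and the trees `d` above
it, or `y = u` is the unit and `T` is the only element of `d`. -/
inductive Absorb (u : A 1) (τ : unitInterval) :
    DTree A α → ∀ {m : ℕ}, A m → (Fin m → DTree A α) → Prop
  | merge {m : ℕ} (y : A m) (d : Fin m → DTree A α) : Absorb u τ (node y τ d) y d
  | keep (T : DTree A α) : Absorb u τ T u fun _ => T

/-- Apply a relation locally, at some subtree. -/
inductive Locally (R : DTree A α → DTree A α → Prop) : DTree A α → DTree A α → Prop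
  | base {T T' : DTree A α} : R T T' → Locally R T T'
  | node {n : ℕ} (x : A n) (t : unitInterval) (c c' : Fin n → DTree A α) (i : Fin n) :
      (∀ j, j ≠ i → c j = c' j) → Locally R (c i) (c' i) → Locally R (node x t c) (node x t c')

/-! #### Counting leaves -/

section mult

variable [DecidableEq α]

/-- The number of leaves labelled by `a`. -/
def mult (a : α) : DTree A α → ℕ
  | leaf b => if b = a then 1 else 0
  | node _ _ c => ∑ i, (c i).mult a

theorem mult_eq (a : α) (T : DTree A α) :
    T.mult a = ∑ j, if T.label j = a then 1 else 0 := by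
  induction T with
  | leaf b =>
    change (if b = a then 1 else 0) = ∑ _j : Fin 1, if b = a then 1 else 0
    simp
  | node x t c ih =>
    change ∑ i, (c i).mult a = ∑ j : Fin (∑ i, (c i).numLeaves),
      if (c (finSigmaFinEquiv.symm j).1).label (finSigmaFinEquiv.symm j).2 = a then 1 else 0
    rw [← finSigmaFinEquiv.sum_comp, Fintype.sum_sigma]
    refine Finset.sum_congr rfl fun i _ => ?_
    rw [ih i]
    refine Finset.sum_congr rfl fun k _ => ?_
    rw [Equiv.symm_apply_apply]

theorem isLabelled_iff (T : DTree A α) : T.IsLabelled ↔ ∀ a, T.mult a = 1 := by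
  rw [IsLabelled, Function.bijective_iff_existsUnique]
  refine forall_congr' fun a => ?_
  rw [mult_eq, Fintype.existsUnique_iff_card_one, Finset.card_filter]

theorem mult_bind [Fintype β] [DecidableEq β] (b : α) (T : DTree A β) (f : β → DTree A α) :
    (T.bind f).mult b = ∑ a, T.mult a * (f a).mult b := by
  induction T with
  | leaf a => simp [bind, mult]
  | node x t c ih =>
    simp only [bind, mult, ih, Finset.sum_mul]
    exact Finset.sum_comm

theorem mult_relabel (b : α) (T : DTree A β) (f : Fin T.numLeaves → α) :
    (T.relabel f).mult b = ∑ j, if f j = b then 1 else 0 := by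
  induction T with
  | leaf a =>
    change (if f (0 : Fin 1) = b then 1 else 0) = ∑ j : Fin 1, if f j = b then 1 else 0
    rw [Fin.sum_univ_one]
  | node x t c ih =>
    simp only [mult, relabel, ih]
    change _ = ∑ j : Fin (∑ i, (c i).numLeaves), if f j = b then 1 else 0
    rw [← finSigmaFinEquiv.sum_comp, Fintype.sum_sigma]

theorem mult_mapVert (g : ∀ n, A n → B n) (a : α) (T : DTree A α) :
    (T.mapVert g).mult a = T.mult a := by
  induction T with
  | leaf b => rfl
  | node x t c ih => simp only [mapVert, mult, ih]

theorem mult_mapParam (r : unitInterval → unitInterval) (a : α) (T : DTree A α) :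
    (T.mapParam r).mult a = T.mult a := by
  induction T with
  | leaf b => rfl
  | node x t c ih => simp only [mapParam, mult, ih]

end mult

theorem isLabelled_planar (T : DTree A α) : T.planar.IsLabelled := by
  refine (isLabelled_iff T.planar).2 ?_
  intro j
  rw [planar, mult_relabel]
  simp

theorem IsLabelled.mapVert [DecidableEq α] {T : DTree A α} (h : T.IsLabelled)
    (g : ∀ n, A n → B n) : (T.mapVert g).IsLabelled := by
  rw [isLabelled_iff] at h ⊢
  simpa only [mult_mapVert] using h

theorem IsLabelled.mapParam [DecidableEq α] {T : DTree A α} (h : T.IsLabelled)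
    (r : unitInterval → unitInterval) : (T.mapParam r).IsLabelled := by
  rw [isLabelled_iff] at h ⊢
  simpa only [mult_mapParam] using h

theorem IsLabelled.map {m n : ℕ} {T : DTree A (Fin m)} (h : T.IsLabelled) (e : Fin m ≃ Fin n) :
    (T.map e).IsLabelled := by
  rw [isLabelled_iff] at h ⊢
  intro j
  simp [DTree.map, mult_bind, h, mult, ← Equiv.eq_symm_apply]

/-- Graft trees with leaves labelled by `Fin (m i)`, the `i`-th one on the leaf `i`. -/
def graft {n : ℕ} {m : Fin n → ℕ} (T : DTree A (Fin n)) (S : ∀ i, DTree A (Fin (m i))) :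
    DTree A (Fin (∑ i, m i)) :=
  T.bind fun i => (S i).map fun k => finSigmaFinEquiv ⟨i, k⟩

theorem IsLabelled.graft {n : ℕ} {m : Fin n → ℕ} {T : DTree A (Fin n)} (h : T.IsLabelled)
    {S : ∀ i, DTree A (Fin (m i))} (hS : ∀ i, (S i).IsLabelled) : (T.graft S).IsLabelled := by
  rw [isLabelled_iff] at h ⊢
  simp only [isLabelled_iff] at hS
  intro j
  obtain ⟨⟨i, k⟩, rfl⟩ := finSigmaFinEquiv.surjective j
  simp only [DTree.graft, DTree.map, mult_bind, h, hS, mult, one_mul]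
  rw [← Fintype.sum_sigma']
  simp

/-- The corolla labelled by `x`, with parameter `t`. -/
def corolla {n : ℕ} (x : A n) (t : unitInterval) : DTree A (Fin n) := node x t leaf

theorem isLabelled_corolla {n : ℕ} (x : A n) (t : unitInterval) : (corolla x t).IsLabelled := by
  rw [isLabelled_iff]
  intro j
  simp [corolla, mult]

/-! #### Conditions on parameters -/

theorem RootOne.map {T : DTree A α} (h : T.RootOne) (g : α → β) : (T.map g).RootOne := by
  cases T <;> exact h

theorem RootOne.bind {T : DTree A α} (h : T.RootOne) {f : α → DTree A β}
    (hf : ∀ a, (f a).RootOne) : (T.bind f).RootOne := by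
  cases T with
  | leaf a => exact hf a
  | node x t c => exact h

theorem RootGE.bind {s : unitInterval} {T : DTree A α} (h : T.RootGE s) {f : α → DTree A β}
    (hf : ∀ a, (f a).RootGE s) : (T.bind f).RootGE s := by
  cases T with
  | leaf a => exact hf a
  | node x t c => exact h

theorem Mono.bind {T : DTree A α} (h : T.Mono) {f : α → DTree A β}
    (hf : ∀ a, (f a).RootOne ∧ (f a).Mono) : (T.bind f).Mono := by
  have hf' : ∀ a s, (f a).RootGE s := by
    intro a s
    have := (hf a).1
    generalize f a = S at this
    cases S with
    | leaf b => trivial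
    | node x t c => exact (show t = 1 from this) ▸ unitInterval.le_one'
  induction T with
  | leaf a => exact (hf a).2
  | node x t c ih => exact fun i => ⟨(h i).1.bind fun a => hf' a t, ih i (h i).2⟩

theorem Mono.map {T : DTree A α} (h : T.Mono) (g : α → β) : (T.map g).Mono :=
  h.bind fun _ => ⟨trivial, trivial⟩

theorem rootGE_zero (T : DTree A α) : T.RootGE 0 := by
  cases T with
  | leaf a => trivial
  | node x t c => exact unitInterval.nonneg'

theorem RootGE.mapVert {s : unitInterval} {T : DTree A α} (h : T.RootGE s)
    (g : ∀ n, A n → B n) : (T.mapVert g).RootGE s := by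
  cases T <;> exact h

theorem RootGE.mapParam {s : unitInterval} {T : DTree A α} (h : T.RootGE s)
    {r : unitInterval → unitInterval} (hr : Monotone r) : (T.mapParam r).RootGE (r s) := by
  cases T with
  | leaf a => trivial
  | node x t c => exact hr h

theorem RootGE.relabel {s : unitInterval} {T : DTree A α} (h : T.RootGE s)
    (f : Fin T.numLeaves → β) : (T.relabel f).RootGE s := by
  cases T <;> exact h

theorem Mono.mapVert {T : DTree A α} (h : T.Mono) (g : ∀ n, A n → B n) : (T.mapVert g).Mono := by
  induction T with
  | leaf a => trivial
  | node x t c ih => exact fun i => ⟨(h i).1.mapVert g, ih i (h i).2⟩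

theorem Mono.mapParam {T : DTree A α} (h : T.Mono) {r : unitInterval → unitInterval}
    (hr : Monotone r) : (T.mapParam r).Mono := by
  induction T with
  | leaf a => trivial
  | node x t c ih => exact fun i => ⟨(h i).1.mapParam hr, ih i (h i).2⟩

theorem Mono.relabel {T : DTree A α} (h : T.Mono) (f : Fin T.numLeaves → β) :
    (T.relabel f).Mono := by
  induction T with
  | leaf a => trivial
  | node x t c ih => exact fun i => ⟨(h i).1.relabel _, ih i (h i).2 _⟩

/-! #### Invariance of composites -/

section eval

variable (P : TopOperad.{w}) (g : ∀ n, A n → P.obj n)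

/-- The composites of `T` and `T'` agree up to the permutation of the leaves given by the labels. -/
def EvalEq (T T' : DTree A α) : Prop :=
  ∃ e : Fin T.numLeaves ≃ Fin T'.numLeaves,
    (∀ j, T.label j = T'.label (e j)) ∧ T.eval P g = P.act e (T'.eval P g)

end eval

end DTree

namespace DTree

variable {A : ℕ → Type u} {B : ℕ → Type u} {α : Type v} {β : Type w}

/-! #### The topology on the set of labelled trees -/

/-- Planar trees with labelled leaves. -/
inductive Shape (α : Type v) : Type v
  | leaf : α → Shape α
  | node : (n : ℕ) → (Fin n → Shape α) → Shape α

namespace Shape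

/-- The set of vertices. -/
def Vert : Shape α → Type
  | leaf _ => Empty
  | node n c => Option (Σ i : Fin n, (c i).Vert)

/-- The number of inputs of a vertex. -/
def arity : (S : Shape α) → S.Vert → ℕ
  | leaf _ => Empty.elim
  | node n c => fun v => Option.rec n (fun p => (c p.1).arity p.2) v

/-- The labelled tree of shape `S` with given labels and parameters of the vertices. -/
def tree : (S : Shape α) → (∀ v : S.Vert, A (S.arity v)) → (S.Vert → unitInterval) → DTree A α
  | leaf a, _, _ => DTree.leaf a
  | node n c, x, t => DTree.node (n := n) (x none) (t none) fun i =>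
      (c i).tree (fun v => x (some ⟨i, v⟩)) (fun v => t (some ⟨i, v⟩))

end Shape

/-- The topology of the coproduct `∐_S ∏_v A(|v|) × [0,1]` over all shapes `S`. -/
instance instTopologicalSpace [∀ n, TopologicalSpace (A n)] : TopologicalSpace (DTree A α) :=
  ⨆ S : Shape α,
    coinduced
      (fun p : (∀ v : S.Vert, A (S.arity v)) × (S.Vert → unitInterval) => S.tree p.1 p.2)
      (compactlyGenerated.{u} ((∀ v : S.Vert, A (S.arity v)) × (S.Vert → unitInterval)))

end DTree

/-! ### The Boardman-Vogt resolution -/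

section BV

variable (O : TopOperad.{u})

/-- The relations defining the Boardman-Vogt resolution. Here the parameter of a vertex is the
length of its output edge. -/
inductive BVBase {α : Type v} : DTree O.obj α → DTree O.obj α → Prop
  | unit (s : unitInterval) (T : DTree O.obj α) :
      BVBase (.node O.unit s fun _ => T) (T.raise s)
  | perm {n n' : ℕ} (e : Fin n ≃ Fin n') (x : O.obj n') (s : unitInterval)
      (c : Fin n' → DTree O.obj α) :
      BVBase (.node (O.act e x) s fun i => c (e i)) (.node x s c)
  | contract {n : ℕ} {m : Fin n → ℕ} (x : O.obj n) (s : unitInterval) (c : Fin n → DTree O.obj α)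
      (y : ∀ i, O.obj (m i)) (d : Fin (∑ i, m i) → DTree O.obj α) :
      (∀ i, DTree.Absorb O.unit 0 (c i) (y i) fun k => d (finSigmaFinEquiv ⟨i, k⟩)) →
      BVBase (.node x s c) (.node (O.comp x y) s d)

/-- Trees whose vertices are labelled by points of `O` and whose inner edges have a length in
`[0,1]`. The length of an inner edge is the parameter of its source vertex; the parameter of the
root, which is not the source of an inner edge, is the dummy value `1`. -/
def PreBV (n : ℕ) : Type u := {T : DTree O.obj (Fin n) // T.IsLabelled ∧ T.RootOne}

/-- The relation generating the equivalence relation on `PreBV`. -/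
def PreBV.Step {n : ℕ} (X Y : PreBV O n) : Prop := DTree.Locally (BVBase O) X.1 Y.1

/-- The spaces of the Boardman-Vogt resolution of `O`. -/
def BV (n : ℕ) : Type u := Quot (PreBV.Step O (n := n))

instance (n : ℕ) : TopologicalSpace (PreBV O n) :=
  inferInstanceAs (TopologicalSpace {T : DTree O.obj (Fin n) // T.IsLabelled ∧ T.RootOne})

instance (n : ℕ) : TopologicalSpace (BV O n) :=
  inferInstanceAs (TopologicalSpace (Quot (PreBV.Step O (n := n))))

variable {O}

namespace PreBV

/-- The corolla labelled by `a`. -/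
def corolla {n : ℕ} (a : O.obj n) : PreBV O n :=
  ⟨DTree.corolla a 1, DTree.isLabelled_corolla a 1, rfl⟩

def act {m n : ℕ} (e : Fin m ≃ Fin n) (X : PreBV O n) : PreBV O m :=
  ⟨X.1.map e.symm, X.2.1.map e.symm, X.2.2.map _⟩

/-- Grafting; the new inner edges have length `1`. -/
def comp {n : ℕ} {m : Fin n → ℕ} (X : PreBV O n) (Y : ∀ i, PreBV O (m i)) :
    PreBV O (∑ i, m i) :=
  ⟨X.1.graft fun i => (Y i).1, X.2.1.graft fun i => (Y i).2.1,
    X.2.2.bind fun i => (Y i).2.2.map _⟩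

end PreBV

end BV

/-! #### Well-definedness -/

/-- A function of a finite family which is compatible with relations in each variable depends only
on the classes of the members of the family. -/
theorem quot_pi_congr {ι : Type*} [Fintype ι] [DecidableEq ι] {A : ι → Type*} {C : Type*}
    (r : ∀ i, A i → A i → Prop) (F : (∀ i, A i) → C)
    (h : ∀ (y : ∀ i, A i) (i : ι) (t : A i), r i (y i) t → F y = F (Function.update y i t))
    (y y' : ∀ i, A i) (hy : ∀ i, Quot.mk (r i) (y i) = Quot.mk (r i) (y' i)) : F y = F y' := by
  have key : ∀ (y : ∀ i, A i) (i : ι) (t : A i), Quot.mk (r i) (y i) = Quot.mk (r i) t →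
      F y = F (Function.update y i t) := by
    intro y i t hq
    have h' : ∀ s s' : A i, r i s s' → F (Function.update y i s) = F (Function.update y i s') := by
      intro s s' hs
      have := h (Function.update y i s) i s' (by simpa using hs)
      simpa using this
    have := congrArg (Quot.lift (fun s => F (Function.update y i s)) h') hq
    simpa using this
  have main : ∀ s : Finset ι, F y = F (fun i => if i ∈ s then y' i else y i) := by
    intro s
    induction s using Finset.induction_on with
    | empty => simp
    | insert a s ha ih =>
      rw [ih, key _ a (y' a) (by simpa [ha] using hy a)]
      congr 1
      funext i
      by_cases hi : i = a
      · subst hi; simp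
      · simp [hi]
  simpa using main Finset.univ

namespace DTree

variable {A : ℕ → Type u} {α : Type v} {β : Type w}

theorem Locally.bind {R : DTree A α → DTree A α → Prop} {R' : DTree A β → DTree A β → Prop}
    (f : α → DTree A β) (hR : ∀ T T', R T T' → R' (T.bind f) (T'.bind f)) {T T' : DTree A α}
    (h : Locally R T T') : Locally R' (T.bind f) (T'.bind f) := by
  induction h with
  | base h => exact .base (hR _ _ h)
  | node x t c c' i hc _ ih => exact .node x t _ _ i (fun j hj => by rw [hc j hj]) ih

theorem bind_congr_of_mult [DecidableEq α] (T : DTree A α) (a : α) (hT : T.mult a = 0)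
    (f f' : α → DTree A β) (hf : ∀ b, b ≠ a → f b = f' b) : T.bind f = T.bind f' := by
  induction T with
  | leaf b =>
    refine hf b fun h => ?_
    simp [mult, h] at hT
  | node x t c ih =>
    simp only [mult, Finset.sum_eq_zero_iff] at hT
    simp only [DTree.bind]
    congr 1
    funext i
    exact ih i (hT i (Finset.mem_univ i))

/-- If `a` labels exactly one leaf of `T`, a local change of the tree grafted on `a` is a local
change of the result. -/
theorem Locally.bind_right [DecidableEq α] {R : DTree A β → DTree A β → Prop} (T : DTree A α)
    (a : α) (hT : T.mult a = 1) (f f' : α → DTree A β) (hf : ∀ b, b ≠ a → f b = f' b)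
    (h : Locally R (f a) (f' a)) : Locally R (T.bind f) (T.bind f') := by
  induction T with
  | leaf b =>
    have : b = a := by
      by_contra hb
      simp [mult, hb] at hT
    subst this
    exact h
  | node x t c ih =>
    simp only [mult] at hT
    obtain ⟨i, -, hi⟩ : ∃ i ∈ Finset.univ, (c i).mult a ≠ 0 := by
      by_contra hcon
      push Not at hcon
      rw [Finset.sum_eq_zero hcon] at hT
      exact zero_ne_one hT
    have hle := Finset.add_sum_erase Finset.univ (fun i => (c i).mult a) (Finset.mem_univ i)
    simp only [hT] at hle
    have h1 : (c i).mult a = 1 := by omega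
    have h0 : ∑ j ∈ Finset.univ.erase i, (c j).mult a = 0 := by omega
    rw [Finset.sum_eq_zero_iff] at h0
    refine .node x t _ _ i (fun j hj => ?_) (ih i h1)
    exact bind_congr_of_mult _ a (h0 j (by simp [hj])) f f' hf

theorem raise_bind {T : DTree A α} (s : unitInterval) {f : α → DTree A β}
    (hf : ∀ a, (f a).RootOne) : (T.bind f).raise s = (T.raise s).bind f := by
  cases T with
  | leaf a =>
    have := hf a
    simp only [DTree.bind, raise]
    generalize f a = S at this
    cases S with
    | leaf b => rfl
    | node x t c =>
      obtain rfl : t = 1 := this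
      simp only [max_eq_right (unitInterval.le_one' (t := s))]
  | node x t c => rfl

theorem Absorb.bind {u : A 1} {τ : unitInterval} {T : DTree A α} {m : ℕ} {y : A m}
    {d : Fin m → DTree A α} (h : Absorb u τ T y d) (f : α → DTree A β) :
    Absorb u τ (T.bind f) y fun k => (d k).bind f := by
  cases h with
  | merge y d => exact .merge y _
  | keep T => exact .keep _

end DTree

section BV

variable {O : TopOperad.{u}}

theorem BVBase.bind {α : Type v} {β : Type w} {f : α → DTree O.obj β} (hf : ∀ a, (f a).RootOne)
    {T T' : DTree O.obj α} (h : BVBase O T T') : BVBase O (T.bind f) (T'.bind f) := by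
  cases h with
  | unit s T => rw [← DTree.raise_bind s hf]; exact .unit s _
  | perm e x s c => exact .perm e x s fun i => (c i).bind f
  | contract x s c y d h => exact .contract x s _ y _ fun i => (h i).bind f

theorem DTree.label_node {A : ℕ → Type u} {α : Type v} {n : ℕ} (x : A n) (t : unitInterval)
    (c : Fin n → DTree A α) (p : Σ i, Fin (c i).numLeaves) :
    (DTree.node x t c).label (finSigmaFinEquiv p) = (c p.1).label p.2 := by
  change (c (finSigmaFinEquiv.symm (finSigmaFinEquiv p)).1).label
    (finSigmaFinEquiv.symm (finSigmaFinEquiv p)).2 = _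
  rw [Equiv.symm_apply_apply]

namespace DTree.EvalEq

variable {A : ℕ → Type u} {α : Type v} {P : TopOperad.{w}} {g : ∀ n, A n → P.obj n}

theorem refl (T : DTree A α) : EvalEq P g T T :=
  ⟨Equiv.refl _, fun _ => rfl, (P.act_refl _).symm⟩

theorem symm {T T' : DTree A α} (h : EvalEq P g T T') : EvalEq P g T' T := by
  obtain ⟨e, hl, he⟩ := h
  refine ⟨e.symm, fun j => by simp [hl], ?_⟩
  rw [he, P.act_act, Equiv.symm_trans_self, P.act_refl]

theorem trans {T T' T'' : DTree A α} (h : EvalEq P g T T') (h' : EvalEq P g T' T'') :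
    EvalEq P g T T'' := by
  obtain ⟨e, hl, he⟩ := h
  obtain ⟨e', hl', he'⟩ := h'
  exact ⟨e.trans e', fun j => by simp [hl, hl'], by rw [he, he', P.act_act]⟩

theorem node {n : ℕ} (x : A n) (t t' : unitInterval) {c c' : Fin n → DTree A α}
    (h : ∀ i, EvalEq P g (c i) (c' i)) : EvalEq P g (.node x t c) (.node x t' c') := by
  choose e hl he using h
  refine ⟨sumEquiv e, fun j => ?_, ?_⟩
  · obtain ⟨p, rfl⟩ := finSigmaFinEquiv.surjective j
    refine (label_node x t c p).trans ?_
    refine (hl p.1 p.2).trans ((label_node x t' c' ⟨p.1, e p.1 p.2⟩).symm.trans ?_)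
    exact congrArg (DTree.node x t' c').label (sumEquiv_apply e p).symm
  · change P.comp (g _ x) (fun i => (c i).eval P g) = _
    simp only [he]
    exact P.comp_act e _ _

theorem unit {x : A 1} (hx : g 1 x = P.unit) (t : unitInterval) (T : DTree A α) :
    EvalEq P g (.node x t fun _ => T) T := by
  refine ⟨oneBlockEquiv T.numLeaves, fun j => ?_, ?_⟩
  · obtain ⟨p, rfl⟩ := finSigmaFinEquiv.surjective j
    refine (label_node x t _ p).trans ?_
    exact congrArg T.label (oneBlockEquiv_apply T.numLeaves p).symm
  · change P.comp (g 1 x) (fun _ => T.eval P g) = _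
    rw [hx]
    exact P.unit_comp _

theorem perm {n n' : ℕ} (e : Fin n ≃ Fin n') {x' : A n} {x : A n'}
    (hx : g n x' = P.act e (g n' x)) (t : unitInterval) (c : Fin n' → DTree A α) :
    EvalEq P g (.node x' t fun i => c (e i)) (.node x t c) := by
  refine ⟨blockEquiv e fun i => (c i).numLeaves, fun j => ?_, ?_⟩
  · obtain ⟨p, rfl⟩ := finSigmaFinEquiv.surjective j
    refine (label_node x' t _ p).trans ?_
    refine (label_node x t c ⟨e p.1, p.2⟩).symm.trans ?_
    exact congrArg (DTree.node x t c).label (blockEquiv_apply e (fun i => (c i).numLeaves) p).symm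
  · change P.comp (g n x') (fun i => (c (e i)).eval P g) = _
    rw [hx]
    exact P.act_comp e _ fun i => (c i).eval P g

theorem contract {n : ℕ} {m : Fin n → ℕ} {x : A n} {y : ∀ i, A (m i)} {z : A (∑ i, m i)}
    (hz : g _ z = P.comp (g _ x) fun i => g _ (y i)) {u : A 1} (hu : g 1 u = P.unit)
    (s τ : unitInterval) {c : Fin n → DTree A α} {d : Fin (∑ i, m i) → DTree A α}
    (h : ∀ i, Absorb u τ (c i) (y i) fun k => d (finSigmaFinEquiv ⟨i, k⟩)) :
    EvalEq P g (.node x s c) (.node z s d) := by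
  have h1 : ∀ i, EvalEq P g (c i) (.node (y i) τ fun k => d (finSigmaFinEquiv ⟨i, k⟩)) := by
    intro i
    have hi := h i
    revert hi
    generalize c i = T
    generalize (fun k => d (finSigmaFinEquiv ⟨i, k⟩)) = d'
    generalize y i = y'
    generalize m i = m'  at y' d'
    intro hi
    cases hi with
    | merge => exact refl _
    | keep => exact (unit hu τ T).symm
  refine (node x s s h1).trans (symm ?_)
  refine ⟨assocEquiv m fun j => (d j).numLeaves, fun j => ?_, ?_⟩
  · obtain ⟨⟨q, l⟩, rfl⟩ := finSigmaFinEquiv.surjective j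
    obtain ⟨⟨i, k⟩, rfl⟩ := finSigmaFinEquiv.surjective q
    refine (label_node z s d _).trans ?_
    refine Eq.trans (Eq.symm ((label_node x s
      (fun i => .node (y i) τ fun k => d (finSigmaFinEquiv ⟨i, k⟩))
      ⟨i, finSigmaFinEquiv ⟨k, l⟩⟩).trans
        (label_node (y i) τ (fun k => d (finSigmaFinEquiv ⟨i, k⟩)) ⟨k, l⟩))) ?_
    exact congrArg
      (DTree.node x s fun i => .node (y i) τ fun k => d (finSigmaFinEquiv ⟨i, k⟩)).label
      (assocEquiv_apply m (fun j => (d j).numLeaves) i k l).symm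
  · change P.comp (g _ z) (fun i => (d i).eval P g) = _
    rw [hz]
    exact P.comp_comp _ _ _

theorem locally {R : DTree A α → DTree A α → Prop} (hR : ∀ T T', R T T' → EvalEq P g T T')
    {T T' : DTree A α} (h : Locally R T T') : EvalEq P g T T' := by
  induction h with
  | base h => exact hR _ _ h
  | node x t c c' i hc _ ih =>
    refine node x t t fun j => ?_
    by_cases hj : j = i
    · subst hj; exact ih
    · rw [hc j hj]; exact refl _

end DTree.EvalEq

theorem DTree.EvalEq.raise {A : ℕ → Type u} {α : Type v} {P : TopOperad.{w}}
    {g : ∀ n, A n → P.obj n} (s : unitInterval) (T : DTree A α) : EvalEq P g T (T.raise s) := by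
  cases T with
  | leaf a => exact .refl _
  | node x t c => exact .node x t _ fun _ => .refl _

/-- Related trees have the same composite. -/
theorem BVBase.evalEq {α : Type v} {T T' : DTree O.obj α} (h : BVBase O T T') :
    DTree.EvalEq O (fun _ x => x) T T' := by
  cases h with
  | unit s T => exact (DTree.EvalEq.unit rfl s T).trans (.raise s T)
  | perm e x s c => exact .perm e rfl s c
  | contract x s c y d h => exact .contract rfl rfl s 0 h

namespace DTree

/-- The composite of the labels of the vertices of a tree with `n` leaves, as an element of
`P(n)`. -/
noncomputable def value {A : ℕ → Type u} (P : TopOperad.{w}) (g : ∀ n, A n → P.obj n) {n : ℕ}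
    (T : DTree A (Fin n)) (h : T.IsLabelled) : P.obj n :=
  P.act (Equiv.ofBijective T.label h).symm (T.eval P g)

theorem EvalEq.value_eq {A : ℕ → Type u} {P : TopOperad.{w}} {g : ∀ n, A n → P.obj n} {n : ℕ}
    {T T' : DTree A (Fin n)} (h : EvalEq P g T T') (hT : T.IsLabelled) (hT' : T'.IsLabelled) :
    T.value P g hT = T'.value P g hT' := by
  obtain ⟨e, hl, he⟩ := h
  rw [value, value, he, P.act_act]
  congr 1
  ext j
  congr 1
  rw [Equiv.trans_apply]
  refine ((Equiv.ofBijective T'.label hT').symm_apply_eq.2 ?_).symm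
  exact ((Equiv.ofBijective T.label hT).apply_symm_apply j).symm.trans (hl _)

end DTree

namespace BV

/-- The class of a tree. -/
def mk {n : ℕ} (X : PreBV O n) : BV O n := Quot.mk _ X

/-- The map `ι : O → BV(O)`. -/
def ι {n : ℕ} (a : O.obj n) : BV O n := mk (PreBV.corolla a)

/-- The map `μ : BV(O) → O`, which composes the labels of the vertices. -/
noncomputable def μ {n : ℕ} : BV O n → O.obj n :=
  Quot.lift (fun X => X.1.value O (fun _ x => x) X.2.1) fun X Y h =>
    (DTree.EvalEq.locally (fun _ _ => BVBase.evalEq) h).value_eq X.2.1 Y.2.1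

/-- The action of the symmetric groups on `BV(O)`. -/
def act {m n : ℕ} (e : Fin m ≃ Fin n) : BV O n → BV O m :=
  Quot.map (PreBV.act e) fun _ _ h =>
    DTree.Locally.bind _
      (fun _ _ => BVBase.bind (f := fun a => .leaf (e.symm a)) fun _ => trivial) h

/-- The operadic composition of `BV(O)`: graft trees, the new inner edges having length `1`. -/
noncomputable def comp {n : ℕ} {m : Fin n → ℕ} (x : BV O n) (y : ∀ i, BV O (m i)) :
    BV O (∑ i, m i) :=
  mk (PreBV.comp (Quot.out x) fun i => Quot.out (y i))

/-- The composition does not depend on the choice of representatives. -/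
theorem comp_mk {n : ℕ} {m : Fin n → ℕ} (X : PreBV O n) (Y : ∀ i, PreBV O (m i)) :
    comp (mk X) (fun i => mk (Y i)) = mk (PreBV.comp X Y) := by
  have h1 : ∀ X' : PreBV O n, mk X' = mk X → ∀ Z : ∀ i, PreBV O (m i),
      mk (PreBV.comp X' Z) = mk (PreBV.comp X Z) := by
    intro X' h Z
    refine congrArg (Quot.lift (fun X => mk (PreBV.comp X Z)) ?_) h
    intro X X' h
    exact Quot.sound (DTree.Locally.bind _
      (fun _ _ => BVBase.bind fun i => (Z i).2.2.map _) h)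
  refine (h1 _ (Quot.out_eq _) _).trans ?_
  refine quot_pi_congr (fun _ => PreBV.Step O) (fun Z => mk (PreBV.comp X Z)) ?_ _ _
    fun i => Quot.out_eq _
  intro Z i t ht
  refine Quot.sound (DTree.Locally.bind_right X.1 i ((DTree.isLabelled_iff _).1 X.2.1 i) _ _ ?_ ?_)
  · intro j hj
    simp [Function.update_of_ne hj]
  · simp only [Function.update_self]
    exact DTree.Locally.bind _ (fun _ _ => BVBase.bind
      (f := fun k => .leaf (finSigmaFinEquiv (⟨i, k⟩ : Σ i, Fin (m i)))) fun _ => trivial) ht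

end BV

end BV

/-! ### The bimodule resolution -/

section WB

variable (O : TopOperad.{u})

/-- The relations defining the resolution of `O` as a bimodule over itself. -/
inductive WBBase {α : Type v} : DTree (BV O) α → DTree (BV O) α → Prop
  | unit (t : unitInterval) (T : DTree (BV O) α) : WBBase (.node (BV.ι O.unit) t fun _ => T) T
  | perm {n n' : ℕ} (e : Fin n ≃ Fin n') (x : BV O n') (t : unitInterval)
      (c : Fin n' → DTree (BV O) α) :
      WBBase (.node (BV.act e x) t fun i => c (e i)) (.node x t c)
  | contract {n : ℕ} {m : Fin n → ℕ} (x : BV O n) (t : unitInterval) (c : Fin n → DTree (BV O) α)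
      (y : ∀ i, BV O (m i)) (d : Fin (∑ i, m i) → DTree (BV O) α) :
      (∀ i, DTree.Absorb (BV.ι O.unit) t (c i) (y i) fun k => d (finSigmaFinEquiv ⟨i, k⟩)) →
      WBBase (.node x t c) (.node (BV.comp x y) t d)
  | proj {n : ℕ} (x : BV O n) (t : unitInterval) (ht : t = 0 ∨ t = 1)
      (c : Fin n → DTree (BV O) α) :
      WBBase (.node x t c) (.node (BV.ι (BV.μ x)) t c)

/-- Trees whose vertices are labelled by points of `BV(O)` and by real numbers in `[0,1]` which
increase from the root to the leaves. -/
def PreWB (n : ℕ) : Type u := {T : DTree (BV O) (Fin n) // T.IsLabelled ∧ T.Mono}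

/-- The relation generating the equivalence relation on `PreWB`. -/
def PreWB.Step {n : ℕ} (X Y : PreWB O n) : Prop := DTree.Locally (WBBase O) X.1 Y.1

/-- The spaces of the bimodule resolution of `O`. -/
def WB (n : ℕ) : Type u := Quot (PreWB.Step O (n := n))

instance (n : ℕ) : TopologicalSpace (PreWB O n) :=
  inferInstanceAs (TopologicalSpace {T : DTree (BV O) (Fin n) // T.IsLabelled ∧ T.Mono})

instance (n : ℕ) : TopologicalSpace (WB O n) :=
  inferInstanceAs (TopologicalSpace (Quot (PreWB.Step O (n := n))))

variable {O}

theorem WBBase.bind {α : Type v} {β : Type w} (f : α → DTree (BV O) β)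
    {T T' : DTree (BV O) α} (h : WBBase O T T') : WBBase O (T.bind f) (T'.bind f) := by
  cases h with
  | unit t T => exact .unit t _
  | perm e x s c => exact .perm e x s fun i => (c i).bind f
  | contract x s c y d h => exact .contract x s _ y _ fun i => (h i).bind f
  | proj x t ht c => exact .proj x t ht _

theorem DTree.mono_corolla {A : ℕ → Type u} {n : ℕ} (x : A n) (t : unitInterval) :
    (DTree.corolla x t).Mono := fun _ => ⟨trivial, trivial⟩

namespace PreWB

def act {m n : ℕ} (e : Fin m ≃ Fin n) (X : PreWB O n) : PreWB O m :=
  ⟨X.1.map e.symm, X.2.1.map e.symm, X.2.2.map _⟩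

/-- Graft on every leaf a corolla labelled by a point of `O` and by `1`. -/
def right {n : ℕ} {m : Fin n → ℕ} (X : PreWB O n) (a : ∀ i, O.obj (m i)) :
    PreWB O (∑ i, m i) :=
  ⟨X.1.graft fun i => DTree.corolla (BV.ι (a i)) 1,
    X.2.1.graft fun _ => DTree.isLabelled_corolla _ _,
    X.2.2.bind fun _ => ⟨rfl, (DTree.mono_corolla _ _).map _⟩⟩

/-- Graft trees on the leaves of a corolla labelled by a point of `O` and by `0`. -/
def left {n : ℕ} {m : Fin n → ℕ} (a : O.obj n) (Y : ∀ i, PreWB O (m i)) :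
    PreWB O (∑ i, m i) :=
  ⟨(DTree.corolla (BV.ι a) 0).graft fun i => (Y i).1,
    (DTree.isLabelled_corolla _ _).graft fun i => (Y i).2.1,
    fun i => ⟨DTree.rootGE_zero _, (Y i).2.2.map _⟩⟩

end PreWB

namespace WB

/-- The class of a tree. -/
def mk {n : ℕ} (X : PreWB O n) : WB O n := Quot.mk _ X

def act {m n : ℕ} (e : Fin m ≃ Fin n) : WB O n → WB O m :=
  Quot.map (PreWB.act e) fun _ _ h => DTree.Locally.bind _ (fun _ _ => WBBase.bind _) h

def right {n : ℕ} {m : Fin n → ℕ} (x : WB O n) (a : ∀ i, O.obj (m i)) : WB O (∑ i, m i) :=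
  Quot.map (fun X => PreWB.right X a)
    (fun _ _ h => DTree.Locally.bind _ (fun _ _ => WBBase.bind _) h) x

noncomputable def left {n : ℕ} {m : Fin n → ℕ} (a : O.obj n) (y : ∀ i, WB O (m i)) :
    WB O (∑ i, m i) :=
  mk (PreWB.left a fun i => Quot.out (y i))

/-- The left operation does not depend on the choice of representatives. -/
theorem left_mk {n : ℕ} {m : Fin n → ℕ} (a : O.obj n) (Y : ∀ i, PreWB O (m i)) :
    left a (fun i => mk (Y i)) = mk (PreWB.left a Y) := by
  refine quot_pi_congr (fun _ => PreWB.Step O) (fun Z => mk (PreWB.left a Z)) ?_ _ _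
    fun i => Quot.out_eq _
  intro Z i t ht
  refine Quot.sound (DTree.Locally.bind_right _ i
    ((DTree.isLabelled_iff _).1 (DTree.isLabelled_corolla _ _) i) _ _ ?_ ?_)
  · intro j hj
    simp [Function.update_of_ne hj]
  · simp only [Function.update_self]
    exact DTree.Locally.bind _ (fun _ _ => WBBase.bind _) ht

end WB

/-! ### The filtration by geometrical inputs -/

namespace DTree

/-- The number of geometrical inputs of the component at the root, made of the vertices whose
parameter is not `1`: the number of its leaves plus the number of univalent vertices of its
auxiliary trees. -/
noncomputable def inputs {α : Type v} : DTree (PreBV O) α → ℕ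
  | leaf _ => 1
  | node x t c => open Classical in
      if t = 1 then 1 else x.1.univalents + ∑ i, (c i).inputs

/-- Once the vertices with parameters `0` and `1` are removed, the remaining components have at most
`k` geometrical inputs. (An edge from a vertex with parameter `0`, or from the trunk, to a vertex
with parameter `1` or to a leaf is a component with one input.) -/
def Filtered (k : ℕ) {α : Type v} : DTree (PreBV O) α → Prop
  | leaf _ => 1 ≤ k
  | node x t c => open Classical in
      if t = 0 then ∀ i, (c i).Filtered k else (node x t c).inputs ≤ k

theorem filtered_node_zero {k : ℕ} {α : Type v} {n : ℕ} (x : PreBV O n)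
    (c : Fin n → DTree (PreBV O) α) (h : ∀ i, (c i).Filtered k) : (node x 0 c).Filtered k := by
  simpa only [Filtered, if_true] using h

theorem mapVert_bind {A B : ℕ → Type u} {α : Type v} {β : Type w} (g : ∀ n, A n → B n)
    (T : DTree A α) (f : α → DTree A β) :
    (T.bind f).mapVert g = (T.mapVert g).bind fun a => (f a).mapVert g := by
  induction T with
  | leaf a => rfl
  | node x t c ih => simp only [bind, mapVert, ih]

theorem inputs_bind {α : Type v} {β : Type w} (T : DTree (PreBV O) α)
    (f : α → DTree (PreBV O) β) (hf : ∀ a, (f a).RootOne) : (T.bind f).inputs = T.inputs := by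
  induction T with
  | leaf a =>
    have := hf a
    simp only [bind, inputs]
    generalize f a = S at this
    cases S with
    | leaf b => rfl
    | node x t c =>
      obtain rfl : t = 1 := this
      simp [inputs]
  | node x t c ih => simp only [bind, inputs, ih]

theorem Filtered.bind {k : ℕ} {α : Type v} {β : Type w} {T : DTree (PreBV O) α}
    (h : T.Filtered k) {f : α → DTree (PreBV O) β} (hf : ∀ a, (f a).RootOne) :
    (T.bind f).Filtered k := by
  induction T with
  | leaf a =>
    have := hf a
    simp only [DTree.bind]
    generalize f a = S at this
    cases S with
    | leaf b => exact h
    | node x t c =>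
      obtain rfl : t = 1 := this
      simpa [Filtered, inputs] using h
  | node x t c ih =>
    simp only [DTree.bind, Filtered] at h ⊢
    split_ifs with ht
    · exact fun i => ih i (by rw [if_pos ht] at h; exact h i)
    · rw [if_neg ht] at h
      rw [← inputs_bind _ f hf] at h
      exact h

end DTree

variable (O)

/-- Main trees together with auxiliary trees: trees whose vertices are labelled by representatives
of points of `BV(O)`, and by real numbers which increase from the root to the leaves. Only those
in the `k`-th filtration term are considered. -/
def PreWBk (k n : ℕ) : Type u :=
  {D : DTree (PreBV O) (Fin n) // D.IsLabelled ∧ D.Mono ∧ D.Filtered k}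

instance (k n : ℕ) : TopologicalSpace (PreWBk O k n) :=
  inferInstanceAs (TopologicalSpace
    {D : DTree (PreBV O) (Fin n) // D.IsLabelled ∧ D.Mono ∧ D.Filtered k})

variable {O}

/-- The point of `WB(O)` represented by a main tree with auxiliary trees. -/
def PreWBk.toWB {k n : ℕ} (D : PreWBk O k n) : WB O n :=
  WB.mk ⟨D.1.mapVert fun _ => BV.mk, D.2.1.mapVert _, D.2.2.1.mapVert _⟩

variable (O)

/-- The `k`-th filtration term of `WB(O)`. -/
def WBk (k n : ℕ) : Type u := {x : WB O n // ∃ D : PreWBk O k n, D.toWB = x}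

variable {O}

namespace WBk

/-- The class of a main tree with auxiliary trees. -/
def mk {k n : ℕ} (D : PreWBk O k n) : WBk O k n := ⟨D.toWB, D, rfl⟩

/-- As for `WB(O)` itself, the filtration term is topologized as the quotient of the space of trees
(with auxiliary trees) representing its points. -/
instance (k n : ℕ) : TopologicalSpace (WBk O k n) :=
  coinduced (mk : PreWBk O k n → WBk O k n) inferInstance

def act {k m n : ℕ} (e : Fin m ≃ Fin n) (x : WBk O k n) : WBk O k m :=
  ⟨WB.act e x.1, by
    obtain ⟨x, D, rfl⟩ := x
    refine ⟨⟨D.1.map e.symm, D.2.1.map e.symm, D.2.2.1.map _, D.2.2.2.bind fun _ => trivial⟩, ?_⟩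
    exact congrArg WB.mk (Subtype.ext (DTree.mapVert_bind _ _ _))⟩

def right {k n : ℕ} {m : Fin n → ℕ} (x : WBk O k n) (a : ∀ i, O.obj (m i)) :
    WBk O k (∑ i, m i) :=
  ⟨WB.right x.1 a, by
    obtain ⟨x, D, rfl⟩ := x
    refine ⟨⟨D.1.graft fun i => DTree.corolla (PreBV.corolla (a i)) 1,
      D.2.1.graft fun _ => DTree.isLabelled_corolla _ _,
      D.2.2.1.bind fun _ => ⟨rfl, (DTree.mono_corolla _ _).map _⟩,
      D.2.2.2.bind fun _ => rfl⟩, ?_⟩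
    exact congrArg WB.mk (Subtype.ext (DTree.mapVert_bind _ _ _))⟩

noncomputable def left {k n : ℕ} {m : Fin n → ℕ} (a : O.obj n) (y : ∀ i, WBk O k (m i)) :
    WBk O k (∑ i, m i) :=
  ⟨WB.left a fun i => (y i).1, by
    choose D hD using fun i => (y i).2
    refine ⟨⟨(DTree.corolla (PreBV.corolla a) 0).graft fun i => (D i).1,
      (DTree.isLabelled_corolla _ _).graft fun i => (D i).2.1,
      fun i => ⟨DTree.rootGE_zero _, (D i).2.2.1.map _⟩, ?_⟩, ?_⟩
    · exact DTree.filtered_node_zero _ _ fun i => (D i).2.2.2.bind fun _ => trivial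
    · simp only [← hD]
      refine Eq.trans ?_ (WB.left_mk a _).symm
      refine congrArg WB.mk (Subtype.ext ((DTree.mapVert_bind _ _ _).trans ?_))
      refine congrArg (DTree.bind _) (funext fun i => ?_)
      exact DTree.mapVert_bind _ _ _⟩

end WBk

end WB

/-! ### Bimodules and mapping spaces -/

/-- The underlying spaces and structure maps of a bimodule over `O`. The axioms of a bimodule play
no role for the notion of a map, so they are not recorded; this is only used for the concrete
bimodules below. -/
structure BimodData (O : TopOperad.{u}) where
  obj : ℕ → Type u
  [top : ∀ n, TopologicalSpace (obj n)]
  act : ∀ {m n : ℕ}, (Fin m ≃ Fin n) → obj n → obj m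
  right : ∀ {n : ℕ} {m : Fin n → ℕ}, obj n → (∀ i, O.obj (m i)) → obj (∑ i, m i)
  left : ∀ {n : ℕ} {m : Fin n → ℕ}, O.obj n → (∀ i, obj (m i)) → obj (∑ i, m i)

attribute [instance] BimodData.top

/-- Maps of bimodules over `O`. -/
structure BimodHom {O : TopOperad.{u}} (M N : BimodData O) where
  toFun : ∀ n, C(M.obj n, N.obj n)
  map_act : ∀ {m n : ℕ} (e : Fin m ≃ Fin n) (x : M.obj n),
    toFun m (M.act e x) = N.act e (toFun n x)
  map_right : ∀ {n : ℕ} {m : Fin n → ℕ} (x : M.obj n) (a : ∀ i, O.obj (m i)),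
    toFun _ (M.right x a) = N.right (toFun n x) a
  map_left : ∀ {n : ℕ} {m : Fin n → ℕ} (a : O.obj n) (y : ∀ i, M.obj (m i)),
    toFun _ (M.left a y) = N.left a fun i => toFun _ (y i)

/-- The mapping space of bimodules: a subspace of the product of the mapping spaces with their
compact-open topologies, made compactly generated. -/
instance {O : TopOperad.{u}} (M N : BimodData O) : TopologicalSpace (BimodHom M N) :=
  @compactlyGenerated.{u} (BimodHom M N) (induced BimodHom.toFun inferInstance)

/-- The underlying spaces and structure maps of a `k`-truncated bimodule over `O`. -/
structure TruncBimodData (O : TopOperad.{u}) (k : ℕ) where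
  obj : Set.Iic k → Type u
  [top : ∀ n, TopologicalSpace (obj n)]
  act : ∀ {m n : Set.Iic k}, (Fin m ≃ Fin n) → obj n → obj m
  right : ∀ {n : Set.Iic k} {m : Fin n → ℕ} (h : ∑ i, m i ≤ k), obj n → (∀ i, O.obj (m i)) →
    obj ⟨∑ i, m i, h⟩
  left : ∀ {n : ℕ} {m : Fin n → Set.Iic k} (h : ∑ i, (m i : ℕ) ≤ k), O.obj n →
    (∀ i, obj (m i)) → obj ⟨∑ i, (m i : ℕ), h⟩

attribute [instance] TruncBimodData.top

/-- Maps of `k`-truncated bimodules over `O`. -/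
structure TruncBimodHom {O : TopOperad.{u}} {k : ℕ} (M N : TruncBimodData O k) where
  toFun : ∀ n, C(M.obj n, N.obj n)
  map_act : ∀ {m n : Set.Iic k} (e : Fin m ≃ Fin n) (x : M.obj n),
    toFun m (M.act e x) = N.act e (toFun n x)
  map_right : ∀ {n : Set.Iic k} {m : Fin n → ℕ} (h : ∑ i, m i ≤ k) (x : M.obj n)
    (a : ∀ i, O.obj (m i)), toFun _ (M.right h x a) = N.right h (toFun n x) a
  map_left : ∀ {n : ℕ} {m : Fin n → Set.Iic k} (h : ∑ i, (m i : ℕ) ≤ k) (a : O.obj n)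
    (y : ∀ i, M.obj (m i)), toFun _ (M.left h a y) = N.left h a fun i => toFun _ (y i)

instance {O : TopOperad.{u}} {k : ℕ} (M N : TruncBimodData O k) :
    TopologicalSpace (TruncBimodHom M N) :=
  @compactlyGenerated.{u} (TruncBimodHom M N) (induced TruncBimodHom.toFun inferInstance)

/-- The truncation functor `T_k`. -/
def BimodData.trunc {O : TopOperad.{u}} (M : BimodData O) (k : ℕ) : TruncBimodData O k where
  obj n := M.obj n
  act e x := M.act e x
  right _ x a := M.right x a
  left _ a y := M.left a y

/-- The bimodule `WB(O)`. -/
noncomputable def wbBimod (O : TopOperad.{u}) : BimodData O where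
  obj := WB O
  act := WB.act
  right := WB.right
  left := WB.left

/-- The bimodule `WB_k(O)`. -/
noncomputable def wbkBimod (O : TopOperad.{u}) (k : ℕ) : BimodData O where
  obj := WBk O k
  act := WBk.act
  right := WBk.right
  left := WBk.left

/-- The bimodule over `O` underlying an operad `O'` under `O`. -/
def TopOperad.Hom.bimod {O O' : TopOperad.{u}} (η : O.Hom O') : BimodData O where
  obj := O'.obj
  act := O'.act
  right x a := O'.comp x fun i => η.toFun _ (a i)
  left a y := O'.comp (η.toFun _ a) y

/-! ### Cutting trees -/

/-- Trees with increasing parameters. -/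
abbrev MonoTree (A : ℕ → Type u) (α : Type v) : Type (max u v) := {T : DTree A α // T.Mono}

namespace DTree

variable {A : ℕ → Type u} {α : Type v}

open Classical in
/-- Keep the largest subtree containing the root all of whose vertices have a parameter satisfying
`p`; its leaves are labelled by the subtrees which have been cut off (possibly without vertices). -/
noncomputable def cut (p : unitInterval → Prop) :
    (T : DTree A α) → T.Mono → DTree A (MonoTree A α)
  | leaf a, _ => leaf ⟨leaf a, trivial⟩
  | node x t c, h =>
      if p t then node x t fun i => (c i).cut p (h i).2 else leaf ⟨node x t c, h⟩

theorem RootGE.cut {s : unitInterval} {T : DTree A α} (hs : T.RootGE s)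
    (p : unitInterval → Prop) (h : T.Mono) : (T.cut p h).RootGE s := by
  cases T with
  | leaf a => trivial
  | node x t c =>
    simp only [DTree.cut]
    split_ifs
    · exact hs
    · trivial

theorem mono_cut (p : unitInterval → Prop) (T : DTree A α) (h : T.Mono) : (T.cut p h).Mono := by
  induction T with
  | leaf a => trivial
  | node x t c ih =>
    simp only [cut]
    split_ifs with hp
    · exact fun i => ⟨(h i).1.cut p (h i).2, ih i (h i).2⟩
    · trivial

end DTree

/-- A point of `P` of some arity, whose inputs are labelled by `α`. -/
structure LabelledPoint (P : TopOperad.{u}) (α : Type v) : Type (max u v) where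
  arity : ℕ
  val : P.obj arity
  lab : Fin arity → α

namespace LabelledPoint

variable {P : TopOperad.{u}} {α : Type v} {β : Type w}

/-- Compose with the point `f a` at every input labelled by `a`. -/
def bind (x : LabelledPoint P α) (f : α → LabelledPoint P β) : LabelledPoint P β where
  arity := ∑ i, (f (x.lab i)).arity
  val := P.comp x.val fun i => (f (x.lab i)).val
  lab j := (f (x.lab (finSigmaFinEquiv.symm j).1)).lab (finSigmaFinEquiv.symm j).2

/-- The inputs are labelled bijectively, and `y` is the corresponding point of `P n`. -/
def Represents {n : ℕ} (x : LabelledPoint P (Fin n)) (y : P.obj n) : Prop :=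
  ∃ e : Fin n ≃ Fin x.arity, (∀ j, x.lab (e j) = j) ∧ y = P.act e x.val

end LabelledPoint

section assemble

variable {O O' : TopOperad.{u}} {α : Type v}

/-- `η ∘ μ` applied to a planar tree. -/
noncomputable def etaMu (η : O.Hom O') (T : DTree (BV O) α) : LabelledPoint O' α where
  arity := T.numLeaves
  val := η.toFun _ (T.eval O fun _ => BV.μ)
  lab := T.label

/-- `f` applied to a planar tree whose parameters have been rescaled by `c⁻¹`. -/
noncomputable def applyRescaled (c : LittleInterval) (f : ∀ q, WB O q → O'.obj q)
    (T : DTree (BV O) α) (h : T.Mono) : LabelledPoint O' α where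
  arity := T.numLeaves
  val := f _ (WB.mk ⟨T.planar.mapParam c.inv, T.isLabelled_planar.mapParam _,
    (h.relabel _).mapParam c.inv_mono⟩)
  lab := T.label

/-- Given intervals `c₁ < ⋯ < c_n` and functions `f₁, …, f_n`, cut the tree `T` into the pieces
below `c₁`, inside `c₁`, between `c₁` and `c₂`, and so on, the endpoints of the intervals belonging
to the gaps. Apply `f_i` to the pieces inside `c_i`, rescaled by `c_i⁻¹`, and `η ∘ μ` to the pieces
in the gaps, and compose in `O'`. -/
noncomputable def assemble (η : O.Hom O') :
    List (LittleInterval × (∀ q, WB O q → O'.obj q)) → MonoTree (BV O) α → LabelledPoint O' α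
  | [], T => etaMu η T.1
  | (c, f) :: L, T =>
      (etaMu η (T.1.cut (fun t => (t : ℝ) ≤ c.left) T.2)).bind fun T' =>
        (applyRescaled c f (T'.1.cut (fun t => (t : ℝ) < c.right) T'.2)
          (DTree.mono_cut _ _ _)).bind fun T'' => assemble η L T''

end assemble

end OperadBimod

open OperadBimod

/-!
All evaluations of planar trees are carried out in the free algebra `FreeAlg P α` over an operad
`P`: operations whose inputs are labelled by elements of `α`, up to renumbering the inputs. There a
point represented by a labelled operation is an equality (`FreeAlg.represents_iff`), and the three
evaluations needed are compatible with grafting: `treeEval` (apply `η` to the composite of all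
labels), `pieceEval` (apply a map of bimodules to a tree) and `assembleFree` (the formula for
`α_n`).

*The filtration.* A point `x` of the Boardman-Vogt resolution has a minimal number of univalent
vertices `BV.univalents x`, obtained by contracting all edges of length zero; it is attained and
additive under composition. Counting every label `x` with this weight gives a condition on trees,
`FilteredW`, which is invariant under the relations of `WB(O)` (`filteredW_iff_of_locally`) and
describes the filtration term (`exists_toWB_iff`). There is no condition for `k = ⊤`, so truncated
and untruncated maps are treated together: `IsBimodMapOn η k f` says that `f` is a map of bimodules
as far as points of arity and filtration at most `k` are concerned. The pieces into which a filtered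
tree is cut are filtered and have arity at most `k`, which is why truncated maps suffice.

*The formula is well defined.* A relation between two trees takes place inside one of the pieces, or
below or above them (`cutAt_of_locally`). In a piece belonging to an interval, a map of bimodules
respects it, since rescaling preserves the parameters `0` and `1`; in a gap, `η` composed with `μ`
respects it. This gives `assembleFree_eq_of_locally`. The left operation only affects the first gap
and the right operation the last one, so the result is a map of bimodules
(`isBimodMapOn_assembled`). The unit law is `assembleFree_id`; the composition law
`assembleFree_flatMap` follows from splitting lists of intervals (`assembleFree_append`) and from
rescaling (`assembleFree_map_comp`).

*Continuity.* Maps out of spaces of trees are tested on families of trees of fixed shape over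
compact spaces (`continuous_of_isFam`). In such a family the shapes of the pieces jump when a
parameter meets the end of an interval. But it does not matter to which side of the cut a vertex at
an end point belongs: after rescaling, it has parameter `0` or `1` in the piece of the interval, and
a map of bimodules takes it out through the left or right operation (`assembleFree_cons_bind`).
Hence the formula for a fixed decomposition, valid on one member of a finite cover of the parameter
space, remains valid on the closure of this member (`exists_pieces`, `assembleFree_eq_of_pieces`),
where it is visibly continuous, and `assemblesContinuously` follows.

*The algebra structure.* The structure `MapSpace` records what the two mapping spaces have in
common. A configuration acts by assembling along its intervals sorted from left to right
(`IsSorting`); the finitely many possible orders define a closed cover of the space of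
configurations, whence continuity. Uniqueness holds because every configuration is a renumbering of
one numbered from left to right (`MapSpace.existsUnique_algebra`).
-/

namespace OperadBimod

/-! ### Free algebras over an operad -/

namespace LabelledPoint

variable {P : TopOperad.{u}} {α : Type v} {β : Type w}

/-- Two labelled points agree up to a renumbering of the inputs. -/
def Rel (x y : LabelledPoint P α) : Prop :=
  ∃ e : Fin x.arity ≃ Fin y.arity, (∀ j, x.lab j = y.lab (e j)) ∧ x.val = P.act e y.val

theorem Rel.refl (x : LabelledPoint P α) : Rel x x :=
  ⟨Equiv.refl _, fun _ => rfl, (P.act_refl _).symm⟩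

theorem Rel.symm {x y : LabelledPoint P α} (h : Rel x y) : Rel y x := by
  obtain ⟨e, hl, he⟩ := h
  exact ⟨e.symm, fun j => by simp [hl], by
    rw [he, P.act_act, Equiv.symm_trans_self, P.act_refl]⟩

theorem Rel.trans {x y z : LabelledPoint P α} (h : Rel x y) (h' : Rel y z) : Rel x z := by
  obtain ⟨e, hl, he⟩ := h
  obtain ⟨e', hl', he'⟩ := h'
  exact ⟨e.trans e', fun j => by simp [hl, hl'], by rw [he, he', P.act_act]⟩

/-- Renumbering of the inputs as a setoid. -/
def relSetoid (P : TopOperad.{u}) (α : Type v) : Setoid (LabelledPoint P α) :=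
  ⟨Rel, Rel.refl, Rel.symm, Rel.trans⟩

/-- The composite of a point of `P` with a family of labelled points. -/
def ofFamily {n : ℕ} (x : P.obj n) (F : Fin n → LabelledPoint P α) : LabelledPoint P α where
  arity := ∑ i, (F i).arity
  val := P.comp x fun i => (F i).val
  lab j := (F (finSigmaFinEquiv.symm j).1).lab (finSigmaFinEquiv.symm j).2

theorem ofFamily_lab {n : ℕ} (x : P.obj n) (F : Fin n → LabelledPoint P α)
    (s : Σ i, Fin (F i).arity) :
    (ofFamily x F).lab (finSigmaFinEquiv s) = (F s.1).lab s.2 := by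
  change (F (finSigmaFinEquiv.symm (finSigmaFinEquiv s)).1).lab
    (finSigmaFinEquiv.symm (finSigmaFinEquiv s)).2 = _
  rw [Equiv.symm_apply_apply]

theorem Rel.ofFamily {n : ℕ} (x : P.obj n) {F G : Fin n → LabelledPoint P α}
    (h : ∀ i, Rel (F i) (G i)) : Rel (ofFamily x F) (ofFamily x G) := by
  choose e hl he using h
  refine ⟨sumEquiv e, fun j => ?_, ?_⟩
  · obtain ⟨s, rfl⟩ := finSigmaFinEquiv.surjective j
    refine (ofFamily_lab x F s).trans ((hl _ _).trans ?_)
    refine (ofFamily_lab x G ⟨s.1, e s.1 s.2⟩).symm.trans ?_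
    exact congrArg (LabelledPoint.ofFamily x G).lab (sumEquiv_apply e s).symm
  · change P.comp x (fun i => (F i).val) = _
    simp only [he]
    exact P.comp_act e _ _

theorem rel_ofFamily_act {n n' : ℕ} (e : Fin n ≃ Fin n') (x : P.obj n')
    (F : Fin n' → LabelledPoint P α) :
    Rel (ofFamily (P.act e x) fun i => F (e i)) (ofFamily x F) := by
  refine ⟨blockEquiv e fun i => (F i).arity, fun j => ?_, P.act_comp e x fun i => (F i).val⟩
  obtain ⟨s, rfl⟩ := finSigmaFinEquiv.surjective j
  refine (ofFamily_lab _ (fun i => F (e i)) s).trans ?_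
  refine (ofFamily_lab x F ⟨e s.1, s.2⟩).symm.trans ?_
  exact congrArg (ofFamily x F).lab (blockEquiv_apply e (fun i => (F i).arity) s).symm

theorem rel_ofFamily_unit (X : LabelledPoint P α) :
    Rel (ofFamily P.unit fun _ : Fin 1 => X) X := by
  refine ⟨oneBlockEquiv X.arity, fun j => ?_, P.unit_comp _⟩
  obtain ⟨s, rfl⟩ := finSigmaFinEquiv.surjective j
  refine (ofFamily_lab _ (fun _ => X) s).trans ?_
  exact congrArg X.lab (oneBlockEquiv_apply X.arity s).symm

theorem rel_ofFamily_comp {n : ℕ} {m : Fin n → ℕ} (x : P.obj n) (y : ∀ i, P.obj (m i))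
    (G : Fin (∑ i, m i) → LabelledPoint P α) :
    Rel (ofFamily (P.comp x y) G)
      (ofFamily x fun i => ofFamily (y i) fun k => G (finSigmaFinEquiv ⟨i, k⟩)) := by
  refine ⟨assocEquiv m fun j => (G j).arity, fun j => ?_, P.comp_comp x y fun j => (G j).val⟩
  obtain ⟨⟨q, l⟩, rfl⟩ := finSigmaFinEquiv.surjective j
  obtain ⟨⟨i, k⟩, rfl⟩ := finSigmaFinEquiv.surjective q
  refine (ofFamily_lab _ G _).trans ?_
  refine Eq.trans (Eq.symm ((ofFamily_lab x
    (fun i => ofFamily (y i) fun k => G (finSigmaFinEquiv ⟨i, k⟩))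
      ⟨i, finSigmaFinEquiv ⟨k, l⟩⟩).trans
        (ofFamily_lab (y i) (fun k => G (finSigmaFinEquiv ⟨i, k⟩)) ⟨k, l⟩))) ?_
  exact congrArg (ofFamily x fun i => ofFamily (y i) fun k => G (finSigmaFinEquiv ⟨i, k⟩)).lab
    (assocEquiv_apply m (fun j => (G j).arity) i k l).symm

theorem rel_ofFamily_comp_unit (X : LabelledPoint P α) :
    Rel (ofFamily X.val fun i => ⟨1, P.unit, fun _ => X.lab i⟩) X := by
  refine ⟨unitBlocksEquiv X.arity, fun j => ?_, P.comp_unit _⟩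
  obtain ⟨s, rfl⟩ := finSigmaFinEquiv.surjective j
  refine (ofFamily_lab X.val (fun i => ⟨1, P.unit, fun _ => X.lab i⟩) s).trans ?_
  exact congrArg X.lab (unitBlocksEquiv_apply X.arity s).symm

end LabelledPoint

/-- The free algebra over `P` on the set `α`: labelled points up to renumbering of the inputs. -/
def FreeAlg (P : TopOperad.{u}) (α : Type v) : Type (max u v) :=
  Quotient (LabelledPoint.relSetoid P α)

namespace FreeAlg

variable {P : TopOperad.{u}} {α : Type v} {β : Type w}

/-- The class of a labelled point. -/
def mk (x : LabelledPoint P α) : FreeAlg P α := Quotient.mk (LabelledPoint.relSetoid P α) x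

theorem mk_eq_mk {x y : LabelledPoint P α} : mk x = mk y ↔ LabelledPoint.Rel x y :=
  Quotient.eq (r := LabelledPoint.relSetoid P α)

theorem exists_mk (X : FreeAlg P α) : ∃ x, mk x = X := Quotient.exists_rep X

/-- The structure maps of the free algebra. -/
noncomputable def op {n : ℕ} (x : P.obj n) (F : Fin n → FreeAlg P α) : FreeAlg P α :=
  mk (LabelledPoint.ofFamily x fun i => Quotient.out (F i))

/-- The generators of the free algebra. -/
def pure (a : α) : FreeAlg P α := mk ⟨1, P.unit, fun _ => a⟩

theorem op_mk {n : ℕ} (x : P.obj n) (F : Fin n → LabelledPoint P α) :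
    op x (fun i => mk (F i)) = mk (LabelledPoint.ofFamily x F) :=
  mk_eq_mk.2 (.ofFamily x fun _ => mk_eq_mk.1 (Quotient.out_eq _))

theorem op_act {n n' : ℕ} (e : Fin n ≃ Fin n') (x : P.obj n') (F : Fin n' → FreeAlg P α) :
    op (P.act e x) (fun i => F (e i)) = op x F :=
  mk_eq_mk.2 (LabelledPoint.rel_ofFamily_act e x fun i => Quotient.out (F i))

theorem op_unit (X : FreeAlg P α) : op P.unit (fun _ => X) = X := by
  obtain ⟨X, rfl⟩ := exists_mk X
  rw [op_mk]
  exact mk_eq_mk.2 (LabelledPoint.rel_ofFamily_unit X)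

theorem op_comp {n : ℕ} {m : Fin n → ℕ} (x : P.obj n) (y : ∀ i, P.obj (m i))
    (G : Fin (∑ i, m i) → FreeAlg P α) :
    op (P.comp x y) G = op x fun i => op (y i) fun k => G (finSigmaFinEquiv ⟨i, k⟩) := by
  choose g hg using fun j => exists_mk (G j)
  obtain rfl : (fun j => mk (g j)) = G := funext hg
  simp only [op_mk]
  exact mk_eq_mk.2 (LabelledPoint.rel_ofFamily_comp x y g)

theorem mk_eq_op (x : LabelledPoint P α) : mk x = op x.val fun i => pure (x.lab i) := by
  refine Eq.trans ?_ (op_mk x.val fun i => ⟨1, P.unit, fun _ => x.lab i⟩).symm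
  exact mk_eq_mk.2 (LabelledPoint.rel_ofFamily_comp_unit x).symm

theorem exists_op (X : FreeAlg P α) :
    ∃ (n : ℕ) (x : P.obj n) (l : Fin n → α), X = op x fun i => pure (l i) := by
  obtain ⟨x, rfl⟩ := exists_mk X
  exact ⟨_, _, _, mk_eq_op x⟩

/-- The morphism of algebras which extends a function on the generators. -/
noncomputable def bind (X : FreeAlg P α) (f : α → FreeAlg P β) : FreeAlg P β :=
  Quotient.lift (s := LabelledPoint.relSetoid P α) (fun x => op x.val fun i => f (x.lab i))
    (by
      rintro x y ⟨e, hl, he⟩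
      rw [he, ← op_act e]
      simp only [hl]) X

theorem mk_bind (x : LabelledPoint P α) (f : α → FreeAlg P β) :
    (mk x).bind f = op x.val fun i => f (x.lab i) := rfl

theorem mk_labelledPoint_bind (x : LabelledPoint P α) (f : α → LabelledPoint P β) :
    mk (x.bind f) = (mk x).bind fun a => mk (f a) := by
  rw [mk_bind, op_mk]
  rfl

theorem bind_op {n : ℕ} (x : P.obj n) (F : Fin n → FreeAlg P α) (f : α → FreeAlg P β) :
    (op x F).bind f = op x fun i => (F i).bind f := by
  choose g hg using fun j => exists_mk (F j)
  obtain rfl : (fun j => mk (g j)) = F := funext hg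
  rw [op_mk, mk_bind]
  refine (op_comp x (fun i => (g i).val) _).trans ?_
  congr 1
  funext i
  rw [mk_bind]
  congr 1
  funext k
  exact congrArg f (LabelledPoint.ofFamily_lab x g ⟨i, k⟩)

theorem pure_bind (a : α) (f : α → FreeAlg P β) : (pure a : FreeAlg P α).bind f = f a :=
  op_unit (f a)

theorem op_pure_bind {n : ℕ} (x : P.obj n) (l : Fin n → α) (f : α → FreeAlg P β) :
    (op x fun i => pure (l i)).bind f = op x fun i => f (l i) := by
  simp only [bind_op, pure_bind]

theorem bind_assoc {γ : Type*} (X : FreeAlg P α) (f : α → FreeAlg P β) (g : β → FreeAlg P γ) :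
    (X.bind f).bind g = X.bind fun a => (f a).bind g := by
  obtain ⟨n, x, l, rfl⟩ := exists_op X
  simp only [bind_op, pure_bind]

theorem op_eq_mk {n : ℕ} (x : P.obj n) (l : Fin n → α) :
    (op x fun i => pure (l i)) = mk ⟨n, x, l⟩ := (mk_eq_op ⟨n, x, l⟩).symm

/-- A point of `P n` can be recovered from the element of the free algebra on `Fin n` which it
represents: a renumbering of the inputs that preserves the labels is the identity, as the labels are
distinct. -/
theorem op_pure_injective {n : ℕ} {x y : P.obj n} (h : op x pure = op y pure) : x = y := by
  rw [show (pure : Fin n → FreeAlg P (Fin n)) = fun i => pure i from rfl,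
    op_eq_mk x fun i => i, op_eq_mk y fun i => i, mk_eq_mk] at h
  obtain ⟨e, hl, he⟩ := h
  obtain rfl : e = Equiv.refl _ := Equiv.ext fun j => (hl j).symm
  exact he.trans (P.act_refl y)

/-- `LabelledPoint.Represents` is an equality in the free algebra. -/
theorem represents_iff {n : ℕ} (x : LabelledPoint P (Fin n)) (y : P.obj n) :
    x.Represents y ↔ mk x = op y pure := by
  rw [show (pure : Fin n → FreeAlg P (Fin n)) = fun i => pure i from rfl,
    op_eq_mk y fun i => i, eq_comm, mk_eq_mk]
  exact exists_congr fun e => and_congr_left' (forall_congr' fun j => eq_comm)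

/-- The sum of the values of a function on the labels. -/
def labelSum (h : α → ℕ) (X : FreeAlg P α) : ℕ :=
  Quotient.lift (s := LabelledPoint.relSetoid P α) (fun x => ∑ j, h (x.lab j))
    (by
      rintro x y ⟨e, hl, -⟩
      rw [← e.sum_comp]
      simp only [hl]) X

theorem labelSum_pure (h : α → ℕ) (a : α) : labelSum h (pure a : FreeAlg P α) = h a :=
  Fin.sum_univ_one _

theorem labelSum_op (h : α → ℕ) {n : ℕ} (x : P.obj n) (F : Fin n → FreeAlg P α) :
    labelSum h (op x F) = ∑ i, labelSum h (F i) := by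
  choose g hg using fun j => exists_mk (F j)
  obtain rfl : (fun j => mk (g j)) = F := funext hg
  rw [op_mk]
  change ∑ j : Fin (∑ i, (g i).arity), h ((LabelledPoint.ofFamily x g).lab j) =
    ∑ i, ∑ k, h ((g i).lab k)
  rw [← finSigmaFinEquiv.sum_comp, Fintype.sum_sigma]
  exact Finset.sum_congr rfl fun i _ => Finset.sum_congr rfl fun k _ =>
    congrArg h (LabelledPoint.ofFamily_lab x g ⟨i, k⟩)

theorem labelSum_bind (h : β → ℕ) (X : FreeAlg P α) (f : α → FreeAlg P β) :
    labelSum h (X.bind f) = labelSum (fun a => labelSum h (f a)) X := by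
  obtain ⟨n, x, l, rfl⟩ := exists_op X
  simp only [bind_op, pure_bind, labelSum_op, labelSum_pure]

/-- A labelled point in which every label occurs exactly once comes from a point of `P`. -/
theorem exists_eq_op_pure {n : ℕ} (X : FreeAlg P (Fin n))
    (h : ∀ a, labelSum (fun b => if b = a then 1 else 0) X = 1) :
    ∃ y : P.obj n, X = op y pure := by
  obtain ⟨x, rfl⟩ := exists_mk X
  have hb : Function.Bijective x.lab := by
    rw [Function.bijective_iff_existsUnique]
    intro a
    rw [Fintype.existsUnique_iff_card_one, Finset.card_filter]
    exact h a
  refine ⟨P.act (Equiv.ofBijective x.lab hb).symm x.val, ((represents_iff x _).1 ?_)⟩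
  exact ⟨_, fun j => (Equiv.ofBijective x.lab hb).apply_symm_apply j, rfl⟩

end FreeAlg

/-! ### Operations on labelled trees -/

namespace DTree

variable {A : ℕ → Type u} {B : ℕ → Type u} {α : Type v} {β : Type w}

theorem bind_bind {γ : Type*} (T : DTree A α) (f : α → DTree A β) (g : β → DTree A γ) :
    (T.bind f).bind g = T.bind fun a => (f a).bind g := by
  induction T with
  | leaf a => rfl
  | node x t c ih => simp only [bind, ih]

theorem bind_leaf (T : DTree A α) : T.bind leaf = T := by
  induction T with
  | leaf a => rfl
  | node x t c ih => simp only [bind, ih]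

theorem map_bind {γ : Type*} (T : DTree A α) (f : α → β) (g : β → DTree A γ) :
    (T.map f).bind g = T.bind fun a => g (f a) :=
  bind_bind T _ g

theorem map_map {γ : Type*} (T : DTree A α) (f : α → β) (g : β → γ) :
    (T.map f).map g = T.map fun a => g (f a) :=
  bind_bind T _ _

theorem bind_map {γ : Type*} (T : DTree A α) (f : α → DTree A β) (g : β → γ) :
    (T.bind f).map g = T.bind fun a => (f a).map g :=
  bind_bind T _ _

theorem map_leaf (f : α → β) (a : α) : (leaf a : DTree A α).map f = leaf (f a) := rfl

theorem map_node (f : α → β) {n : ℕ} (x : A n) (t : unitInterval) (c : Fin n → DTree A α) :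
    (node x t c).map f = node x t fun i => (c i).map f := rfl

theorem mapParam_bind (r : unitInterval → unitInterval) (T : DTree A α) (f : α → DTree A β) :
    (T.bind f).mapParam r = (T.mapParam r).bind fun a => (f a).mapParam r := by
  induction T with
  | leaf a => rfl
  | node x t c ih => simp only [bind, mapParam, ih]

theorem mapParam_map (r : unitInterval → unitInterval) (T : DTree A α) (f : α → β) :
    (T.map f).mapParam r = (T.mapParam r).map f :=
  mapParam_bind r T _

theorem mapParam_mapParam (r s : unitInterval → unitInterval) (T : DTree A α) :
    (T.mapParam r).mapParam s = T.mapParam fun t => s (r t) := by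
  induction T with
  | leaf a => rfl
  | node x t c ih => simp only [mapParam, ih]

theorem mapParam_id (T : DTree A α) : (T.mapParam fun t => t) = T := by
  induction T with
  | leaf a => rfl
  | node x t c ih => simp only [mapParam, ih]

theorem mapVert_map (g : ∀ n, A n → B n) (T : DTree A α) (f : α → β) :
    (T.map f).mapVert g = (T.mapVert g).map f :=
  mapVert_bind g T _

theorem mapVert_mapParam (g : ∀ n, A n → B n) (r : unitInterval → unitInterval) (T : DTree A α) :
    (T.mapVert g).mapParam r = (T.mapParam r).mapVert g := by
  induction T with
  | leaf a => rfl
  | node x t c ih => simp only [mapVert, mapParam, ih]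

theorem rootGE_map_iff {s : unitInterval} {T : DTree A α} (f : α → β) :
    (T.map f).RootGE s ↔ T.RootGE s := by
  cases T <;> rfl

theorem mono_map_iff {T : DTree A α} (f : α → β) : (T.map f).Mono ↔ T.Mono := by
  induction T with
  | leaf a => rfl
  | node x t c ih =>
    simp only [map_node, Mono, rootGE_map_iff]
    exact forall_congr' fun i => and_congr_right' (ih i)

theorem rootGE_mapVert_iff {s : unitInterval} {T : DTree A α} (g : ∀ n, A n → B n) :
    (T.mapVert g).RootGE s ↔ T.RootGE s := by
  cases T <;> rfl

theorem mono_mapVert_iff {T : DTree A α} (g : ∀ n, A n → B n) :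
    (T.mapVert g).Mono ↔ T.Mono := by
  induction T with
  | leaf a => rfl
  | node x t c ih =>
    simp only [mapVert, Mono, rootGE_mapVert_iff]
    exact forall_congr' fun i => and_congr_right' (ih i)

/-! #### Conditions on all leaves and on all vertices -/

/-- All labels of leaves satisfy `p`. -/
def ForallLabel (p : α → Prop) : DTree A α → Prop
  | leaf a => p a
  | node _ _ c => ∀ i, (c i).ForallLabel p

/-- All parameters of vertices satisfy `p`. -/
def ForallParam (p : unitInterval → Prop) : DTree A α → Prop
  | leaf _ => True
  | node _ t c => p t ∧ ∀ i, (c i).ForallParam p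

theorem forall_label_node {p : α → Prop} {n : ℕ} (x : A n) (t : unitInterval)
    (c : Fin n → DTree A α) :
    (∀ j, p ((node x t c).label j)) ↔ ∀ i k, p ((c i).label k) := by
  constructor
  · intro h i k
    rw [← label_node x t c ⟨i, k⟩]
    exact h _
  · intro h j
    obtain ⟨s, rfl⟩ := finSigmaFinEquiv.surjective j
    rw [label_node x t c s]
    exact h _ _

theorem forallLabel_iff {p : α → Prop} {T : DTree A α} :
    T.ForallLabel p ↔ ∀ j, p (T.label j) := by
  induction T with
  | leaf a => exact ⟨fun h _ => h, fun h => h (0 : Fin 1)⟩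
  | node x t c ih => rw [forall_label_node]; exact forall_congr' fun i => ih i

theorem ForallLabel.imp {p q : α → Prop} {T : DTree A α} (h : T.ForallLabel p)
    (hpq : ∀ a, p a → q a) : T.ForallLabel q := by
  rw [forallLabel_iff] at h ⊢
  exact fun j => hpq _ (h j)

theorem ForallLabel.and {p q : α → Prop} {T : DTree A α} (h : T.ForallLabel p)
    (h' : T.ForallLabel q) : T.ForallLabel fun a => p a ∧ q a := by
  rw [forallLabel_iff] at h h' ⊢
  exact fun j => ⟨h j, h' j⟩

theorem ForallLabel.of_forall {p : α → Prop} (h : ∀ a, p a) (T : DTree A α) : T.ForallLabel p :=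
  forallLabel_iff.2 fun _ => h _

theorem forallLabel_bind {p : β → Prop} {T : DTree A α} {f : α → DTree A β} :
    (T.bind f).ForallLabel p ↔ T.ForallLabel fun a => (f a).ForallLabel p := by
  induction T with
  | leaf a => rfl
  | node x t c ih => exact forall_congr' fun i => ih i

theorem forallLabel_map {p : β → Prop} {T : DTree A α} {f : α → β} :
    (T.map f).ForallLabel p ↔ T.ForallLabel fun a => p (f a) :=
  forallLabel_bind

theorem forallLabel_mapParam {p : α → Prop} {T : DTree A α} {r : unitInterval → unitInterval} :
    (T.mapParam r).ForallLabel p ↔ T.ForallLabel p := by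
  induction T with
  | leaf a => rfl
  | node x t c ih => exact forall_congr' fun i => ih i

theorem forallLabel_mapVert {p : α → Prop} {T : DTree A α} {g : ∀ n, A n → B n} :
    (T.mapVert g).ForallLabel p ↔ T.ForallLabel p := by
  induction T with
  | leaf a => rfl
  | node x t c ih => exact forall_congr' fun i => ih i

theorem ForallParam.imp {p q : unitInterval → Prop} {T : DTree A α} (h : T.ForallParam p)
    (hpq : ∀ t, p t → q t) : T.ForallParam q := by
  induction T with
  | leaf a => trivial
  | node x t c ih => exact ⟨hpq _ h.1, fun i => ih i (h.2 i)⟩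

theorem forallParam_map {p : unitInterval → Prop} {T : DTree A α} {f : α → β} :
    (T.map f).ForallParam p ↔ T.ForallParam p := by
  induction T with
  | leaf a => rfl
  | node x t c ih => exact and_congr_right' (forall_congr' fun i => ih i)

theorem forallParam_mapParam {p : unitInterval → Prop} {T : DTree A α}
    {r : unitInterval → unitInterval} :
    (T.mapParam r).ForallParam p ↔ T.ForallParam fun t => p (r t) := by
  induction T with
  | leaf a => rfl
  | node x t c ih => exact and_congr_right' (forall_congr' fun i => ih i)

theorem forallParam_mapVert {p : unitInterval → Prop} {T : DTree A α} {g : ∀ n, A n → B n} :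
    (T.mapVert g).ForallParam p ↔ T.ForallParam p := by
  induction T with
  | leaf a => rfl
  | node x t c ih => exact and_congr_right' (forall_congr' fun i => ih i)

theorem RootGE.trans {s s' : unitInterval} {T : DTree A α} (h : T.RootGE s) (hs : s' ≤ s) :
    T.RootGE s' := by
  cases T with
  | leaf a => trivial
  | node x t c => exact hs.trans h

theorem Mono.forallParam_ge {T : DTree A α} (h : T.Mono) {s : unitInterval} (hs : T.RootGE s) :
    T.ForallParam fun t => s ≤ t := by
  induction T with
  | leaf a => trivial
  | node x t c ih => exact ⟨hs, fun i => ih i (h i).2 ((h i).1.trans hs)⟩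

theorem ForallParam.rootGE {T : DTree A α} {s : unitInterval}
    (h : T.ForallParam fun t => s ≤ t) : T.RootGE s := by
  cases T with
  | leaf a => trivial
  | node x t c => exact h.1

/-! #### Relabelling -/

theorem relabel_label (T : DTree A α) (f : α → β) :
    (T.relabel fun j => f (T.label j)) = T.map f := by
  induction T with
  | leaf a => rfl
  | node x t c ih =>
    simp only [relabel, map_node]
    congr 1
    funext i
    rw [← ih i]
    congr 1
    funext k
    exact congrArg f (label_node x t c ⟨i, k⟩)

theorem relabel_map {γ : Type*} (T : DTree A α) (f : Fin T.numLeaves → β) (g : β → γ) :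
    (T.relabel f).map g = T.relabel fun j => g (f j) := by
  induction T with
  | leaf a => rfl
  | node x t c ih => simp only [relabel, map_node, ih]

theorem planar_map_label (T : DTree A α) : T.planar.map T.label = T := by
  rw [planar, relabel_map]
  exact (relabel_label T fun a => a).trans (bind_leaf T)

theorem finSigmaFinEquiv_cast {n : ℕ} {m m' : Fin n → ℕ} (h : ∀ i, m i = m' i)
    (h' : ∑ i, m i = ∑ i, m' i) (s : Σ i, Fin (m i)) :
    Fin.cast h' (finSigmaFinEquiv s) = finSigmaFinEquiv ⟨s.1, Fin.cast (h s.1) s.2⟩ := by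
  obtain rfl := funext h
  rfl

theorem exists_cast_relabel {γ : Type} (T : DTree A α) (f : Fin T.numLeaves → β) :
    ∃ hN : (T.relabel f).numLeaves = T.numLeaves,
      (∀ j, (T.relabel f).label j = f (Fin.cast hN j)) ∧
      ∀ g : Fin (T.relabel f).numLeaves → γ,
        (T.relabel f).relabel g = T.relabel fun j => g (Fin.cast hN.symm j) := by
  induction T with
  | leaf a =>
    refine ⟨rfl, fun j => congrArg f ?_, fun g => rfl⟩
    exact Subsingleton.elim (α := Fin 1) _ _
  | node x t c ih =>
    choose hN hl hr using fun i => ih i fun k => f (finSigmaFinEquiv ⟨i, k⟩)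
    have h' : ((node x t c).relabel f).numLeaves = (node x t c).numLeaves :=
      Finset.sum_congr rfl fun i _ => hN i
    refine ⟨h', fun j => ?_, fun g => ?_⟩
    · obtain ⟨s, rfl⟩ := finSigmaFinEquiv.surjective j
      refine (label_node x t _ s).trans ((hl s.1 s.2).trans (congrArg f ?_))
      exact (finSigmaFinEquiv_cast hN h' s).symm
    · change node x t _ = node x t _
      congr 1
      funext i
      rw [hr]
      congr 1
      funext k
      refine congrArg g ?_
      exact (finSigmaFinEquiv_cast (fun i => (hN i).symm) h'.symm ⟨i, k⟩).symm

theorem exists_cast_mapParam {γ : Type} (T : DTree A α) (r : unitInterval → unitInterval) :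
    ∃ hN : (T.mapParam r).numLeaves = T.numLeaves,
      (∀ j, (T.mapParam r).label j = T.label (Fin.cast hN j)) ∧
      ∀ g : Fin (T.mapParam r).numLeaves → γ,
        (T.mapParam r).relabel g = (T.relabel fun j => g (Fin.cast hN.symm j)).mapParam r := by
  induction T with
  | leaf a => exact ⟨rfl, fun j => rfl, fun g => rfl⟩
  | node x t c ih =>
    choose hN hl hr using ih
    have h' : ((node x t c).mapParam r).numLeaves = (node x t c).numLeaves :=
      Finset.sum_congr rfl fun i _ => hN i
    refine ⟨h', fun j => ?_, fun g => ?_⟩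
    · obtain ⟨s, rfl⟩ := finSigmaFinEquiv.surjective j
      refine (label_node x (r t) _ s).trans ((hl s.1 s.2).trans ?_)
      rw [← label_node x t c ⟨s.1, Fin.cast (hN s.1) s.2⟩]
      exact congrArg _ (finSigmaFinEquiv_cast hN h' s).symm
    · change node x (r t) _ = node x (r t) _
      congr 1
      funext i
      rw [hr]
      congr 2
      funext k
      refine congrArg g ?_
      exact (finSigmaFinEquiv_cast (fun i => (hN i).symm) h'.symm ⟨i, k⟩).symm

theorem numLeaves_map (T : DTree A α) (f : α → β) : (T.map f).numLeaves = T.numLeaves := by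
  induction T with
  | leaf a => rfl
  | node x t c ih => exact Finset.sum_congr rfl fun i _ => ih i

theorem IsLabelled.numLeaves_eq {n : ℕ} {T : DTree A (Fin n)} (h : T.IsLabelled) :
    T.numLeaves = n := by
  simpa using Fintype.card_congr (Equiv.ofBijective _ h)

/-! #### Evaluation in a free algebra -/

/-- The element of the free algebra given by the composite of the labels of the vertices. -/
noncomputable def freeEval (P : TopOperad.{w}) (g : ∀ n, A n → P.obj n) (T : DTree A α) :
    FreeAlg P α :=
  FreeAlg.mk ⟨T.numLeaves, T.eval P g, T.label⟩

section freeEval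

variable {P : TopOperad.{w}} {g : ∀ n, A n → P.obj n}

theorem freeEval_leaf (a : α) : freeEval P g (leaf a) = FreeAlg.pure a := rfl

theorem freeEval_node {n : ℕ} (x : A n) (t : unitInterval) (c : Fin n → DTree A α) :
    freeEval P g (node x t c) = FreeAlg.op (g n x) fun i => freeEval P g (c i) :=
  (FreeAlg.op_mk (g n x) fun i => ⟨(c i).numLeaves, (c i).eval P g, (c i).label⟩).symm

theorem freeEval_bind {β : Type*} (T : DTree A α) (f : α → DTree A β) :
    freeEval P g (T.bind f) = (freeEval P g T).bind fun a => freeEval P g (f a) := by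
  induction T with
  | leaf a => exact (FreeAlg.pure_bind _ _).symm
  | node x t c ih => simp only [bind, freeEval_node, FreeAlg.bind_op, ih]

theorem freeEval_map {β : Type*} (T : DTree A α) (f : α → β) :
    freeEval P g (T.map f) = (freeEval P g T).bind fun a => FreeAlg.pure (f a) :=
  freeEval_bind T _

theorem freeEval_mapParam (r : unitInterval → unitInterval) (T : DTree A α) :
    freeEval P g (T.mapParam r) = freeEval P g T := by
  induction T with
  | leaf a => rfl
  | node x t c ih => simp only [mapParam, freeEval_node, ih]

theorem freeEval_mapVert {h : ∀ n, B n → A n} (T : DTree B α) :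
    freeEval P g (T.mapVert h) = freeEval P (fun n x => g n (h n x)) T := by
  induction T with
  | leaf a => rfl
  | node x t c ih => simp only [mapVert, freeEval_node, ih]

theorem EvalEq.freeEval_eq {T T' : DTree A α} (h : EvalEq P g T T') :
    freeEval P g T = freeEval P g T' :=
  FreeAlg.mk_eq_mk.2 h

theorem freeEval_bind_congr {β : Type*} {T : DTree A α} {f f' : α → FreeAlg P β}
    (h : T.ForallLabel fun a => f a = f' a) :
    (freeEval P g T).bind f = (freeEval P g T).bind f' := by
  rw [forallLabel_iff] at h
  simp only [freeEval, FreeAlg.mk_bind, h]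

/-- The sum of the values of a function on the labels of the leaves. -/
def labelSum (h : α → ℕ) : DTree A α → ℕ
  | leaf a => h a
  | node _ _ c => ∑ i, (c i).labelSum h

theorem labelSum_freeEval (h : α → ℕ) (T : DTree A α) :
    (freeEval P g T).labelSum h = T.labelSum h := by
  induction T with
  | leaf a => exact FreeAlg.labelSum_pure h a
  | node x t c ih => simp only [freeEval_node, FreeAlg.labelSum_op, labelSum, ih]

end freeEval

theorem labelSum_eq (h : α → ℕ) (T : DTree A α) : T.labelSum h = ∑ j, h (T.label j) := by
  induction T with
  | leaf a =>
    change h a = ∑ _j : Fin 1, h a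
    simp
  | node x t c ih =>
    simp only [labelSum, ih]
    change _ = ∑ j : Fin (∑ i, (c i).numLeaves), h ((node x t c).label j)
    rw [← finSigmaFinEquiv.sum_comp, Fintype.sum_sigma]
    exact Finset.sum_congr rfl fun i _ => Finset.sum_congr rfl fun k _ =>
      congrArg h (label_node x t c ⟨i, k⟩).symm

theorem labelSum_bind {β : Type*} (h : β → ℕ) (T : DTree A α) (f : α → DTree A β) :
    (T.bind f).labelSum h = T.labelSum fun a => (f a).labelSum h := by
  induction T with
  | leaf a => rfl
  | node x t c ih => simp only [bind, labelSum, ih]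

theorem labelSum_mapParam (h : α → ℕ) (r : unitInterval → unitInterval) (T : DTree A α) :
    (T.mapParam r).labelSum h = T.labelSum h := by
  induction T with
  | leaf a => rfl
  | node x t c ih => simp only [mapParam, labelSum, ih]

theorem mult_eq_labelSum [DecidableEq α] (a : α) (T : DTree A α) :
    T.mult a = T.labelSum fun b => if b = a then 1 else 0 := by
  rw [labelSum_eq, mult_eq]

/-! #### Cutting -/

open Classical in
/-- The largest subtree containing the root all of whose vertices have a parameter satisfying `p`;
its leaves are labelled by the subtrees which have been cut off. In contrast to `DTree.cut`, these
do not carry a proof that their parameters increase. -/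
noncomputable def cutAt (p : unitInterval → Prop) : DTree A α → DTree A (DTree A α)
  | leaf a => leaf (leaf a)
  | node x t c => if p t then node x t fun i => (c i).cutAt p else leaf (node x t c)

section cutAt

variable {p q : unitInterval → Prop}

theorem cutAt_leaf (a : α) : (leaf a : DTree A α).cutAt p = leaf (leaf a) := rfl

theorem cutAt_pos {n : ℕ} {x : A n} {t : unitInterval} {c : Fin n → DTree A α} (h : p t) :
    (node x t c).cutAt p = node x t fun i => (c i).cutAt p := by
  simp only [cutAt, if_pos h]

theorem cutAt_neg {n : ℕ} {x : A n} {t : unitInterval} {c : Fin n → DTree A α} (h : ¬p t) :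
    (node x t c).cutAt p = leaf (node x t c) := by
  simp only [cutAt, if_neg h]

theorem cut_map_val (T : DTree A α) (h : T.Mono) :
    (T.cut p h).map Subtype.val = T.cutAt p := by
  induction T with
  | leaf a => rfl
  | node x t c ih =>
    by_cases hp : p t
    · simp only [cut, cutAt, if_pos hp, map_node, ih]
    · simp only [cut, cutAt, if_neg hp, map_leaf]

theorem cutAt_bind_id (T : DTree A α) : (T.cutAt p).bind (fun S => S) = T := by
  induction T with
  | leaf a => rfl
  | node x t c ih =>
    by_cases hp : p t
    · simp only [cutAt_pos hp, bind, ih]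
    · simp only [cutAt_neg hp, bind]

theorem cutAt_map (T : DTree A α) (f : α → β) :
    (T.map f).cutAt p = (T.cutAt p).map fun S => S.map f := by
  induction T with
  | leaf a => rfl
  | node x t c ih =>
    by_cases hp : p t
    · simp only [map_node, cutAt_pos hp, ih]
    · simp only [map_node, cutAt_neg hp, map_leaf]

theorem cutAt_mapParam (r : unitInterval → unitInterval) (T : DTree A α) :
    (T.mapParam r).cutAt p = ((T.cutAt fun t => p (r t)).mapParam r).map fun S => S.mapParam r := by
  induction T with
  | leaf a => rfl
  | node x t c ih =>
    by_cases hp : p (r t)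
    · rw [cutAt_pos (p := fun t => p (r t)) hp]
      simp only [mapParam, cutAt_pos hp, map_node, ih]
    · rw [cutAt_neg (p := fun t => p (r t)) hp]
      simp only [mapParam, cutAt_neg hp, map_leaf]

theorem cutAt_cutAt (hpq : ∀ t, p t → q t) (T : DTree A α) :
    (T.cutAt q).cutAt p = (T.cutAt p).map fun S => S.cutAt q := by
  induction T with
  | leaf a => rfl
  | node x t c ih =>
    by_cases hp : p t
    · simp only [cutAt_pos hp, cutAt_pos (hpq t hp), map_node, ih]
    · by_cases hq : q t
      · simp only [cutAt_pos hq, cutAt_neg hp, map_leaf]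
      · simp only [cutAt_neg hq, cutAt_neg hp, map_leaf, cutAt_leaf]

/-- Cutting above a subtree which is entirely kept. -/
theorem cutAt_bind_of_forallParam {T : DTree A α} (h : T.ForallParam p) (f : α → DTree A β) :
    (T.bind f).cutAt p = T.bind fun a => (f a).cutAt p := by
  induction T with
  | leaf a => rfl
  | node x t c ih =>
    simp only [bind, cutAt_pos h.1]
    congr 1
    funext i
    exact ih i (h.2 i)

/-- Cutting a tree on whose leaves one has grafted trees which are entirely cut off. -/
theorem cutAt_bind_of_cutAt_eq_leaf {T : DTree A α} {f : α → DTree A β}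
    (h : T.ForallLabel fun a => (f a).cutAt p = leaf (f a)) :
    (T.bind f).cutAt p = (T.cutAt p).map fun S => S.bind f := by
  induction T with
  | leaf a => exact h
  | node x t c ih =>
    by_cases hp : p t
    · simp only [bind, cutAt_pos hp, map_node]
      congr 1
      funext i
      exact ih i (h i)
    · simp only [bind, cutAt_neg hp, map_leaf]

theorem RootGE.cutAt_eq_leaf {s : unitInterval} {T : DTree A α} (h : T.RootGE s)
    (hp : ∀ t, s ≤ t → ¬p t) : T.cutAt p = leaf T := by
  cases T with
  | leaf a => rfl
  | node x t c => exact cutAt_neg (hp t h)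

theorem cutAt_congr (h : ∀ t, p t ↔ q t) (T : DTree A α) : T.cutAt p = T.cutAt q := by
  rw [show p = q from funext fun t => propext (h t)]

theorem forallParam_cutAt (T : DTree A α) : (T.cutAt p).ForallParam p := by
  induction T with
  | leaf a => trivial
  | node x t c ih =>
    by_cases hp : p t
    · rw [cutAt_pos hp]; exact ⟨hp, ih⟩
    · rw [cutAt_neg hp]; trivial

theorem Mono.cutAt {T : DTree A α} (h : T.Mono) : (T.cutAt p).Mono := by
  rw [← cut_map_val T h, mono_map_iff]
  exact mono_cut p T h

theorem Mono.forallLabel_cutAt {T : DTree A α} (h : T.Mono) : (T.cutAt p).ForallLabel Mono := by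
  rw [← cut_map_val T h, forallLabel_map]
  exact .of_forall (fun S => S.2) _

/-- A condition inherited by subtrees holds for the trees which have been cut off. -/
theorem forallLabel_cutAt_of {C : DTree A α → Prop}
    (hC : ∀ {n : ℕ} (x : A n) (t : unitInterval) (c : Fin n → DTree A α), p t →
      C (node x t c) → ∀ i, C (c i)) {T : DTree A α} (h : C T) :
    (T.cutAt p).ForallLabel C := by
  induction T with
  | leaf a => exact h
  | node x t c ih =>
    by_cases hp : p t
    · rw [cutAt_pos hp]; exact fun i => ih i (hC x t c hp h i)
    · rw [cutAt_neg hp]; exact h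

/-- The parameter of the root of a tree which has been cut off does not satisfy `p`. -/
theorem forallLabel_cutAt_self (T : DTree A α) :
    (T.cutAt p).ForallLabel fun S => S.cutAt p = leaf S := by
  induction T with
  | leaf a => rfl
  | node x t c ih =>
    by_cases hp : p t
    · rw [cutAt_pos hp]; exact ih
    · rw [cutAt_neg hp]; exact cutAt_neg hp

theorem labelSum_cutAt (h : α → ℕ) (T : DTree A α) :
    (T.cutAt p).labelSum (fun S => S.labelSum h) = T.labelSum h := by
  rw [← labelSum_bind, cutAt_bind_id]

end cutAt

end DTree

/-! ### The map from the Boardman-Vogt resolution -/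

section BV

variable {O O' : TopOperad.{u}}

theorem BV.mk_surjective {n : ℕ} (x : BV O n) : ∃ X : PreBV O n, BV.mk X = x := Quot.exists_rep x

theorem op_value {A : ℕ → Type u} {P : TopOperad.{w}} {g : ∀ n, A n → P.obj n} {n : ℕ}
    {T : DTree A (Fin n)} (h : T.IsLabelled) :
    FreeAlg.op (T.value P g h) FreeAlg.pure = DTree.freeEval P g T := by
  refine ((FreeAlg.represents_iff ⟨T.numLeaves, T.eval P g, T.label⟩ _).1 ?_).symm
  exact ⟨_, fun j => (Equiv.ofBijective T.label h).apply_symm_apply j, rfl⟩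

theorem BV.op_μ_mk {n : ℕ} (X : PreBV O n) :
    FreeAlg.op (BV.μ (BV.mk X)) FreeAlg.pure = DTree.freeEval O (fun _ x => x) X.1 :=
  op_value X.2.1

/-- The composite of a point with generators, in terms of a representing tree. -/
theorem BV.op_μ_mk_bind {α : Type*} {n : ℕ} (X : PreBV O n) (F : Fin n → FreeAlg O α) :
    FreeAlg.op (BV.μ (BV.mk X)) F = (DTree.freeEval O (fun _ x => x) X.1).bind F := by
  rw [← BV.op_μ_mk]
  exact (FreeAlg.op_pure_bind _ (fun i => i) F).symm

theorem BV.μ_ι {n : ℕ} (a : O.obj n) : BV.μ (BV.ι a) = a := by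
  apply FreeAlg.op_pure_injective
  rw [BV.ι, BV.op_μ_mk]
  exact DTree.freeEval_node a 1 DTree.leaf

theorem BV.μ_act {m n : ℕ} (e : Fin m ≃ Fin n) (x : BV O n) :
    BV.μ (BV.act e x) = O.act e (BV.μ x) := by
  obtain ⟨X, rfl⟩ := BV.mk_surjective x
  apply FreeAlg.op_pure_injective
  refine (BV.op_μ_mk (PreBV.act e X)).trans ?_
  refine (DTree.freeEval_map X.1 e.symm).trans ?_
  rw [← BV.op_μ_mk_bind]
  refine (FreeAlg.op_act e (BV.μ (BV.mk X)) fun j => FreeAlg.pure (e.symm j)).symm.trans ?_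
  simp only [Equiv.symm_apply_apply]

theorem BV.μ_comp {n : ℕ} {m : Fin n → ℕ} (x : BV O n) (y : ∀ i, BV O (m i)) :
    BV.μ (BV.comp x y) = O.comp (BV.μ x) fun i => BV.μ (y i) := by
  obtain ⟨X, rfl⟩ := BV.mk_surjective x
  choose Y hY using fun i => BV.mk_surjective (y i)
  obtain rfl : (fun i => BV.mk (Y i)) = y := funext hY
  apply FreeAlg.op_pure_injective
  rw [BV.comp_mk, BV.op_μ_mk, FreeAlg.op_comp, BV.op_μ_mk_bind]
  refine (DTree.freeEval_bind X.1 _).trans ?_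
  congr 1
  funext i
  rw [BV.op_μ_mk_bind]
  exact DTree.freeEval_map _ _

theorem WBBase.evalEq (η : O.Hom O') {α : Type v} {T T' : DTree (BV O) α} (h : WBBase O T T') :
    DTree.EvalEq O' (fun n x => η.toFun n (BV.μ x)) T T' := by
  cases h with
  | unit t T' =>
    have h : η.toFun 1 (BV.μ (BV.ι O.unit)) = O'.unit := by rw [BV.μ_ι, η.map_unit]
    exact DTree.EvalEq.unit (g := fun n x => η.toFun n (BV.μ x)) h t _
  | perm e x t c => exact .perm e (by rw [BV.μ_act, η.map_act]) t c
  | contract x t c y d h =>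
    have h' : η.toFun 1 (BV.μ (BV.ι O.unit)) = O'.unit := by rw [BV.μ_ι, η.map_unit]
    exact DTree.EvalEq.contract (g := fun n x => η.toFun n (BV.μ x))
      (by rw [BV.μ_comp, η.map_comp]) h' t t h
  | proj x t ht c =>
    refine ⟨Equiv.refl _, fun j => rfl, ?_⟩
    refine Eq.trans ?_ (O'.act_refl _).symm
    change O'.comp (η.toFun _ (BV.μ x)) _ = O'.comp (η.toFun _ (BV.μ (BV.ι (BV.μ x)))) _
    rw [BV.μ_ι]

/-- `η ∘ μ` applied to a tree, as an element of a free algebra over `O'`. -/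
noncomputable abbrev treeEval (η : O.Hom O') {α : Type v} (T : DTree (BV O) α) : FreeAlg O' α :=
  T.freeEval O' fun n x => η.toFun n (BV.μ x)

theorem treeEval_eq_of_locally (η : O.Hom O') {α : Type v} {T T' : DTree (BV O) α}
    (h : DTree.Locally (WBBase O) T T') : treeEval η T = treeEval η T' :=
  (DTree.EvalEq.locally (fun _ _ => WBBase.evalEq η) h).freeEval_eq

theorem mk_etaMu (η : O.Hom O') {α : Type v} (T : DTree (BV O) α) :
    FreeAlg.mk (etaMu η T) = treeEval η T := by
  have h : η.toFun _ (T.eval O fun _ => BV.μ) = T.eval O' fun n x => η.toFun n (BV.μ x) := by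
    induction T with
    | leaf a => exact η.map_unit
    | node x t c ih =>
      refine (η.map_comp _ _).trans ?_
      simp only [ih]
      rfl
  simp only [etaMu, h]
  rfl

end BV

/-! ### The number of univalent vertices of a point of the Boardman-Vogt resolution -/

section univalents

variable {O : TopOperad.{u}}

namespace DTree

variable {A : ℕ → Type u} {α : Type v} {β : Type w}

/-- Contract the edges of length zero of a tree, the parameter of a vertex being the length of its
output edge. The first component is the number of inputs which the tree contributes to the vertex
below it, the second one the number of univalent vertices after contraction, apart from the vertex
below. -/
noncomputable def contracted : DTree A α → ℕ × ℕ
  | leaf _ => (1, 0)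
  | node _ s c => open Classical in
      if s = 0 then ∑ i, (c i).contracted
      else (1, (∑ i, (c i).contracted).2 + if (∑ i, (c i).contracted).1 = 0 then 1 else 0)

theorem contracted_raise (s : unitInterval) (T : DTree A α) (x : A 1) :
    (node x s fun _ => T).contracted = (T.raise s).contracted := by
  have h1 : ∑ _i : Fin 1, T.contracted = T.contracted := by simp
  by_cases hs : s = 0
  · subst hs
    simp only [contracted, if_true, h1]
    cases T with
    | leaf a => rfl
    | node y t c => simp only [raise, max_eq_right (unitInterval.nonneg' (t := t))]
  · simp only [contracted, if_neg hs, h1]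
    cases T with
    | leaf a => simp [raise, contracted]
    | node y t c =>
      have hm : max s t ≠ 0 := fun h => hs (le_antisymm (h ▸ le_max_left s t) unitInterval.nonneg')
      by_cases ht : t = 0
      · simp only [raise, contracted, if_neg hm, if_pos ht]
      · simp only [raise, contracted, if_neg hm, if_neg ht, one_ne_zero, if_false, add_zero]

theorem Absorb.sum_contracted {u : A 1} {T : DTree A α} {m : ℕ} {y : A m} {d : Fin m → DTree A α}
    (h : Absorb u 0 T y d) : T.contracted = ∑ k, (d k).contracted := by
  cases h with
  | merge y d => simp only [contracted, if_true]
  | keep T => simp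

theorem contracted_node_congr {m n : ℕ} {x : A m} {y : A n} {s : unitInterval}
    {c : Fin m → DTree A α} {d : Fin n → DTree A α}
    (h : ∑ i, (c i).contracted = ∑ i, (d i).contracted) :
    (node x s c).contracted = (node y s d).contracted := by
  simp only [contracted, h]

/-- Grafting on leaves along edges of positive length does not interfere with the contraction of
edges. -/
theorem contracted_bind (T : DTree A α) (f : α → DTree A β)
    (hf : ∀ a, (f a).contracted.1 = 1) :
    (T.bind f).contracted =
      (T.contracted.1, T.contracted.2 + T.labelSum fun a => (f a).contracted.2) := by
  induction T with
  | leaf a => exact Prod.ext (hf a) (by simp [contracted, bind, labelSum])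
  | node x s c ih =>
    have h1 : ∑ i, ((c i).bind f).contracted = ((∑ i, (c i).contracted).1,
        (∑ i, (c i).contracted).2 + ∑ i, (c i).labelSum fun a => (f a).contracted.2) := by
      simp only [ih, Prod.ext_iff, Prod.fst_sum, Prod.snd_sum, Finset.sum_add_distrib, and_self]
    by_cases hs : s = 0
    · simp only [bind, contracted, if_pos hs, labelSum, h1]
    · simp only [bind, contracted, if_neg hs, labelSum, h1]
      exact Prod.ext rfl (by dsimp only; omega)

theorem RootOne.contracted_fst {T : DTree A α} (h : T.RootOne) : T.contracted.1 = 1 := by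
  cases T with
  | leaf a => rfl
  | node x t c =>
    obtain rfl : t = 1 := h
    simp [contracted]

/-- Contraction does not increase the number of univalent vertices; if a tree contributes no input
to the vertex below, at least one of its univalent vertices is merged with this vertex. -/
theorem contracted_le_univalents (T : DTree A α) :
    T.contracted.2 + (if T.contracted.1 = 0 then 1 else 0) ≤ T.univalents := by
  induction T with
  | leaf a => simp [contracted, univalents]
  | node x s c ih =>
    rename_i n
    have h2 : ∑ i, ((c i).contracted.2 + if (c i).contracted.1 = 0 then 1 else 0) ≤
        ∑ i, (c i).univalents := Finset.sum_le_sum fun i _ => ih i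
    have key : (∑ i, (c i).contracted).2 + (if (∑ i, (c i).contracted).1 = 0 then 1 else 0) ≤
        (node x s c).univalents := by
      simp only [univalents, Prod.fst_sum, Prod.snd_sum]
      rw [Finset.sum_add_distrib] at h2
      by_cases hn : n = 0
      · subst hn; simp
      · rw [if_neg hn]
        have : (if ∑ i, (c i).contracted.1 = 0 then 1 else 0) ≤
            ∑ i, if (c i).contracted.1 = 0 then 1 else 0 := by
          split_ifs with h0
          · simp only [Finset.sum_eq_zero_iff, Finset.mem_univ, true_implies] at h0
            simp [h0]; omega
          · exact Nat.zero_le _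
        omega
    by_cases hs : s = 0
    · simpa only [contracted, if_pos hs] using key
    · simpa [contracted, if_neg hs] using key

theorem one_le_univalents_add (T : DTree A α) : 1 ≤ T.univalents + T.numLeaves := by
  induction T with
  | leaf a => exact Nat.le_add_left _ _
  | node x s c ih =>
    rename_i n
    change 1 ≤ (if n = 0 then 1 else 0) + ∑ i, (c i).univalents + ∑ i, (c i).numLeaves
    by_cases hn : n = 0
    · simp [hn]; omega
    · have := Finset.sum_le_sum fun i (_ : i ∈ Finset.univ) => ih i
      rw [Finset.sum_add_distrib] at this
      simp at this
      omega

end DTree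

open DTree

theorem BVBase.contracted_eq {α : Type v} {T T' : DTree O.obj α} (h : BVBase O T T') :
    T.contracted = T'.contracted := by
  cases h with
  | unit s T => exact contracted_raise s T _
  | perm e x s c => exact contracted_node_congr (e.sum_comp fun i => (c i).contracted)
  | contract x s c y d h =>
    refine contracted_node_congr ?_
    rw [← finSigmaFinEquiv.sum_comp, Fintype.sum_sigma]
    exact Finset.sum_congr rfl fun i _ => (h i).sum_contracted

theorem contracted_eq_of_locally {α : Type v} {T T' : DTree O.obj α}
    (h : Locally (BVBase O) T T') : T.contracted = T'.contracted := by
  induction h with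
  | base h => exact h.contracted_eq
  | node x t c c' i hc _ ih =>
    refine contracted_node_congr (Finset.sum_congr rfl fun j _ => ?_)
    by_cases hj : j = i
    · subst hj; exact ih
    · rw [hc j hj]

/-- The number of univalent vertices after contraction of the inner edges of length zero. By
`BV.univalents_mk_le` and `BV.exists_univalents_eq`, this is the minimum over all representatives.
-/
noncomputable def BV.univalents {n : ℕ} : BV O n → ℕ :=
  Quot.lift (fun X => X.1.contracted.2) fun _ _ h =>
    congrArg Prod.snd (contracted_eq_of_locally h)

theorem BV.univalents_mk_le {n : ℕ} (X : PreBV O n) : (BV.mk X).univalents ≤ X.1.univalents :=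
  (Nat.le_add_right _ _).trans (contracted_le_univalents X.1)

theorem BV.univalents_ι_unit : (BV.ι O.unit).univalents = 0 := by
  change (DTree.corolla O.unit 1).contracted.2 = 0
  simp [DTree.corolla, contracted]

theorem BV.univalents_act {m n : ℕ} (e : Fin m ≃ Fin n) (x : BV O n) :
    (BV.act e x).univalents = x.univalents := by
  obtain ⟨X, rfl⟩ := BV.mk_surjective x
  refine (congrArg Prod.snd (contracted_bind X.1 (fun a => leaf (e.symm a)) fun _ => rfl)).trans ?_
  change _ + labelSum (fun _ => 0) _ = _
  rw [labelSum_eq]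
  simp
  rfl

theorem DTree.IsLabelled.labelSum_eq {A : ℕ → Type u} {n : ℕ} {T : DTree A (Fin n)}
    (h : T.IsLabelled) (f : Fin n → ℕ) : T.labelSum f = ∑ i, f i := by
  rw [DTree.labelSum_eq]
  exact (Equiv.ofBijective _ h).sum_comp f

/-- The number of univalent vertices is additive, because the edges created by a composition have
length one and are not contracted. -/
theorem BV.univalents_comp {n : ℕ} {m : Fin n → ℕ} (x : BV O n) (y : ∀ i, BV O (m i)) :
    (BV.comp x y).univalents = x.univalents + ∑ i, (y i).univalents := by
  obtain ⟨X, rfl⟩ := BV.mk_surjective x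
  choose Y hY using fun i => BV.mk_surjective (y i)
  obtain rfl : (fun i => BV.mk (Y i)) = y := funext hY
  rw [BV.comp_mk]
  have h : ∀ i, ((Y i).1.map fun k => finSigmaFinEquiv (⟨i, k⟩ : Σ i, Fin (m i))).contracted =
      (Y i).1.contracted := by
    intro i
    refine (contracted_bind (Y i).1 _ fun _ => rfl).trans ?_
    change (_, _ + labelSum (fun _ => 0) _) = _
    rw [DTree.labelSum_eq]
    simp
  refine (congrArg Prod.snd (contracted_bind X.1 _ fun i => ?_)).trans ?_
  · rw [h]; exact (Y i).2.2.contracted_fst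
  · simp only [h]
    rw [X.2.1.labelSum_eq]
    rfl

/-! #### Contracting all edges of length zero -/

namespace DTree

variable {α : Type v}

/-- A step of the equivalence relation which does not change whether the root has parameter one. -/
def BVStep (T T' : DTree O.obj α) : Prop := Locally (BVBase O) T T' ∧ (T.RootOne ↔ T'.RootOne)

/-- After contraction, each subtree above the root, with its output edge, still counts as one input
of the vertex below it. -/
def NoZeroAbove : DTree O.obj α → Prop
  | leaf _ => True
  | node _ _ c => ∀ i, (c i).contracted.1 = 1 ∧ (c i).NoZeroAbove

theorem eqvGen_node {n : ℕ} (x : O.obj n) (s : unitInterval) {c c' : Fin n → DTree O.obj α}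
    (h : ∀ i, Relation.EqvGen BVStep (c i) (c' i)) :
    Relation.EqvGen BVStep (node x s c) (node x s c') := by
  rw [← Quot.eq]
  refine quot_pi_congr (fun _ => BVStep) (fun c => Quot.mk BVStep (node x s c)) ?_ c c'
    fun i => Quot.eq.2 (h i)
  intro y i t ht
  refine Quot.sound ⟨.node x s _ _ i (fun j hj => by simp [Function.update_of_ne hj]) ?_, Iff.rfl⟩
  simpa using ht.1

/-- Every tree is equivalent to one which satisfies `NoZeroAbove`, obtained by contracting all edges
of length zero above the root. -/
theorem exists_noZeroAbove (T : DTree O.obj α) :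
    ∃ T', Relation.EqvGen BVStep T T' ∧ T'.NoZeroAbove := by
  induction T with
  | leaf a => exact ⟨_, .refl _, trivial⟩
  | node x s c ih =>
    choose c' hc hz using ih
    -- A subtree whose output edge has length zero is merged with the root, the other subtrees are
    -- kept. The relation `contract` performs all these merges at once.
    have h : ∀ i, ∃ (m : ℕ) (y : O.obj m) (d : Fin m → DTree O.obj α),
        Absorb O.unit 0 (c' i) y d ∧ ∀ k, (d k).contracted.1 = 1 ∧ (d k).NoZeroAbove := by
      intro i
      have hi := hz i
      generalize c' i = T at hi
      cases T with
      | leaf a => exact ⟨1, _, _, .keep _, fun _ => ⟨rfl, trivial⟩⟩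
      | node y t d =>
        by_cases ht : t = 0
        · subst ht
          exact ⟨_, y, d, .merge y d, hi⟩
        · exact ⟨1, _, _, .keep _, fun _ => ⟨by simp [contracted, if_neg ht], hi⟩⟩
    choose m y d hd hd' using h
    refine ⟨node (O.comp x y) s fun j => d _ (finSigmaFinEquiv.symm j).2, ?_, fun j => hd' _ _⟩
    refine (eqvGen_node x s hc).trans _ _ _ (.rel _ _ ⟨.base (.contract x s c' y _ ?_), Iff.rfl⟩)
    intro i
    convert hd i using 1
    funext k
    rw [Equiv.symm_apply_apply]

theorem NoZeroAbove.univalents {T : DTree O.obj α} (h : T.NoZeroAbove)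
    (h1 : T.contracted.1 = 1) : T.univalents = T.contracted.2 := by
  induction T with
  | leaf a => rfl
  | node x s c ih =>
    rename_i n
    have hk : ∀ i, (c i).univalents = (c i).contracted.2 := fun i => ih i (h i).2 (h i).1
    have ho : (∑ i, (c i).contracted).1 = n := by
      simp only [Prod.fst_sum, fun i => (h i).1]
      simp
    by_cases hs : s = 0
    · simp only [contracted, if_pos hs] at h1 ⊢
      rw [ho] at h1
      simp [DTree.univalents, hk, Prod.snd_sum, h1]
    · simp only [contracted, if_neg hs, ho, DTree.univalents, hk, Prod.snd_sum]
      omega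

end DTree

/-- The minimal number of univalent vertices is attained by a representative. -/
theorem BV.exists_univalents_eq {n : ℕ} (x : BV O n) :
    ∃ X : PreBV O n, BV.mk X = x ∧ X.1.univalents = x.univalents := by
  obtain ⟨X, rfl⟩ := BV.mk_surjective x
  obtain ⟨T, hT, hz⟩ := exists_noZeroAbove X.1
  -- The steps take place between trees which need not represent points of the resolution, so the
  -- conditions on representatives have to be carried along.
  have key : ∀ T T' : DTree O.obj (Fin n), Relation.EqvGen BVStep T T' →
      ((T.IsLabelled ∧ T.RootOne ↔ T'.IsLabelled ∧ T'.RootOne) ∧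
        ∀ h h', BV.mk ⟨T, h⟩ = BV.mk ⟨T', h'⟩) := by
    intro T T' h
    induction h with
    | rel T T' h =>
      refine ⟨and_congr ?_ h.2, fun _ _ => Quot.sound h.1⟩
      obtain ⟨e, hl, -⟩ := EvalEq.locally (fun _ _ => BVBase.evalEq) h.1
      have : T.label = T'.label ∘ e := funext hl
      rw [IsLabelled, IsLabelled, this]
      exact e.bijective.of_comp_iff T'.label
    | refl T => exact ⟨Iff.rfl, fun _ _ => rfl⟩
    | symm T T' _ ih => exact ⟨ih.1.symm, fun h h' => (ih.2 h' h).symm⟩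
    | trans T T' T'' _ _ ih ih' =>
      exact ⟨ih.1.trans ih'.1, fun h h' => (ih.2 h (ih.1.1 h)).trans (ih'.2 _ h')⟩
  obtain ⟨h1, h2⟩ := key _ _ hT
  refine ⟨⟨T, h1.1 X.2⟩, (h2 X.2 _).symm, ?_⟩
  exact (hz.univalents (h1.1 X.2).2.contracted_fst).trans
    (congrArg BV.univalents (h2 X.2 (h1.1 X.2))).symm

/-- Every vertex has an input or stands for a tree with a univalent vertex. This is the hypothesis
on weights used for filtrations below. -/
theorem BV.one_le_univalents_add {n : ℕ} (x : BV O n) : 1 ≤ x.univalents + n := by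
  obtain ⟨⟨T, hT⟩, -, h⟩ := BV.exists_univalents_eq x
  have h1 := DTree.one_le_univalents_add T
  rw [hT.1.numLeaves_eq] at h1
  exact h1.trans_eq (congrArg (· + n) h)

end univalents

/-! ### Filtrations defined by weights of vertices -/

namespace DTree

variable {A : ℕ → Type u} {B : ℕ → Type u} {α : Type v} {β : Type w}

/-- The number of geometrical inputs of the component at the root, when a vertex `x` stands for a
tree with `W x` univalent vertices. -/
noncomputable def inputsW (W : ∀ n, A n → ℕ) : DTree A α → ℕ
  | leaf _ => 1
  | node x t c => open Classical in if t = 1 then 1 else W _ x + ∑ i, (c i).inputsW W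

/-- The components left after removal of the vertices with parameters `0` and `1` have at most `k`
geometrical inputs, when a vertex `x` stands for a tree with `W x` univalent vertices. There is no
condition for `k = ⊤`. -/
def FilteredW (W : ∀ n, A n → ℕ) (k : ℕ∞) : DTree A α → Prop
  | leaf _ => 1 ≤ k
  | node x t c => open Classical in
      if t = 0 then ∀ i, (c i).FilteredW W k else ((node x t c).inputsW W : ℕ∞) ≤ k

variable {W : ∀ n, A n → ℕ} {k : ℕ∞}

theorem inputsW_leaf (a : α) : (leaf a : DTree A α).inputsW W = 1 := rfl

theorem inputsW_one {n : ℕ} (x : A n) (c : Fin n → DTree A α) : (node x 1 c).inputsW W = 1 := by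
  simp [inputsW]

theorem inputsW_of_rootGE_one {T : DTree A α} (h : T.RootGE 1) : T.inputsW W = 1 := by
  cases T with
  | leaf a => rfl
  | node x t c =>
    obtain rfl : t = 1 := le_antisymm unitInterval.le_one' h
    exact inputsW_one x c

theorem inputsW_of_ne_one {n : ℕ} (x : A n) {t : unitInterval} (ht : t ≠ 1)
    (c : Fin n → DTree A α) : (node x t c).inputsW W = W n x + ∑ i, (c i).inputsW W := by
  simp [inputsW, ht]

theorem filteredW_zero {n : ℕ} (x : A n) (c : Fin n → DTree A α) :
    (node x 0 c).FilteredW W k ↔ ∀ i, (c i).FilteredW W k := by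
  simp [FilteredW]

theorem filteredW_of_ne_zero {n : ℕ} (x : A n) {t : unitInterval} (ht : t ≠ 0)
    (c : Fin n → DTree A α) :
    (node x t c).FilteredW W k ↔ ((node x t c).inputsW W : ℕ∞) ≤ k := by
  simp [FilteredW, ht]

theorem filteredW_iff_of_rootGE {s : unitInterval} (hs : 0 < s) {T : DTree A α}
    (h : T.RootGE s) : T.FilteredW W k ↔ (T.inputsW W : ℕ∞) ≤ k := by
  cases T with
  | leaf a => simp [FilteredW, inputsW]
  | node x t c => exact filteredW_of_ne_zero x (hs.trans_le h).ne' c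

theorem inputsW_child_le {n : ℕ} (x : A n) {t : unitInterval} (ht : t ≠ 1)
    (c : Fin n → DTree A α) (i : Fin n) : (c i).inputsW W ≤ (node x t c).inputsW W := by
  rw [inputsW_of_ne_one x ht]
  exact (Finset.single_le_sum (f := fun i => (c i).inputsW W) (fun _ _ => Nat.zero_le _)
    (Finset.mem_univ i)).trans (Nat.le_add_left _ _)

theorem filteredW_of_inputsW_le {T : DTree A α} (h : (T.inputsW W : ℕ∞) ≤ k) :
    T.FilteredW W k := by
  induction T with
  | leaf a => simpa [inputsW, FilteredW] using h
  | node x t c ih =>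
    by_cases ht : t = 0
    · subst ht
      rw [filteredW_zero]
      exact fun i => ih i (le_trans (by exact_mod_cast inputsW_child_le x zero_ne_one c i) h)
    · rwa [filteredW_of_ne_zero x ht]

theorem filteredW_top (T : DTree A α) : T.FilteredW W ⊤ := filteredW_of_inputsW_le le_top

theorem inputsW_bind_leaf (f : α → β) (T : DTree A α) : (T.map f).inputsW W = T.inputsW W := by
  induction T with
  | leaf a => rfl
  | node x t c ih => simp only [map_node, inputsW, ih]

theorem filteredW_map {f : α → β} {T : DTree A α} :
    (T.map f).FilteredW W k ↔ T.FilteredW W k := by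
  induction T with
  | leaf a => rfl
  | node x t c ih =>
    have h : ∀ i, ((c i).map f).inputsW W = (c i).inputsW W := fun i => inputsW_bind_leaf f _
    simp only [map_node, FilteredW, ih, inputsW, h]

theorem inputsW_mapVert (W : ∀ n, B n → ℕ) (g : ∀ n, A n → B n) (T : DTree A α) :
    (T.mapVert g).inputsW W = T.inputsW fun n x => W n (g n x) := by
  induction T with
  | leaf a => rfl
  | node x t c ih => simp only [mapVert, inputsW, ih]

theorem filteredW_mapVert (W : ∀ n, B n → ℕ) (g : ∀ n, A n → B n) (T : DTree A α) :
    (T.mapVert g).FilteredW W k ↔ T.FilteredW (fun n x => W n (g n x)) k := by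
  induction T with
  | leaf a => rfl
  | node x t c ih => simp only [mapVert, FilteredW, ih, inputsW, inputsW_mapVert]

theorem inputsW_le_inputsW {W' : ∀ n, A n → ℕ} (h : ∀ n x, W n x ≤ W' n x) (T : DTree A α) :
    T.inputsW W ≤ T.inputsW W' := by
  induction T with
  | leaf a => rfl
  | node x t c ih =>
    by_cases ht : t = 1
    · subst ht; simp only [inputsW_one, le_refl]
    · rw [inputsW_of_ne_one x ht, inputsW_of_ne_one x ht]
      exact add_le_add (h _ _) (Finset.sum_le_sum fun i _ => ih i)

theorem FilteredW.of_le {W' : ∀ n, A n → ℕ} (h : ∀ n x, W n x ≤ W' n x) {T : DTree A α}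
    (hT : T.FilteredW W' k) : T.FilteredW W k := by
  induction T with
  | leaf a => exact hT
  | node x t c ih =>
    by_cases ht : t = 0
    · subst ht
      rw [filteredW_zero] at hT ⊢
      exact fun i => ih i (hT i)
    · rw [filteredW_of_ne_zero x ht] at hT ⊢
      exact le_trans (by exact_mod_cast inputsW_le_inputsW h _) hT

/-! #### Pieces of a filtered tree -/

section pieces

variable {p : unitInterval → Prop}

theorem forallLabel_cutAt_inputsW_le (h1 : ¬p 1) {T : DTree A α}
    (h : (T.inputsW W : ℕ∞) ≤ k) : (T.cutAt p).ForallLabel fun S => (S.inputsW W : ℕ∞) ≤ k :=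
  forallLabel_cutAt_of (C := fun S => (S.inputsW W : ℕ∞) ≤ k)
    (fun x t c ht h i =>
      le_trans (by exact_mod_cast inputsW_child_le x (fun h => h1 (h ▸ ht)) c i) h) h

/-- The trees left after removal of a part at the root which contains the vertices with parameter
`0` have at most `k` geometrical inputs. -/
theorem FilteredW.forallLabel_cutAt (h0 : p 0) (h1 : ¬p 1) {T : DTree A α}
    (h : T.FilteredW W k) : (T.cutAt p).ForallLabel fun S => (S.inputsW W : ℕ∞) ≤ k := by
  induction T with
  | leaf a => simpa [cutAt, ForallLabel, inputsW, FilteredW] using h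
  | node x t c ih =>
    by_cases hp : p t
    · rw [cutAt_pos hp]
      intro i
      by_cases ht : t = 0
      · subst ht
        exact ih i ((filteredW_zero x c).1 h i)
      · rw [filteredW_of_ne_zero x ht] at h
        exact ih i (filteredW_of_inputsW_le
          (le_trans (by exact_mod_cast inputsW_child_le x (fun h => h1 (h ▸ hp)) c i) h))
    · rw [cutAt_neg hp]
      exact (filteredW_of_ne_zero x (by rintro rfl; exact hp h0) c).1 h

/-- Every tree has a geometrical input if every vertex has an input or positive weight. -/
theorem one_le_inputsW (hW : ∀ n x, 1 ≤ W n x + n) (T : DTree A α) : 1 ≤ T.inputsW W := by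
  induction T with
  | leaf a => rfl
  | node x t c ih =>
    by_cases ht : t = 1
    · subst ht; rw [inputsW_one]
    · rw [inputsW_of_ne_one x ht]
      have := Finset.sum_le_sum fun i (_ : i ∈ Finset.univ) => ih i
      simp only [Finset.sum_const, Finset.card_univ, Fintype.card_fin, smul_eq_mul, mul_one] at this
      have := hW _ x
      omega

/-- The part at the root has at most as many geometrical inputs as the whole tree: each tree which
is cut off is replaced by a leaf and had at least one input itself. -/
theorem inputsW_mapParam_cutAt_le (hW : ∀ n x, 1 ≤ W n x + n) (h1 : ¬p 1)
    {r : unitInterval → unitInterval} (hr : ∀ t, p t → r t ≠ 1) (T : DTree A α) :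
    ((T.cutAt p).mapParam r).inputsW W ≤ T.inputsW W := by
  induction T with
  | leaf a => rfl
  | node x t c ih =>
    by_cases hp : p t
    · rw [cutAt_pos hp, mapParam, inputsW_of_ne_one x (hr t hp),
        inputsW_of_ne_one x (fun h => h1 (h ▸ hp))]
      exact add_le_add_right (Finset.sum_le_sum fun i _ => ih i) _
    · rw [cutAt_neg hp]
      exact one_le_inputsW hW _

/-- A component with at most `k` geometrical inputs has parts at the root of arity at most `k`, so
that truncated maps can be applied to these parts. -/
theorem numLeaves_cutAt_le (hW : ∀ n x, 1 ≤ W n x + n) (h1 : ¬p 1) (T : DTree A α) :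
    (T.cutAt p).numLeaves ≤ T.inputsW W := by
  induction T with
  | leaf a => rfl
  | node x t c ih =>
    by_cases hp : p t
    · rw [cutAt_pos hp, inputsW_of_ne_one x (fun h => h1 (h ▸ hp))]
      exact (Finset.sum_le_sum fun i _ => ih i).trans (Nat.le_add_left _ _)
    · rw [cutAt_neg hp]
      exact one_le_inputsW hW _

end pieces

end DTree

/-! ### Invariance of the filtration -/

section invariance

open DTree

variable {O : TopOperad.{u}}

/-- The number of univalent vertices as a weight. -/
noncomputable abbrev bvWeight (O : TopOperad.{u}) (n : ℕ) (x : BV O n) : ℕ := x.univalents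

theorem DTree.Absorb.inputsW_eq {α : Type v} {t : unitInterval} (ht : t ≠ 1)
    {T : DTree (BV O) α} {m : ℕ} {y : BV O m} {d : Fin m → DTree (BV O) α}
    (h : Absorb (BV.ι O.unit) t T y d) :
    T.inputsW (bvWeight O) = y.univalents + ∑ k, (d k).inputsW (bvWeight O) := by
  cases h with
  | merge y d => exact inputsW_of_ne_one _ ht _
  | keep T => simp [BV.univalents_ι_unit]

theorem DTree.Absorb.filteredW_iff {α : Type v} {k : ℕ∞} {T : DTree (BV O) α} {m : ℕ} {y : BV O m}
    {d : Fin m → DTree (BV O) α} (h : Absorb (BV.ι O.unit) 0 T y d) :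
    T.FilteredW (bvWeight O) k ↔ ∀ j, (d j).FilteredW (bvWeight O) k := by
  cases h with
  | merge y d => exact filteredW_zero y d
  | keep T => exact ⟨fun h _ => h, fun h => h 0⟩

/-- The number of geometrical inputs is invariant under the relations if no parameter is `0`. (At a
vertex with parameter `0` the relation `proj` may change the number of univalent vertices of the
label; at parameter `1` labels are not counted.) -/
theorem inputsW_eq_of_locally {α : Type v} {T T' : DTree (BV O) α} (hT : T.Mono)
    (h0 : T.ForallParam (· ≠ 0)) (h : Locally (WBBase O) T T') :
    T.inputsW (bvWeight O) = T'.inputsW (bvWeight O) := by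
  induction h with
  | base h =>
    cases h with
    | unit t T =>
      by_cases ht : t = 1
      · subst ht
        rw [inputsW_one, inputsW_of_rootGE_one (hT 0).1]
      · rw [inputsW_of_ne_one _ ht]
        simp [BV.univalents_ι_unit]
    | perm e x t c =>
      by_cases ht : t = 1
      · subst ht; simp only [inputsW_one]
      · rw [inputsW_of_ne_one _ ht, inputsW_of_ne_one _ ht]
        exact congrArg₂ _ (BV.univalents_act e x)
          (e.sum_comp fun i => (c i).inputsW (bvWeight O))
    | contract x t c y d h =>
      by_cases ht : t = 1
      · subst ht; simp only [inputsW_one]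
      · rw [inputsW_of_ne_one _ ht, inputsW_of_ne_one _ ht, bvWeight, bvWeight,
          BV.univalents_comp, ← finSigmaFinEquiv.sum_comp, Fintype.sum_sigma, add_assoc,
          ← Finset.sum_add_distrib]
        exact congrArg _ (Finset.sum_congr rfl fun i _ => (h i).inputsW_eq ht)
    | proj x t ht c =>
      obtain rfl | rfl := ht
      · exact absurd rfl h0.1
      · simp only [inputsW_one]
  | node x t c c' i hc _ ih =>
    by_cases ht : t = 1
    · subst ht; simp only [inputsW_one]
    · rw [inputsW_of_ne_one _ ht, inputsW_of_ne_one _ ht]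
      refine congrArg _ (Finset.sum_congr rfl fun j _ => ?_)
      by_cases hj : j = i
      · subst hj; exact ih (hT j).2 (h0.2 j)
      · rw [hc j hj]

theorem DTree.Mono.forallParam_ne_zero {α : Type v} {T : DTree (BV O) α} (hT : T.Mono)
    {s : unitInterval} (hs : s ≠ 0) (h : T.RootGE s) : T.ForallParam (· ≠ 0) :=
  (hT.forallParam_ge h).imp fun _ ht h0 => hs (le_antisymm (h0 ▸ ht) unitInterval.nonneg')

/-- The filtration does not depend on the representative. -/
theorem filteredW_iff_of_locally {α : Type v} {k : ℕ∞} {T T' : DTree (BV O) α} (hT : T.Mono)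
    (hT' : T'.Mono) (h : Locally (WBBase O) T T') :
    T.FilteredW (bvWeight O) k ↔ T'.FilteredW (bvWeight O) k := by
  -- Above the vertices with parameter zero, the condition only concerns the number of inputs.
  have key : ∀ {s : unitInterval} {T T' : DTree (BV O) α}, s ≠ 0 → T.Mono → T.RootGE s →
      T'.RootGE s → Locally (WBBase O) T T' →
      (T.FilteredW (bvWeight O) k ↔ T'.FilteredW (bvWeight O) k) := by
    intro s T T' hs hT h1 h2 h
    have hs' : 0 < s := lt_of_le_of_ne unitInterval.nonneg' (Ne.symm hs)
    rw [filteredW_iff_of_rootGE hs' h1, filteredW_iff_of_rootGE hs' h2,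
      inputsW_eq_of_locally hT (hT.forallParam_ne_zero hs h1) h]
  induction h with
  | base h =>
    cases h with
    | unit t T =>
      by_cases ht : t = 0
      · subst ht
        rw [filteredW_zero]
        exact ⟨fun h => h 0, fun h _ => h⟩
      · exact key ht hT le_rfl (hT 0).1 (.base (.unit t _))
    | perm e x t c =>
      by_cases ht : t = 0
      · subst ht
        rw [filteredW_zero, filteredW_zero]
        exact e.forall_congr_left.trans (by simp)
      · exact key (s := t) ht hT le_rfl le_rfl (.base (.perm e x t c))
    | contract x t c y d h =>
      by_cases ht : t = 0
      · subst ht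
        rw [filteredW_zero, filteredW_zero, ← finSigmaFinEquiv.forall_congr_right, Sigma.forall]
        exact forall_congr' fun i => (h i).filteredW_iff
      · exact key (s := t) ht hT le_rfl le_rfl (.base (.contract x t c y d h))
    | proj x t ht c =>
      by_cases ht0 : t = 0
      · subst ht0
        rw [filteredW_zero, filteredW_zero]
      · exact key (s := t) ht0 hT le_rfl le_rfl (.base (.proj x t ht c))
  | node x t c c' i hc h ih =>
    by_cases ht : t = 0
    · subst ht
      rw [filteredW_zero, filteredW_zero]
      refine forall_congr' fun j => ?_
      by_cases hj : j = i
      · subst hj; exact ih (hT j).2 (hT' j).2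
      · rw [hc j hj]
    · exact key (s := t) ht hT le_rfl le_rfl (.node x t c c' i hc h)

namespace WB

/-- Some (equivalently, every) representative is in the `k`-th filtration term. -/
def IsFiltered (k : ℕ∞) {n : ℕ} : WB O n → Prop :=
  Quot.lift (fun T => T.1.FilteredW (bvWeight O) k) fun X Y h =>
    propext (filteredW_iff_of_locally X.2.2 Y.2.2 h)

theorem isFiltered_mk {k : ℕ∞} {n : ℕ} (T : PreWB O n) :
    (mk T).IsFiltered k ↔ T.1.FilteredW (bvWeight O) k := Iff.rfl

theorem mk_surjective {n : ℕ} (z : WB O n) : ∃ T : PreWB O n, mk T = z := Quot.exists_rep z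

theorem isFiltered_top {n : ℕ} (z : WB O n) : z.IsFiltered ⊤ := by
  obtain ⟨T, rfl⟩ := mk_surjective z
  exact filteredW_top _

end WB

/-- The number of univalent vertices of an auxiliary tree as a weight. -/
abbrev preWeight (O : TopOperad.{u}) (n : ℕ) (X : PreBV O n) : ℕ := X.1.univalents

theorem inputsW_preWeight {α : Type v} (D : DTree (PreBV O) α) :
    D.inputsW (preWeight O) = D.inputs := by
  induction D with
  | leaf a => rfl
  | node x t c ih => simp only [inputsW, inputs, ih]

theorem filteredW_preWeight {α : Type v} {k : ℕ} {D : DTree (PreBV O) α} :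
    D.FilteredW (preWeight O) k ↔ D.Filtered k := by
  induction D with
  | leaf a => simp [FilteredW, Filtered]
  | node x t c ih =>
    by_cases ht : t = 0
    · subst ht
      rw [filteredW_zero]
      simp [Filtered, ih]
    · rw [filteredW_of_ne_zero x ht, inputsW_preWeight]
      simp [Filtered, ht]

/-- A point is in the `k`-th filtration term if and only if it is filtered in the sense of the
reduced number of univalent vertices. -/
theorem exists_toWB_iff {k n : ℕ} (z : WB O n) :
    (∃ D : PreWBk O k n, D.toWB = z) ↔ z.IsFiltered k := by
  constructor
  · rintro ⟨D, rfl⟩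
    refine (WB.isFiltered_mk _).2 ((filteredW_mapVert _ _ _).2 ?_)
    exact (filteredW_preWeight.2 D.2.2.2).of_le fun n x => BV.univalents_mk_le x
  · intro hz
    obtain ⟨T, rfl⟩ := WB.mk_surjective z
    -- Represent every label by an auxiliary tree with the minimal number of univalent vertices.
    choose s hs hsu using fun n (x : BV O n) => BV.exists_univalents_eq x
    have hT : (T.1.mapVert s).mapVert (fun _ => BV.mk) = T.1 := by
      generalize T.1 = S
      induction S with
      | leaf a => rfl
      | node x t c ih => simp only [mapVert, ih, hs]
    refine ⟨⟨T.1.mapVert s, T.2.1.mapVert s, T.2.2.mapVert s, ?_⟩,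
      congrArg WB.mk (Subtype.ext hT)⟩
    rw [← filteredW_preWeight, filteredW_mapVert]
    exact FilteredW.of_le (fun n x => (hsu n x).le) hz

end invariance

/-! ### Relations and relabelling -/

/-- A function on the union of blocks which is given on each block. -/
def blockFun {n : ℕ} {m : Fin n → ℕ} {β : Type w} (d : ∀ i, Fin (m i) → β) (j : Fin (∑ i, m i)) :
    β :=
  d (finSigmaFinEquiv.symm j).1 (finSigmaFinEquiv.symm j).2

theorem blockFun_apply {n : ℕ} {m : Fin n → ℕ} {β : Type w} (d : ∀ i, Fin (m i) → β) (i : Fin n)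
    (k : Fin (m i)) : blockFun d (finSigmaFinEquiv ⟨i, k⟩) = d i k := by
  rw [blockFun, Equiv.symm_apply_apply]

section lifting

open DTree

variable {O : TopOperad.{u}} {α : Type v} {β : Type w}

theorem DTree.map_eq_node {A : ℕ → Type u} {f : α → β} {S : DTree A α} {n : ℕ} {x : A n}
    {t : unitInterval} {c : Fin n → DTree A β} (h : S.map f = node x t c) :
    ∃ c', S = node x t c' ∧ ∀ i, (c' i).map f = c i := by
  cases S with
  | leaf a => cases h
  | node y s d =>
    rw [map_node] at h
    cases h
    exact ⟨d, rfl, fun _ => rfl⟩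

theorem DTree.Absorb.lift {A : ℕ → Type u} {f : α → β} {a : A 1} {τ : unitInterval} {T : DTree A β}
    {m : ℕ} {y : A m} {d : Fin m → DTree A β} (h : Absorb a τ T y d) {S : DTree A α}
    (hS : S.map f = T) : ∃ d', Absorb a τ S y d' ∧ ∀ k, (d' k).map f = d k := by
  cases h with
  | merge y d =>
    obtain ⟨d', rfl, hd⟩ := map_eq_node hS
    exact ⟨d', .merge y d', hd⟩
  | keep T => exact ⟨_, .keep S, fun _ => hS⟩

theorem WBBase.lift {f : α → β} {T T' : DTree (BV O) β} (h : WBBase O T T') {S : DTree (BV O) α}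
    (hS : S.map f = T) : ∃ S', WBBase O S S' ∧ S'.map f = T' := by
  cases h with
  | unit t T =>
    obtain ⟨c, rfl, hc⟩ := map_eq_node hS
    refine ⟨c 0, ?_, hc 0⟩
    rw [show c = fun _ => c 0 from funext fun i => congrArg c (Subsingleton.elim i 0)]
    exact .unit t (c 0)
  | perm e x t c =>
    obtain ⟨c', rfl, hc⟩ := map_eq_node hS
    refine ⟨node x t fun i => c' (e.symm i), ?_, ?_⟩
    · have := WBBase.perm (O := O) e x t fun i => c' (e.symm i)
      simpa only [Equiv.symm_apply_apply] using this
    · simp only [map_node, hc, Equiv.apply_symm_apply]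
  | contract x t c y d h =>
    obtain ⟨c', rfl, hc⟩ := map_eq_node hS
    choose d' hd hd' using fun i => (h i).lift (hc i)
    refine ⟨node (BV.comp x y) t fun j => d' _ (finSigmaFinEquiv.symm j).2,
      .contract x t c' y _ fun i => ?_, ?_⟩
    · convert hd i using 1
      funext k
      rw [Equiv.symm_apply_apply]
    · rw [map_node]
      congr 1
      funext j
      rw [hd']
      exact congrArg d (finSigmaFinEquiv.apply_symm_apply j)
  | proj x t ht c =>
    obtain ⟨c', rfl, hc⟩ := map_eq_node hS
    exact ⟨_, .proj x t ht c', by rw [map_node]; congr 1; exact funext hc⟩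

/-- The relations do not involve the labels of the leaves, so they lift along a change of these
labels. -/
theorem locally_lift {f : α → β} {T T' : DTree (BV O) β} (h : Locally (WBBase O) T T') :
    ∀ S : DTree (BV O) α, S.map f = T → ∃ S', Locally (WBBase O) S S' ∧ S'.map f = T' := by
  induction h with
  | base h =>
    intro S hS
    obtain ⟨S', h', hS'⟩ := h.lift hS
    exact ⟨S', .base h', hS'⟩
  | node x t c c' i hc _ ih =>
    intro S hS
    obtain ⟨d, rfl, hd⟩ := map_eq_node hS
    obtain ⟨S', h', hS'⟩ := ih (d i) (hd i)
    refine ⟨node x t (Function.update d i S'), .node x t _ _ i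
      (fun j hj => by simp [Function.update_of_ne hj]) (by simpa using h'), ?_⟩
    rw [map_node]
    congr 1
    funext j
    by_cases hj : j = i
    · subst hj; simpa using hS'
    · rw [Function.update_of_ne hj, hd, hc j hj]

theorem numLeaves_eq_of_locally {T T' : DTree (BV O) α} (h : Locally (WBBase O) T T') :
    T.numLeaves = T'.numLeaves := by
  obtain ⟨e, -⟩ := EvalEq.locally (P := O) (g := fun _ => BV.μ) (fun _ _ h => by
    obtain ⟨e, hl, he⟩ := WBBase.evalEq (O' := O)
      ⟨fun _ x => x, fun _ => continuous_id, fun _ _ => rfl, rfl, fun _ _ => rfl⟩ h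
    exact ⟨e, hl, he⟩) h
  simpa using Fintype.card_congr e

theorem isLabelled_of_map {A : ℕ → Type u} {n : ℕ} {T T' : DTree A (Fin n)}
    (e : Fin T.numLeaves ≃ Fin T'.numLeaves) (h : ∀ j, T.label j = T'.label (e j))
    (hT : T.IsLabelled) : T'.IsLabelled := by
  have : T.label = T'.label ∘ e := funext h
  rw [IsLabelled, this] at hT
  exact (e.bijective.of_comp_iff T'.label).1 hT

end lifting

/-! ### Maps of bimodules on trees -/

section pieceEval

open DTree

variable {O O' : TopOperad.{u}} (η : O.Hom O') {α : Type v} {β : Type w}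

open Classical in
/-- A function on `WB(O)` applied to a tree, as an element of a free algebra. (The value is only
relevant if the parameters of the tree increase.) -/
noncomputable def pieceEval (f : ∀ q, WB O q → O'.obj q) (T : DTree (BV O) α) : FreeAlg O' α :=
  if h : T.Mono then
    FreeAlg.mk ⟨T.numLeaves, f _ (WB.mk ⟨T.planar, T.isLabelled_planar, h.relabel _⟩), T.label⟩
  else treeEval η T

theorem mk_labelledPoint_cast (f : ∀ q, WB O q → O'.obj q) {N N' : ℕ} (hN : N' = N)
    (X : PreWB O N) (X' : PreWB O N') (hX : X'.1 = X.1.map (Fin.cast hN.symm)) (l : Fin N → α)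
    (l' : Fin N' → α) (hl : ∀ j, l' j = l (Fin.cast hN j)) :
    (⟨N', f N' (WB.mk X'), l'⟩ : LabelledPoint O' α) = ⟨N, f N (WB.mk X), l⟩ := by
  subst hN
  obtain rfl : X' = X := Subtype.ext (hX.trans (bind_leaf _))
  obtain rfl : l' = l := funext hl
  rfl

variable {η}

theorem pieceEval_of_mono (f : ∀ q, WB O q → O'.obj q) {T : DTree (BV O) α} (h : T.Mono) :
    pieceEval η f T = FreeAlg.op
      (f _ (WB.mk ⟨T.planar, T.isLabelled_planar, h.relabel _⟩)) fun j =>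
        FreeAlg.pure (T.label j) := by
  rw [pieceEval, dif_pos h]
  exact FreeAlg.mk_eq_op _

theorem pieceEval_map (f : ∀ q, WB O q → O'.obj q) (T : DTree (BV O) α) (h : α → β) :
    pieceEval η f (T.map h) = (pieceEval η f T).bind fun a => FreeAlg.pure (h a) := by
  by_cases hT : T.Mono
  · rw [pieceEval_of_mono f hT, FreeAlg.op_pure_bind, FreeAlg.op_eq_mk, pieceEval,
      dif_pos ((mono_map_iff h).2 hT)]
    -- The number of leaves is preserved only propositionally, hence the transport along an
    -- equality.
    have key : ∀ (S : DTree (BV O) β) (hS : S.Mono), (T.relabel fun j => h (T.label j)) = S →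
        (⟨S.numLeaves, f _ (WB.mk ⟨S.planar, S.isLabelled_planar, hS.relabel _⟩), S.label⟩ :
          LabelledPoint O' β) =
        ⟨T.numLeaves, f _ (WB.mk ⟨T.planar, T.isLabelled_planar, hT.relabel _⟩),
          fun j => h (T.label j)⟩ := by
      rintro S hS rfl
      obtain ⟨hN, hl, hr⟩ := exists_cast_relabel
        (γ := Fin (T.relabel fun j => h (T.label j)).numLeaves) T fun j => h (T.label j)
      exact mk_labelledPoint_cast f hN ⟨T.planar, T.isLabelled_planar, hT.relabel _⟩ _
        ((hr fun j => j).trans (relabel_map T (fun j => j) _).symm) _ _ hl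
    exact congrArg FreeAlg.mk (key _ ((mono_map_iff h).2 hT) (relabel_label T h))
  · rw [pieceEval, pieceEval, dif_neg hT, dif_neg (fun h' => hT ((mono_map_iff h).1 h'))]
    exact freeEval_map _ _

theorem mk_applyRescaled (c : LittleInterval) (f : ∀ q, WB O q → O'.obj q) {T : DTree (BV O) α}
    (h : T.Mono) :
    FreeAlg.mk (applyRescaled c f T h) = pieceEval η f (T.mapParam c.inv) := by
  rw [pieceEval, dif_pos (h.mapParam c.inv_mono), applyRescaled]
  congr 1
  obtain ⟨hN, hl, hr⟩ := exists_cast_mapParam (γ := Fin (T.mapParam c.inv).numLeaves) T c.inv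
  refine (mk_labelledPoint_cast f hN _ _ ?_ _ _ hl).symm
  refine (hr _).trans ?_
  rw [← mapParam_map, planar, relabel_map]

variable (η) in
/-- `f` is compatible with those operations which only involve points of the `k`-th filtration term
of arity at most `k`. -/
structure IsBimodMapOn (k : ℕ∞) (f : ∀ q, WB O q → O'.obj q) : Prop where
  act : ∀ {m n : ℕ} (e : Fin m ≃ Fin n) (z : WB O n), (n : ℕ∞) ≤ k → z.IsFiltered k →
    f m (WB.act e z) = O'.act e (f n z)
  right : ∀ {n : ℕ} {m : Fin n → ℕ} (z : WB O n) (a : ∀ i, O.obj (m i)), (n : ℕ∞) ≤ k →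
    z.IsFiltered k → ((∑ i, m i : ℕ) : ℕ∞) ≤ k →
    f _ (WB.right z a) = O'.comp (f n z) fun i => η.toFun _ (a i)
  left : ∀ {n : ℕ} {m : Fin n → ℕ} (a : O.obj n) (y : ∀ i, WB O (m i)),
    (∀ i, (y i).IsFiltered k) → ((∑ i, m i : ℕ) : ℕ∞) ≤ k →
    f _ (WB.left a y) = O'.comp (η.toFun _ a) fun i => f _ (y i)

variable {k : ℕ∞} {f : ∀ q, WB O q → O'.obj q}

/-- For a labelled tree, the value is the value of `f` at the point represented by the tree. -/
theorem IsBimodMapOn.pieceEval_eq_op_pure (hf : IsBimodMapOn η k f) {n : ℕ}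
    {T : DTree (BV O) (Fin n)} (hT : T.IsLabelled ∧ T.Mono) (hn : (n : ℕ∞) ≤ k)
    (hF : T.FilteredW (bvWeight O) k) :
    pieceEval η f T = FreeAlg.op (f n (WB.mk ⟨T, hT⟩)) FreeAlg.pure := by
  rw [pieceEval_of_mono f hT.2]
  let e : Fin T.numLeaves ≃ Fin n := Equiv.ofBijective T.label hT.1
  have h : (⟨T.planar, T.isLabelled_planar, hT.2.relabel _⟩ : PreWB O T.numLeaves) =
      PreWB.act e ⟨T, hT⟩ := by
    refine Subtype.ext (Eq.trans ?_ (congrArg (map e.symm) (planar_map_label T)))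
    rw [map_map, show (fun a => e.symm (T.label a)) = fun a => a from
      funext e.symm_apply_apply]
    exact (bind_leaf _).symm
  rw [h]
  refine (congrArg (fun y => FreeAlg.op y _) (hf.act e (WB.mk ⟨T, hT⟩) hn hF)).trans ?_
  exact FreeAlg.op_act e _ FreeAlg.pure

theorem IsBimodMapOn.pieceEval_map_eq_op (hf : IsBimodMapOn η k f) {n : ℕ}
    {T : DTree (BV O) (Fin n)} (hT : T.IsLabelled ∧ T.Mono) (hn : (n : ℕ∞) ≤ k)
    (hF : T.FilteredW (bvWeight O) k) (l : Fin n → α) :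
    pieceEval η f (T.map l) =
      FreeAlg.op (f n (WB.mk ⟨T, hT⟩)) fun i => FreeAlg.pure (l i) := by
  rw [pieceEval_map, hf.pieceEval_eq_op_pure hT hn hF]
  exact FreeAlg.op_pure_bind _ (fun i => i) _

theorem filteredW_planar {T : DTree (BV O) α} :
    T.planar.FilteredW (bvWeight O) k ↔ T.FilteredW (bvWeight O) k := by
  conv_rhs => rw [← planar_map_label T]
  exact filteredW_map.symm

/-- The value does not change when a relation is applied to the tree. -/
theorem IsBimodMapOn.pieceEval_eq_of_locally (hf : IsBimodMapOn η k f) {T T' : DTree (BV O) α}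
    (hT : T.Mono) (hT' : T'.Mono) (hF : T.FilteredW (bvWeight O) k)
    (hk : (T.numLeaves : ℕ∞) ≤ k) (h : Locally (WBBase O) T T') :
    pieceEval η f T = pieceEval η f T' := by
  -- Number the leaves, so that both trees represent points of `WB(O)`.
  obtain ⟨S, hS, rfl⟩ := locally_lift h _ (planar_map_label T)
  have hm : S.Mono := (mono_map_iff _).1 hT'
  obtain ⟨e, hl, -⟩ := EvalEq.locally (fun _ _ => WBBase.evalEq η) hS
  have hX : T.planar.IsLabelled ∧ T.planar.Mono := ⟨T.isLabelled_planar, hT.relabel _⟩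
  have hY : S.IsLabelled ∧ S.Mono := ⟨isLabelled_of_map e hl T.isLabelled_planar, hm⟩
  have hXF : T.planar.FilteredW (bvWeight O) k := filteredW_planar.2 hF
  have hXY : WB.mk ⟨T.planar, hX⟩ = WB.mk ⟨S, hY⟩ := Quot.sound hS
  conv_lhs => rw [← planar_map_label T]
  rw [hf.pieceEval_map_eq_op hX hk hXF, hf.pieceEval_map_eq_op hY hk
    ((filteredW_iff_of_locally hX.2 hm hS).1 hXF), hXY]

/-- A vertex with parameter `0` acts through the left operation. -/
theorem IsBimodMapOn.pieceEval_zero (hf : IsBimodMapOn η k f) {n : ℕ} (x : BV O n)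
    (c : Fin n → DTree (BV O) α) (hT : (node x 0 c).Mono)
    (hF : (node x 0 c).FilteredW (bvWeight O) k) (hk : ((node x 0 c).numLeaves : ℕ∞) ≤ k) :
    pieceEval η f (node x 0 c) = FreeAlg.op (η.toFun n (BV.μ x)) fun i => pieceEval η f (c i) := by
  -- As the parameter is `0`, the label may be assumed to come from `O`.
  rw [hf.pieceEval_eq_of_locally (T' := node (BV.ι (BV.μ x)) 0 c) hT hT hF hk
    (.base (.proj x 0 (Or.inl rfl) c))]
  generalize BV.μ x = a
  let Y : ∀ i, PreWB O (c i).numLeaves := fun i =>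
    ⟨(c i).planar, (c i).isLabelled_planar, (hT i).2.relabel _⟩
  have hYF : ∀ i, (Y i).1.FilteredW (bvWeight O) k := fun i =>
    filteredW_planar.2 ((filteredW_zero x c).1 hF i)
  let l : Fin (∑ i, (c i).numLeaves) → α := fun j =>
    (c (finSigmaFinEquiv.symm j).1).label (finSigmaFinEquiv.symm j).2
  have hl : ∀ i k, l (finSigmaFinEquiv ⟨i, k⟩) = (c i).label k := fun i k =>
    label_node (BV.ι a) 0 c ⟨i, k⟩
  have h : node (BV.ι a) 0 c = (PreWB.left a Y).1.map l := by
    change _ = node (BV.ι a) 0 fun i => (((Y i).1.map _).map l)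
    congr 1
    funext i
    rw [map_map]
    simp only [hl]
    exact (planar_map_label _).symm
  have hFl : (PreWB.left a Y).1.FilteredW (bvWeight O) k := by
    refine (filteredW_zero (BV.ι a) _).2 fun i => ?_
    exact filteredW_map.2 (hYF i)
  rw [h]
  refine (hf.pieceEval_map_eq_op (PreWB.left a Y).2 hk hFl l).trans ?_
  refine (congrArg (fun y => FreeAlg.op y _)
    ((congrArg (f _) (WB.left_mk a Y).symm).trans (hf.left a _ hYF hk))).trans ?_
  rw [FreeAlg.op_comp]
  congr 1
  funext i
  rw [pieceEval_of_mono f (hT i).2]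
  simp only [hl]
  rfl

/-! #### Trees all of whose parameters are one -/

/-- Trees all of whose vertices have parameter `1`. -/
def OneTree (O : TopOperad.{u}) (α : Type v) : Type (max u v) :=
  {T : DTree (BV O) α // T.Mono ∧ T.RootGE 1}

/-- The relations on trees all of whose vertices have parameter `1`. -/
def OneTree.Step (T T' : OneTree O α) : Prop := Locally (WBBase O) T.1 T'.1

/-- A corolla with parameter `1`, with labelled leaves. -/
def OneTree.corolla {n : ℕ} (x : BV O n) (l : Fin n → α) : OneTree O α :=
  ⟨node x 1 fun i => leaf (l i), fun _ => ⟨trivial, trivial⟩, le_rfl⟩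

/-- A tree all of whose vertices have parameter `1` is equivalent to a corolla. -/
theorem OneTree.exists_corolla (T : OneTree O α) : ∃ (m : ℕ) (a : O.obj m) (l : Fin m → α),
    Quot.mk OneTree.Step T = Quot.mk OneTree.Step (OneTree.corolla (BV.ι a) l) := by
  obtain ⟨T, hT⟩ := T
  induction T with
  | leaf a => exact ⟨1, O.unit, fun _ => a, (Quot.sound (.base (.unit 1 (leaf a)))).symm⟩
  | node x t c ih =>
    rename_i n
    obtain rfl : t = 1 := le_antisymm unitInterval.le_one' hT.2
    choose m a l h using fun i => ih i ⟨(hT.1 i).2, (hT.1 i).1⟩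
    let F : (Fin n → OneTree O α) → OneTree O α := fun y =>
      ⟨node x 1 fun i => (y i).1, fun i => ⟨(y i).2.2, (y i).2.1⟩, le_rfl⟩
    have h1 := quot_pi_congr (fun _ : Fin n => OneTree.Step (O := O) (α := α))
      (fun y => Quot.mk OneTree.Step (F y)) (fun y i t ht => Quot.sound
        (.node x 1 _ _ i (fun j hj => by simp [Function.update_of_ne hj])
          (by simpa using (show Locally (WBBase O) (y i).1 t.1 from ht))))
      _ _ h
    let l' : Fin (∑ i, m i) → α := blockFun l
    have h2 : OneTree.Step (F fun i => corolla (BV.ι (a i)) (l i))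
        (corolla (BV.comp x fun i => BV.ι (a i)) l') := by
      refine .base (.contract x 1 _ _ _ fun i => ?_)
      have hl : (fun k => leaf (l' (finSigmaFinEquiv ⟨i, k⟩))) =
          fun k => (leaf (l i k) : DTree (BV O) α) := by
        funext k
        simp only [l', blockFun_apply]
      rw [hl]
      exact .merge _ _
    exact ⟨_, _, l', h1.trans ((Quot.sound h2).trans
      (Quot.sound (.base (.proj _ 1 (Or.inr rfl) _))))⟩

theorem treeEval_oneTree {T T' : OneTree O α}
    (h : Quot.mk OneTree.Step T = Quot.mk OneTree.Step T') :
    treeEval η T.1 = treeEval η T'.1 :=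
  congrArg (Quot.lift (fun T : OneTree O α => treeEval η T.1)
    fun _ _ h => treeEval_eq_of_locally η h) h

theorem DTree.inputsW_bind {A : ℕ → Type u} {W : ∀ n, A n → ℕ} {C : DTree A α} {S : α → DTree A β}
    (h : C.ForallLabel fun a => (S a).RootGE 1) : (C.bind S).inputsW W = C.inputsW W := by
  induction C with
  | leaf a => exact inputsW_of_rootGE_one h
  | node x t c ih =>
    have hi : ∀ i, ((c i).bind S).inputsW W = (c i).inputsW W := fun i => ih i (h i)
    simp only [DTree.bind, inputsW, hi]

theorem DTree.FilteredW.bind {A : ℕ → Type u} {W : ∀ n, A n → ℕ} {C : DTree A α}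
    {S : α → DTree A β} (hC : C.FilteredW W k) (h : C.ForallLabel fun a => (S a).RootGE 1) :
    (C.bind S).FilteredW W k := by
  induction C with
  | leaf a =>
    refine filteredW_of_inputsW_le ?_
    change ((S a).inputsW W : ℕ∞) ≤ k
    rw [inputsW_of_rootGE_one h]
    exact_mod_cast hC
  | node x t c ih =>
    by_cases ht : t = 0
    · subst ht
      rw [filteredW_zero] at hC
      exact (filteredW_zero _ _).2 fun i => ih i (hC i) (h i)
    · rw [filteredW_of_ne_zero _ ht] at hC
      refine (filteredW_of_ne_zero _ ht _).2 ?_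
      rw [← inputsW_bind h] at hC
      exact hC

theorem DTree.Mono.bind_of_rootGE_one {A : ℕ → Type u} {C : DTree A α} {S : α → DTree A β}
    (hC : C.Mono) (h : C.ForallLabel fun a => (S a).Mono ∧ (S a).RootGE 1) :
    (C.bind S).Mono := by
  induction C with
  | leaf a => exact h.1
  | node x t c ih =>
    refine fun i => ⟨?_, ih i (hC i).2 (h i)⟩
    have h1 := (hC i).1
    have h2 := h i
    change RootGE t ((c i).bind S)
    revert h1 h2
    generalize c i = T
    intro h1 h2
    cases T with
    | leaf a => exact RootGE.trans (T := S a) h2.2 unitInterval.le_one'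
    | node y s d => exact h1

/-- Trees with parameter `1` on top of a tree act through the right operation. -/
theorem IsBimodMapOn.pieceEval_bind_one (hf : IsBimodMapOn η k f) {C : DTree (BV O) α}
    {S : α → DTree (BV O) β} (hC : C.Mono) (hCF : C.FilteredW (bvWeight O) k)
    (hCk : (C.numLeaves : ℕ∞) ≤ k) (hS : C.ForallLabel fun a => (S a).Mono ∧ (S a).RootGE 1)
    (hk : ((C.bind S).numLeaves : ℕ∞) ≤ k) :
    pieceEval η f (C.bind S) = (pieceEval η f C).bind fun a => treeEval η (S a) := by
  rw [forallLabel_iff] at hS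
  let n := C.numLeaves
  have hX : C.planar.IsLabelled ∧ C.planar.Mono := ⟨C.isLabelled_planar, hC.relabel _⟩
  have hXF : C.planar.FilteredW (bvWeight O) k := filteredW_planar.2 hCF
  -- The trees on top are replaced one at a time by corollas, which act through the right operation.
  let S₀ : Fin n → OneTree O β := fun i => ⟨S (C.label i), hS i⟩
  choose m a l h using fun i => (S₀ i).exists_corolla
  have hb : C.bind S = C.planar.bind fun i => (S₀ i).1 := by
    conv_lhs => rw [← planar_map_label C, map_bind]
  have hmono : ∀ y : Fin n → OneTree O β, (C.planar.bind fun i => (y i).1).Mono := fun y =>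
    hX.2.bind_of_rootGE_one (.of_forall (fun i => (y i).2) _)
  have hfilt : ∀ y : Fin n → OneTree O β,
      (C.planar.bind fun i => (y i).1).FilteredW (bvWeight O) k := fun y =>
    hXF.bind (.of_forall (fun i => (y i).2.2) _)
  have hstep : ∀ (y : Fin n → OneTree O β) (i : Fin n) (t : OneTree O β), (y i).Step t →
      Locally (WBBase O) (C.planar.bind fun i => (y i).1)
        (C.planar.bind fun j => (Function.update y i t j).1) := fun y i t ht =>
    Locally.bind_right _ i ((isLabelled_iff _).1 hX.1 i) _ _
      (fun j hj => by simp [Function.update_of_ne hj])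
      (by simpa using (show Locally (WBBase O) (y i).1 t.1 from ht))
  have h1 := quot_pi_congr (fun _ : Fin n => OneTree.Step (O := O) (α := β))
    (fun y => (C.planar.bind fun i => (y i).1).numLeaves)
    (fun y i t ht => numLeaves_eq_of_locally (hstep y i t ht)) _ _ h
  classical
  -- The bound on the number of leaves is only known for the given trees; in the other cases,
  -- `treeEval` serves as a value which is invariant as well.
  have h2 := quot_pi_congr (fun _ : Fin n => OneTree.Step (O := O) (α := β))
    (fun y => if ((C.planar.bind fun i => (y i).1).numLeaves : ℕ∞) ≤ k then
      pieceEval η f (C.planar.bind fun i => (y i).1)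
    else treeEval η (C.planar.bind fun i => (y i).1))
    (fun y i t ht => by
      have hs := hstep y i t ht
      rw [← numLeaves_eq_of_locally hs]
      split_ifs with hle
      · exact hf.pieceEval_eq_of_locally (hmono _) (hmono _) (hfilt _) hle hs
      · exact treeEval_eq_of_locally η hs) _ _ h
  rw [hb] at hk ⊢
  rw [if_pos hk, if_pos (h1 ▸ hk)] at h2
  rw [h2]
  rw [h1] at hk
  let l' : Fin (∑ i, m i) → β := blockFun l
  have hr : (C.planar.bind fun i => (OneTree.corolla (BV.ι (a i)) (l i)).1) =
      (PreWB.right ⟨C.planar, hX⟩ a).1.map l' := by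
    change _ = (C.planar.bind _).map l'
    rw [DTree.bind_map]
    congr 1
    funext i
    change node _ 1 _ = node _ 1 _
    congr 1
    funext j
    change leaf _ = leaf _
    simp only [l', blockFun_apply]
  have hFr : (PreWB.right ⟨C.planar, hX⟩ a).1.FilteredW (bvWeight O) k :=
    hXF.bind (.of_forall (fun i => le_rfl) _)
  have hkr : ((∑ i, m i : ℕ) : ℕ∞) ≤ k := by
    rwa [hr, numLeaves_map, (PreWB.right ⟨C.planar, hX⟩ a).2.1.numLeaves_eq] at hk
  rw [hr]
  refine (hf.pieceEval_map_eq_op (PreWB.right ⟨C.planar, hX⟩ a).2 hkr hFr l').trans ?_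
  refine (congrArg (fun y => FreeAlg.op y _)
    (hf.right (WB.mk ⟨C.planar, hX⟩) a hCk hXF hkr)).trans ?_
  rw [FreeAlg.op_comp, pieceEval_of_mono f hC, FreeAlg.op_pure_bind]
  congr 1
  funext i
  rw [show treeEval η (S (C.label i)) = treeEval η (S₀ i).1 from rfl, treeEval_oneTree (h i)]
  refine Eq.trans ?_ (freeEval_node _ _ _).symm
  simp only [BV.μ_ι, freeEval_leaf]
  congr 1
  funext j
  simp only [l', blockFun_apply]

/-- The value on a tree is obtained by cutting off the vertices with parameters `0` and `1`. -/
theorem IsBimodMapOn.pieceEval_eq_bind (hf : IsBimodMapOn η k f) {T : DTree (BV O) α} (hT : T.Mono)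
    (hF : T.FilteredW (bvWeight O) k) (hk : (T.numLeaves : ℕ∞) ≤ k) :
    pieceEval η f T = (treeEval η (T.cutAt (· ≤ 0))).bind fun S =>
      (pieceEval η f (S.cutAt (· < 1))).bind (treeEval η) := by
  -- The vertices with parameter `1` act through the right operation.
  have key : ∀ S : DTree (BV O) α, S.Mono → (S.inputsW (bvWeight O) : ℕ∞) ≤ k →
      (S.numLeaves : ℕ∞) ≤ k →
      pieceEval η f S = (pieceEval η f (S.cutAt (· < 1))).bind (treeEval η) := by
    intro S hS hi hk
    have hlt : ¬(1 : unitInterval) < 1 := lt_irrefl _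
    have hW : ∀ (n : ℕ) (x : BV O n), 1 ≤ bvWeight O n x + n := fun _ x => x.one_le_univalents_add
    have h1 := inputsW_mapParam_cutAt_le (p := (· < 1)) hW hlt (r := fun t => t)
      (fun t ht => ne_of_lt ht) S
    rw [mapParam_id] at h1
    have h2 := numLeaves_cutAt_le (p := (· < 1)) hW hlt S
    have h := hf.pieceEval_bind_one (C := S.cutAt (· < 1)) (S := fun S => S) hS.cutAt
      (filteredW_of_inputsW_le (le_trans (Nat.cast_le.2 h1) hi))
      (le_trans (Nat.cast_le.2 h2) hi)
      (hS.forallLabel_cutAt.and ((forallLabel_cutAt_self S).imp fun S' h' => ?_))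
      (by rwa [cutAt_bind_id])
    · rwa [cutAt_bind_id] at h
    · cases S' with
      | leaf a => trivial
      | node x t c =>
        by_contra hlt'
        rw [cutAt_pos (p := (· < 1)) (lt_of_not_ge hlt')] at h'
        cases h'
  -- The vertices with parameter `0` at the root act through the left operation.
  induction T with
  | leaf a =>
    rw [cutAt_leaf, treeEval, freeEval_leaf, FreeAlg.pure_bind]
    exact key _ trivial (by simpa [inputsW, FilteredW] using hF) hk
  | node x t c ih =>
    by_cases ht : t ≤ 0
    · obtain rfl : t = 0 := le_antisymm ht unitInterval.nonneg'
      rw [hf.pieceEval_zero x c hT hF hk, cutAt_pos (p := (· ≤ 0)) le_rfl, treeEval, freeEval_node,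
        FreeAlg.bind_op]
      congr 1
      funext i
      refine ih i (hT i).2 ((filteredW_zero x c).1 hF i) (le_trans ?_ hk)
      exact_mod_cast Finset.single_le_sum (f := fun i => (c i).numLeaves)
        (fun _ _ => Nat.zero_le _) (Finset.mem_univ i)
    · rw [cutAt_neg (p := (· ≤ 0)) ht, treeEval, freeEval_leaf, FreeAlg.pure_bind]
      exact key _ hT ((filteredW_of_ne_zero x (fun h => ht h.le) c).1 hF) hk

end pieceEval

/-! ### Inverses of little intervals -/

namespace LittleInterval

theorem left_nonneg (c : LittleInterval) : 0 ≤ c.left := c.2.1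

theorem left_lt_right (c : LittleInterval) : c.left < c.right := c.2.2.1

theorem right_le_one (c : LittleInterval) : c.right ≤ 1 := c.2.2.2

theorem left_lt_one (c : LittleInterval) : c.left < 1 := c.left_lt_right.trans_le c.right_le_one

theorem left_comp (c d : LittleInterval) : (c.comp d).left = c.toFun d.left := rfl

theorem right_comp (c d : LittleInterval) : (c.comp d).right = c.toFun d.right := rfl

theorem left_le_left_comp (c d : LittleInterval) : c.left ≤ (c.comp d).left := by
  have := c.left_lt_right
  have := d.left_nonneg
  rw [left_comp, toFun]
  nlinarith

theorem right_comp_le_right (c d : LittleInterval) : (c.comp d).right ≤ c.right := by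
  have := c.left_lt_right
  have := d.right_le_one
  rw [right_comp, toFun]
  nlinarith

theorem coe_inv (c : LittleInterval) (t : unitInterval) :
    (c.inv t : ℝ) = max 0 (min 1 (((t : ℝ) - c.left) / (c.right - c.left))) := by
  rw [inv, Set.coe_projIcc]

theorem inv_le_left_iff (c d : LittleInterval) (t : unitInterval) :
    (c.inv t : ℝ) ≤ d.left ↔ (t : ℝ) ≤ (c.comp d).left := by
  have hc := sub_pos.2 c.left_lt_right
  have h0 := d.left_nonneg
  have h1 := d.left_lt_one
  rw [coe_inv, left_comp, toFun, max_le_iff, min_le_iff, div_le_iff₀ hc]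
  constructor
  · rintro ⟨-, h | h⟩ <;> nlinarith
  · exact fun h => ⟨h0, Or.inr (by nlinarith)⟩

theorem inv_lt_right_iff (c d : LittleInterval) (t : unitInterval) :
    (c.inv t : ℝ) < d.right ↔ (t : ℝ) < (c.comp d).right := by
  have hc := sub_pos.2 c.left_lt_right
  have h0 := d.left_nonneg.trans_lt d.left_lt_right
  have h1 := d.right_le_one
  rw [coe_inv, right_comp, toFun, max_lt_iff, min_lt_iff, div_lt_iff₀ hc]
  constructor
  · rintro ⟨-, h | h⟩ <;> nlinarith
  · exact fun h => ⟨h0, Or.inr (by nlinarith)⟩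

/-- The inverse of a composite, also where the parameters are truncated to `[0,1]`. -/
theorem inv_comp (c d : LittleInterval) (t : unitInterval) :
    (c.comp d).inv t = d.inv (c.inv t) := by
  have hc := sub_pos.2 c.left_lt_right
  have hd := sub_pos.2 d.left_lt_right
  have h0 := d.left_nonneg
  have h1 := d.right_le_one
  have hne := hc.ne'
  have hne' := hd.ne'
  refine Subtype.ext ?_
  simp only [coe_inv]
  have h : ((t : ℝ) - (c.comp d).left) / ((c.comp d).right - (c.comp d).left) =
      (((t : ℝ) - c.left) / (c.right - c.left) - d.left) / (d.right - d.left) := by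
    rw [left_comp, right_comp, toFun, toFun,
      show c.left + (c.right - c.left) * d.right - (c.left + (c.right - c.left) * d.left) =
        (c.right - c.left) * (d.right - d.left) by ring]
    field_simp
    ring
  rw [h]
  generalize ((t : ℝ) - c.left) / (c.right - c.left) = s
  rcases le_total s 0 with hs | hs
  · rw [max_eq_left ((min_le_right 1 s).trans hs), max_eq_left, max_eq_left]
    · exact (min_le_right _ _).trans (div_nonpos_of_nonpos_of_nonneg (by linarith) hd.le)
    · exact (min_le_right _ _).trans (div_nonpos_of_nonpos_of_nonneg (by linarith) hd.le)
  · rcases le_total s 1 with hs' | hs'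
    · rw [min_eq_right hs', max_eq_right hs]
    · rw [min_eq_left hs', max_eq_right zero_le_one, min_eq_left, min_eq_left]
      · rw [le_div_iff₀ hd]; linarith
      · rw [le_div_iff₀ hd]; linarith

theorem inv_le_zero_iff (c : LittleInterval) (t : unitInterval) :
    c.inv t ≤ 0 ↔ (t : ℝ) ≤ c.left := by
  have h := inv_le_left_iff c LittleInterval.id t
  rwa [comp_id] at h

theorem inv_lt_one_iff (c : LittleInterval) (t : unitInterval) :
    c.inv t < 1 ↔ (t : ℝ) < c.right := by
  have h := inv_lt_right_iff c LittleInterval.id t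
  rwa [comp_id] at h

theorem inv_zero (c : LittleInterval) : c.inv 0 = 0 :=
  le_antisymm ((inv_le_zero_iff c 0).2 c.left_nonneg) unitInterval.nonneg'

theorem inv_one (c : LittleInterval) : c.inv 1 = 1 :=
  le_antisymm unitInterval.le_one'
    (not_lt.1 fun h => absurd ((inv_lt_one_iff c 1).1 h) (not_lt.2 c.right_le_one))

end LittleInterval

section asm

open DTree

variable {O O' : TopOperad.{u}} (η : O.Hom O') {α : Type v} {β : Type w}

/-! ### Cutting and assembling a tree -/

variable (O O') in
/-- A little interval together with a function on `WB(O)`. -/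
abbrev IntervalMap : Type u := LittleInterval × (∀ q, WB O q → O'.obj q)

open Classical in
/-- The result of `assemble`, as an element of a free algebra. (The value is only relevant if the
parameters of the tree increase.) -/
noncomputable def assembleFree (L : List (IntervalMap O O')) (T : DTree (BV O) α) : FreeAlg O' α :=
  if h : T.Mono then FreeAlg.mk (assemble η L ⟨T, h⟩) else treeEval η T

variable {η}

theorem assembleFree_of_not_mono (L : List (IntervalMap O O')) {T : DTree (BV O) α}
    (h : ¬T.Mono) : assembleFree η L T = treeEval η T := dif_neg h

theorem assembleFree_nil (T : DTree (BV O) α) : assembleFree η [] T = treeEval η T := by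
  by_cases hT : T.Mono
  · rw [assembleFree, dif_pos hT]; exact mk_etaMu η T
  · exact assembleFree_of_not_mono _ hT

/-- The recursive description of assembling: cut off the first gap and then the first interval. -/
theorem assembleFree_cons {c : LittleInterval} {f : ∀ q, WB O q → O'.obj q}
    {L : List (IntervalMap O O')} {T : DTree (BV O) α} (hT : T.Mono) :
    assembleFree η ((c, f) :: L) T =
      (treeEval η (T.cutAt fun t => (t : ℝ) ≤ c.left)).bind fun S =>
        (pieceEval η f ((S.cutAt fun t => (t : ℝ) < c.right).mapParam c.inv)).bind
          (assembleFree η L) := by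
  rw [assembleFree, dif_pos hT, assemble, FreeAlg.mk_labelledPoint_bind, mk_etaMu,
    ← cut_map_val T hT, treeEval, treeEval, freeEval_map, FreeAlg.bind_assoc]
  congr 1
  funext S
  rw [FreeAlg.pure_bind, FreeAlg.mk_labelledPoint_bind, mk_applyRescaled, ← cut_map_val _ S.2,
    mapParam_map, pieceEval_map, FreeAlg.bind_assoc]
  congr 1
  funext S'
  rw [FreeAlg.pure_bind, assembleFree, dif_pos S'.2]

theorem treeEval_bind_congr {T : DTree (BV O) α} {φ ψ : α → FreeAlg O' β}
    (h : T.ForallLabel fun a => φ a = ψ a) : (treeEval η T).bind φ = (treeEval η T).bind ψ :=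
  freeEval_bind_congr h

theorem pieceEval_bind_congr {f : ∀ q, WB O q → O'.obj q} {T : DTree (BV O) α}
    {φ ψ : α → FreeAlg O' β} (h : T.ForallLabel fun a => φ a = ψ a) :
    (pieceEval η f T).bind φ = (pieceEval η f T).bind ψ := by
  by_cases hT : T.Mono
  · rw [forallLabel_iff] at h
    simp only [pieceEval_of_mono f hT, FreeAlg.op_pure_bind, h]
  · simp only [pieceEval, dif_neg hT]
    exact freeEval_bind_congr h

theorem assembleFree_map (L : List (IntervalMap O O')) (T : DTree (BV O) α) (h : α → β) :
    assembleFree η L (T.map h) = (assembleFree η L T).bind fun a => FreeAlg.pure (h a) := by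
  induction L generalizing T with
  | nil => simp only [assembleFree_nil]; exact freeEval_map _ _
  | cons d L ih =>
    obtain ⟨c, f⟩ := d
    by_cases hT : T.Mono
    · rw [assembleFree_cons hT, assembleFree_cons ((mono_map_iff h).2 hT), cutAt_map, treeEval,
        treeEval, freeEval_map, FreeAlg.bind_assoc, FreeAlg.bind_assoc]
      congr 1
      funext S
      rw [FreeAlg.pure_bind, cutAt_map, mapParam_map, pieceEval_map, FreeAlg.bind_assoc,
        FreeAlg.bind_assoc]
      congr 1
      funext S'
      rw [FreeAlg.pure_bind, ih]
    · rw [assembleFree_of_not_mono _ hT,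
        assembleFree_of_not_mono _ (fun h' => hT ((mono_map_iff h).1 h'))]
      exact freeEval_map _ _

theorem labelSum_pieceEval (h : α → ℕ) (f : ∀ q, WB O q → O'.obj q) (T : DTree (BV O) α) :
    (pieceEval η f T).labelSum h = T.labelSum h := by
  by_cases hT : T.Mono
  · rw [pieceEval_of_mono f hT, FreeAlg.labelSum_op, labelSum_eq]
    simp only [FreeAlg.labelSum_pure]
  · rw [pieceEval, dif_neg hT]
    exact labelSum_freeEval h T

/-- Assembling does not change the labels of the inputs and their multiplicities. -/
theorem labelSum_assembleFree (h : α → ℕ) (L : List (IntervalMap O O')) (T : DTree (BV O) α) :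
    (assembleFree η L T).labelSum h = T.labelSum h := by
  induction L generalizing T with
  | nil => rw [assembleFree_nil]; exact labelSum_freeEval h T
  | cons d L ih =>
    obtain ⟨c, f⟩ := d
    by_cases hT : T.Mono
    · rw [assembleFree_cons hT, FreeAlg.labelSum_bind]
      simp only [FreeAlg.labelSum_bind, ih, labelSum_pieceEval, labelSum_mapParam, labelSum_cutAt]
      rw [treeEval, labelSum_freeEval, labelSum_cutAt]
    · rw [assembleFree_of_not_mono _ hT]
      exact labelSum_freeEval h T

theorem DTree.forallLabel_mono_of_bind {A : ℕ → Type u} {T : DTree A α} {S : α → DTree A β}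
    (h : (T.bind S).Mono) : T.ForallLabel fun a => (S a).Mono := by
  induction T with
  | leaf a => exact h
  | node x t c ih => exact fun i => ih i (h i).2

/-- A part of the tree at the root below all intervals can be split off. -/
theorem assembleFree_bind_of_le {L : List (IntervalMap O O')} {B : DTree (BV O) α}
    {S : α → DTree (BV O) β} (hm : (B.bind S).Mono)
    (hB : ∀ d ∈ L, B.ForallParam fun t => (t : ℝ) ≤ d.1.left) :
    assembleFree η L (B.bind S) = (treeEval η B).bind fun a => assembleFree η L (S a) := by
  cases L with
  | nil => simp only [assembleFree_nil]; exact freeEval_bind _ _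
  | cons d L =>
    obtain ⟨c, f⟩ := d
    rw [assembleFree_cons hm, cutAt_bind_of_forallParam (hB _ (List.mem_cons_self ..)), treeEval,
      freeEval_bind, FreeAlg.bind_assoc]
    exact treeEval_bind_congr ((forallLabel_mono_of_bind hm).imp fun a ha =>
      (assembleFree_cons ha).symm)

/-- A vertex with parameter `0` acts through the left operation. -/
theorem assembleFree_zero (L : List (IntervalMap O O')) {n : ℕ} (x : BV O n)
    (c : Fin n → DTree (BV O) α) (hT : (node x 0 c).Mono) :
    assembleFree η L (node x 0 c) =
      FreeAlg.op (η.toFun n (BV.μ x)) fun i => assembleFree η L (c i) := by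
  refine (assembleFree_bind_of_le (B := node x 0 leaf) (S := c) hT fun d _ =>
    ⟨d.1.left_nonneg, fun _ => trivial⟩).trans ?_
  rw [treeEval, freeEval_node]
  simp only [freeEval_leaf]
  exact FreeAlg.op_pure_bind _ (fun i => i) _

theorem DTree.cutAt_eq_leaf_of_le {A : ℕ → Type u} {r : ℝ} {T : DTree A α}
    (h : T.ForallParam fun t => r ≤ t) {p : unitInterval → Prop} (hp : ∀ t : unitInterval,
      r ≤ t → ¬p t) : T.cutAt p = leaf T := by
  cases T with
  | leaf a => rfl
  | node x t c => exact cutAt_neg (hp t h.1)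

theorem DTree.Mono.forallParam_one_le {A : ℕ → Type u} {T : DTree A α} (h : T.Mono)
    (h' : T.RootGE 1) : T.ForallParam fun t => (1 : ℝ) ≤ t :=
  (h.forallParam_ge h').imp fun _ ht => ht

/-- Trees with parameter `1` on top of a tree can be split off. -/
theorem assembleFree_bind_one {L : List (IntervalMap O O')} {T : DTree (BV O) α}
    {S : α → DTree (BV O) β} (hT : T.Mono)
    (hS : T.ForallLabel fun a => (S a).Mono ∧ (S a).RootGE 1) :
    assembleFree η L (T.bind S) = (assembleFree η L T).bind fun a => treeEval η (S a) := by
  induction L generalizing T with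
  | nil => simp only [assembleFree_nil]; exact freeEval_bind _ _
  | cons d L ih =>
    obtain ⟨c, f⟩ := d
    have hcut : ∀ {p : unitInterval → Prop}, ¬p 1 → ∀ {T' : DTree (BV O) α},
        (T'.ForallLabel fun a => (S a).Mono ∧ (S a).RootGE 1) →
        T'.ForallLabel fun a => (S a).cutAt p = leaf (S a) := fun hp _ h =>
      h.imp fun a ha => cutAt_eq_leaf_of_le (ha.1.forallParam_one_le ha.2) fun t ht h' => hp
        ((le_antisymm unitInterval.le_one' ht : t = 1) ▸ h')
    have hsub : ∀ {p : unitInterval → Prop} {T' : DTree (BV O) α},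
        (T'.Mono ∧ T'.ForallLabel fun a => (S a).Mono ∧ (S a).RootGE 1) →
        (T'.cutAt p).ForallLabel fun T'' =>
          T''.Mono ∧ T''.ForallLabel fun a => (S a).Mono ∧ (S a).RootGE 1 := fun h =>
      forallLabel_cutAt_of (C := fun T'' =>
        T''.Mono ∧ T''.ForallLabel fun a => (S a).Mono ∧ (S a).RootGE 1)
        (fun x t c _ h i => ⟨(h.1 i).2, h.2 i⟩) h
    have h1 : ¬((1 : unitInterval) : ℝ) ≤ c.left := not_le.2 c.left_lt_one
    have h2 : ¬((1 : unitInterval) : ℝ) < c.right := not_lt.2 c.right_le_one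
    rw [assembleFree_cons hT, assembleFree_cons (hT.bind_of_rootGE_one hS),
      cutAt_bind_of_cutAt_eq_leaf (hcut h1 hS), treeEval, treeEval, freeEval_map,
      FreeAlg.bind_assoc, FreeAlg.bind_assoc]
    refine treeEval_bind_congr ((hsub ⟨hT, hS⟩).imp fun T' hT' => ?_)
    rw [FreeAlg.pure_bind, cutAt_bind_of_cutAt_eq_leaf (hcut h2 hT'.2), mapParam_map,
      pieceEval_map, FreeAlg.bind_assoc, FreeAlg.bind_assoc]
    refine pieceEval_bind_congr (forallLabel_mapParam.2 ((hsub hT').imp fun T'' hT'' => ?_))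
    rw [FreeAlg.pure_bind, ih hT''.1 hT''.2]

/-- A list of intervals can be split at a point between the intervals. -/
theorem assembleFree_append {L₁ L₂ : List (IntervalMap O O')} {r : ℝ}
    (h₁ : ∀ d ∈ L₁, d.1.right ≤ r) (h₂ : ∀ d ∈ L₂, r ≤ d.1.left) {T : DTree (BV O) α}
    (hT : T.Mono) : assembleFree η (L₁ ++ L₂) T =
      (assembleFree η L₁ (T.cutAt fun t => (t : ℝ) < r)).bind (assembleFree η L₂) := by
  induction L₁ generalizing T with
  | nil =>
    rw [assembleFree_nil]
    conv_lhs => rw [← cutAt_bind_id (p := fun t => (t : ℝ) < r) T]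
    refine assembleFree_bind_of_le (by rwa [cutAt_bind_id]) fun d hd => ?_
    exact (forallParam_cutAt T).imp fun t ht => (le_of_lt ht).trans (h₂ d hd)
  | cons d L ih =>
    obtain ⟨c, f⟩ := d
    have hr : c.right ≤ r := h₁ _ (List.mem_cons_self ..)
    have ih' := fun {T : DTree (BV O) α} => ih (T := T) fun d hd => h₁ d (List.mem_cons_of_mem _ hd)
    rw [List.cons_append, assembleFree_cons hT, assembleFree_cons hT.cutAt,
      cutAt_cutAt (fun t ht => lt_of_le_of_lt ht (c.left_lt_right.trans_le hr)), treeEval, treeEval,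
      freeEval_map, FreeAlg.bind_assoc, FreeAlg.bind_assoc]
    refine treeEval_bind_congr (hT.forallLabel_cutAt.imp fun S hS => ?_)
    rw [FreeAlg.pure_bind, cutAt_cutAt (fun t ht => lt_of_lt_of_le ht hr), mapParam_map,
      pieceEval_map, FreeAlg.bind_assoc, FreeAlg.bind_assoc]
    refine pieceEval_bind_congr (forallLabel_mapParam.2 (hS.forallLabel_cutAt.imp fun S' hS' => ?_))
    rw [FreeAlg.pure_bind, ih' hS']

/-- Intervals inside `c` correspond to intervals for the rescaled tree. -/
theorem assembleFree_map_comp (c : LittleInterval) (L : List (IntervalMap O O'))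
    {T : DTree (BV O) α} (hT : T.Mono) :
    assembleFree η (L.map fun d => (c.comp d.1, d.2)) T =
      assembleFree η L (T.mapParam c.inv) := by
  induction L generalizing T with
  | nil => simp only [List.map_nil, assembleFree_nil]; exact (freeEval_mapParam _ _).symm
  | cons d L ih =>
    obtain ⟨d, f⟩ := d
    rw [List.map_cons, assembleFree_cons hT, assembleFree_cons (hT.mapParam c.inv_mono),
      cutAt_mapParam, treeEval, treeEval, freeEval_map, freeEval_mapParam, FreeAlg.bind_assoc,
      cutAt_congr (fun t => c.inv_le_left_iff d t)]
    refine treeEval_bind_congr (hT.forallLabel_cutAt.imp fun S hS => ?_)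
    rw [FreeAlg.pure_bind, cutAt_mapParam, mapParam_map, pieceEval_map, FreeAlg.bind_assoc,
      cutAt_congr (fun t => c.inv_lt_right_iff d t), mapParam_mapParam,
      show (fun t => d.inv (c.inv t)) = (c.comp d).inv from funext fun t => (c.inv_comp d t).symm]
    refine pieceEval_bind_congr (forallLabel_mapParam.2 (hS.forallLabel_cutAt.imp fun S' hS' => ?_))
    rw [FreeAlg.pure_bind, ih hS']

variable {k : ℕ∞}

/-- If a tree is decomposed at the right end of the first interval, then it does not matter to which
part the vertices at the end points of the interval belong. -/
theorem assembleFree_cons_bind {c : LittleInterval} {f : ∀ q, WB O q → O'.obj q}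
    (hf : IsBimodMapOn η k f) {L : List (IntervalMap O O')} (hL : ∀ d ∈ L, c.right ≤ d.1.left)
    {B : DTree (BV O) α} {S : α → DTree (BV O) β} (hm : (B.bind S).Mono) (hBm : B.Mono)
    (hB : B.ForallParam fun t => (t : ℝ) ≤ c.right)
    (hS : B.ForallLabel fun a => (S a).ForallParam fun t => c.right ≤ (t : ℝ))
    (hBF : (B.mapParam c.inv).FilteredW (bvWeight O) k) (hBk : (B.numLeaves : ℕ∞) ≤ k) :
    assembleFree η ((c, f) :: L) (B.bind S) =
      (pieceEval η f (B.mapParam c.inv)).bind fun a => assembleFree η L (S a) := by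
  have hnum : ((B.mapParam c.inv).numLeaves : ℕ∞) ≤ k := by
    obtain ⟨hN, -⟩ := exists_cast_mapParam (γ := ℕ) B c.inv
    rwa [hN]
  -- The property of subtrees of `B` which is needed at the two cuts.
  let C : DTree (BV O) α → Prop := fun T => (T.bind S).Mono ∧
    (T.ForallParam fun t => (t : ℝ) ≤ c.right) ∧
    T.ForallLabel fun a => (S a).ForallParam fun t => c.right ≤ (t : ℝ)
  have hsub : ∀ {p : unitInterval → Prop} {T : DTree (BV O) α}, C T → (T.cutAt p).ForallLabel C :=
    fun h => forallLabel_cutAt_of (C := C)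
      (fun x t c _ h i => ⟨(h.1 i).2, h.2.1.2 i, h.2.2 i⟩) h
  have hcut : ∀ {p : unitInterval → Prop}, (∀ t : unitInterval, c.right ≤ (t : ℝ) → ¬p t) →
      ∀ {T : DTree (BV O) α}, C T → T.ForallLabel fun a => (S a).cutAt p = leaf (S a) :=
    fun hp _ h => h.2.2.imp fun a ha => cutAt_eq_leaf_of_le ha hp
  have hC : C B := ⟨hm, hB, hS⟩
  -- In the value of `f`, the vertices of `B` rescaled to `0` and `1` are split off; the cuts are
  -- then those of the definition of assembling.
  rw [hf.pieceEval_eq_bind (hBm.mapParam c.inv_mono) hBF hnum, assembleFree_cons hm,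
    cutAt_bind_of_cutAt_eq_leaf (hcut (fun t ht => not_le.2 (c.left_lt_right.trans_le ht)) hC),
    cutAt_mapParam, cutAt_congr (fun t => c.inv_le_zero_iff t)]
  simp only [treeEval, freeEval_map, freeEval_mapParam, FreeAlg.bind_assoc, FreeAlg.pure_bind]
  refine treeEval_bind_congr ((hsub hC).imp fun T hT => ?_)
  rw [cutAt_bind_of_cutAt_eq_leaf (hcut (fun t ht => not_lt.2 ht) hT), cutAt_mapParam,
    cutAt_congr (fun t => c.inv_lt_one_iff t), mapParam_map, pieceEval_map, pieceEval_map,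
    FreeAlg.bind_assoc, FreeAlg.bind_assoc]
  refine pieceEval_bind_congr (forallLabel_mapParam.2 ((hsub hT).imp fun T' hT' => ?_))
  simp only [FreeAlg.pure_bind, freeEval_mapParam]
  exact assembleFree_bind_of_le hT'.1 fun d hd => hT'.2.1.imp fun t ht => ht.trans (hL d hd)

end asm

/-! ### Independence of the representative -/

section invariance

open DTree

variable {O O' : TopOperad.{u}} {η : O.Hom O'} {α : Type v} {β : Type w}

/-- The relation generating equivalence of the trees which are cut off by `cutAt p`. -/
def CutStep (p : unitInterval → Prop) (S S' : DTree (BV O) α) : Prop :=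
  S.Mono ∧ S'.Mono ∧ (∃ s, ¬p s ∧ S.RootGE s ∧ S'.RootGE s) ∧ Locally (WBBase O) S S'

theorem DTree.Absorb.cutAt_map {A : ℕ → Type u} {a : A 1} {t : unitInterval} {T : DTree A α}
    {m : ℕ} {y : A m} {d : Fin m → DTree A α} (h : Absorb a t T y d) {p : unitInterval → Prop}
    (hp : p t) (g : DTree A α → β) :
    Absorb a t ((T.cutAt p).map g) y fun k => ((d k).cutAt p).map g := by
  cases h with
  | merge y d => rw [cutAt_pos hp]; exact .merge y _
  | keep T => exact .keep _

theorem DTree.Absorb.mapParam {A : ℕ → Type u} {a : A 1} {t : unitInterval} {T : DTree A α}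
    {m : ℕ} {y : A m} {d : Fin m → DTree A α} (h : Absorb a t T y d)
    (r : unitInterval → unitInterval) :
    Absorb a (r t) (T.mapParam r) y fun k => (d k).mapParam r := by
  cases h with
  | merge y d => exact .merge y _
  | keep T => exact .keep _

/-- A relation between trees gives a relation between the parts at the root, or between two of the
trees which are cut off. -/
theorem cutAt_of_locally {p : unitInterval → Prop} (hp : ∀ s t, s ≤ t → p t → p s)
    {T T' : DTree (BV O) α} (hT : T.Mono) (hT' : T'.Mono) (h : Locally (WBBase O) T T') :
    (T.cutAt p).map (Quot.mk (CutStep p)) = (T'.cutAt p).map (Quot.mk (CutStep p)) ∨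
      Locally (WBBase O) ((T.cutAt p).map (Quot.mk (CutStep p)))
        ((T'.cutAt p).map (Quot.mk (CutStep p))) := by
  have key : ∀ {t : unitInterval} {S S' : DTree (BV O) α}, ¬p t → S.Mono → S'.Mono → S.RootGE t →
      S'.RootGE t → Locally (WBBase O) S S' →
      (S.cutAt p).map (Quot.mk (CutStep p)) = (S'.cutAt p).map (Quot.mk (CutStep p)) := by
    intro t S S' ht h1 h2 h3 h4 h
    have hge : ∀ s, t ≤ s → ¬p s := fun s hs h => ht (hp _ _ hs h)
    rw [h3.cutAt_eq_leaf hge, h4.cutAt_eq_leaf hge]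
    exact congrArg leaf (Quot.sound ⟨h1, h2, ⟨t, ht, h3, h4⟩, h⟩)
  induction h with
  | base h =>
    cases h with
    | unit t T =>
      by_cases ht : p t
      · rw [cutAt_pos ht]
        exact .inr (.base (.unit t _))
      · exact .inl (key (t := t) ht hT hT' le_rfl (hT 0).1 (.base (.unit t _)))
    | perm e x t c =>
      by_cases ht : p t
      · rw [cutAt_pos ht, cutAt_pos ht]
        exact .inr (.base (.perm e x t fun i => ((c i).cutAt p).map _))
      · exact .inl (key (t := t) ht hT hT' le_rfl le_rfl (.base (.perm e x t c)))
    | contract x t c y d h =>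
      by_cases ht : p t
      · rw [cutAt_pos ht, cutAt_pos ht]
        refine .inr (.base (.contract x t _ y _ fun i => ?_))
        exact (h i).cutAt_map ht _
      · exact .inl (key (t := t) ht hT hT' le_rfl le_rfl (.base (.contract x t c y d h)))
    | proj x t ht' c =>
      by_cases ht : p t
      · rw [cutAt_pos ht, cutAt_pos ht]
        exact .inr (.base (.proj x t ht' _))
      · exact .inl (key (t := t) ht hT hT' le_rfl le_rfl (.base (.proj x t ht' c)))
  | node x t c c' i hc h ih =>
    by_cases ht : p t
    · rw [cutAt_pos ht, cutAt_pos ht]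
      rcases ih (hT i).2 (hT' i).2 with h' | h'
      · refine .inl ?_
        simp only [map_node]
        congr 1
        funext j
        by_cases hj : j = i
        · subst hj; exact h'
        · rw [hc j hj]
      · exact .inr (.node x t _ _ i
          (fun j hj => congrArg (fun T => (T.cutAt p).map (Quot.mk (CutStep p))) (hc j hj)) h')
    · exact .inl (key (t := t) ht hT hT' le_rfl le_rfl (.node x t c c' i hc h))

/-- The relations are compatible with a change of parameters which fixes `0` and `1`. -/
theorem locally_mapParam {r : unitInterval → unitInterval} (h0 : r 0 = 0) (h1 : r 1 = 1)
    {T T' : DTree (BV O) α} (h : Locally (WBBase O) T T') :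
    Locally (WBBase O) (T.mapParam r) (T'.mapParam r) := by
  induction h with
  | base h =>
    refine .base ?_
    cases h with
    | unit t T => exact .unit _ _
    | perm e x t c => exact .perm e x (r t) fun i => (c i).mapParam r
    | contract x t c y d h =>
      exact .contract x (r t) _ y _ fun i => (h i).mapParam r
    | proj x t ht c =>
      refine .proj x _ ?_ _
      rcases ht with rfl | rfl
      · exact .inl h0
      · exact .inr h1
  | node x t c c' i hc _ ih => exact .node x (r t) _ _ i (fun j hj => by rw [hc j hj]) ih

theorem exists_cutStep_lift {X : Type*} {p : unitInterval → Prop} (φ : DTree (BV O) α → X)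
    (h : ∀ S S', CutStep p S S' → φ S = φ S') : ∃ φ' : Quot (CutStep p) → X,
    ∀ S, φ' (Quot.mk _ S) = φ S := ⟨Quot.lift φ h, fun _ => rfl⟩

variable {k : ℕ∞}

/-- The result of assembling does not depend on the representative. -/
theorem assembleFree_eq_of_locally {L : List (IntervalMap O O')}
    (hL : ∀ d ∈ L, IsBimodMapOn η k d.2) {T T' : DTree (BV O) α} (hT : T.Mono) (hT' : T'.Mono)
    (hF : T.FilteredW (bvWeight O) k) (h : Locally (WBBase O) T T') :
    assembleFree η L T = assembleFree η L T' := by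
  classical
  induction L generalizing T T' with
  | nil => rw [assembleFree_nil, assembleFree_nil]; exact treeEval_eq_of_locally η h
  | cons d L ih =>
    obtain ⟨c, f⟩ := d
    have hf : IsBimodMapOn η k f := hL _ (List.mem_cons_self ..)
    have ih' := fun {T T' : DTree (BV O) α} => ih (T := T) (T' := T')
      fun d hd => hL d (List.mem_cons_of_mem _ hd)
    have hW : ∀ (n : ℕ) (x : BV O n), 1 ≤ bvWeight O n x + n := fun _ x => x.one_le_univalents_add
    let p₁ : unitInterval → Prop := fun t => (t : ℝ) ≤ c.left
    let p₂ : unitInterval → Prop := fun t => (t : ℝ) < c.right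
    have hp₁ : ∀ s t, s ≤ t → p₁ t → p₁ s := fun s t hst ht =>
      (Subtype.coe_le_coe.2 hst).trans ht
    have hp₂ : ∀ s t, s ≤ t → p₂ t → p₂ s := fun s t hst ht =>
      (Subtype.coe_le_coe.2 hst).trans_lt ht
    have h10 : p₁ 0 := c.left_nonneg
    have h11 : ¬p₁ 1 := not_le.2 c.left_lt_one
    have h21 : ¬p₂ 1 := not_lt.2 c.right_le_one
    have hr : ∀ t, p₂ t → c.inv t ≠ 1 := fun t ht => ((c.inv_lt_one_iff t).2 ht).ne
    -- The functions `φ` and `ψ`, applied to the trees which are cut off, are replaced by `treeEval`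
    -- where the filtration condition fails. They are then invariant under all relations, and factor
    -- through the quotient by `CutStep`, where `cutAt_of_locally` applies.
    let ψ : DTree (BV O) α → FreeAlg O' α := fun S =>
      if (S.inputsW (bvWeight O) : ℕ∞) ≤ k then
        (pieceEval η f ((S.cutAt p₂).mapParam c.inv)).bind (assembleFree η L)
      else treeEval η S
    let φ : DTree (BV O) α → FreeAlg O' α := fun S =>
      if S.FilteredW (bvWeight O) k then assembleFree η L S else treeEval η S
    obtain ⟨φ', hφ'⟩ := exists_cutStep_lift (p := p₂) φ (by
      rintro S S' ⟨h1, h2, -, h3⟩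
      have := filteredW_iff_of_locally (k := k) h1 h2 h3
      simp only [φ, ← this]
      split_ifs with hS
      · exact ih' h1 h2 hS h3
      · exact treeEval_eq_of_locally η h3)
    have hφ : ∀ S : DTree (BV O) α, (S.inputsW (bvWeight O) : ℕ∞) ≤ k → S.Mono →
        (pieceEval η f ((S.cutAt p₂).mapParam c.inv)).bind (assembleFree η L) =
        (pieceEval η f (((S.cutAt p₂).map (Quot.mk (CutStep p₂))).mapParam c.inv)).bind φ' := by
      intro S hS hSm
      rw [mapParam_map, pieceEval_map, FreeAlg.bind_assoc]
      refine pieceEval_bind_congr (forallLabel_mapParam.2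
        ((forallLabel_cutAt_inputsW_le h21 hS).imp fun S' hS' => ?_))
      rw [FreeAlg.pure_bind, hφ']
      exact (if_pos (filteredW_of_inputsW_le hS')).symm
    obtain ⟨ψ', hψ'⟩ := exists_cutStep_lift (p := p₁) ψ (by
      rintro S S' ⟨h1, h2, ⟨s, hs, h3, h4⟩, h5⟩
      have hs0 : s ≠ 0 := by rintro rfl; exact hs h10
      have hi := inputsW_eq_of_locally h1 (h1.forallParam_ne_zero hs0 h3) h5
      simp only [ψ, ← hi]
      split_ifs with hS
      · rw [hφ S hS h1, hφ S' (hi ▸ hS) h2]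
        -- The relation takes place either above the piece of the first interval, or in this piece.
        rcases cutAt_of_locally hp₂ h1 h2 h5 with h6 | h6
        · rw [h6]
        · refine congrArg (fun X => FreeAlg.bind X φ') (hf.pieceEval_eq_of_locally
            (((mono_map_iff _).2 h1.cutAt).mapParam c.inv_mono)
            (((mono_map_iff _).2 h2.cutAt).mapParam c.inv_mono) ?_ ?_
            (locally_mapParam c.inv_zero c.inv_one h6))
          · rw [mapParam_map, filteredW_map]
            exact filteredW_of_inputsW_le
              (le_trans (Nat.cast_le.2 (inputsW_mapParam_cutAt_le hW h21 hr S)) hS)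
          · rw [mapParam_map, numLeaves_map, (exists_cast_mapParam (γ := ℕ) _ c.inv).1]
            exact le_trans (Nat.cast_le.2 (numLeaves_cutAt_le hW h21 S)) hS
      · exact treeEval_eq_of_locally η h5)
    have hψ : ∀ S : DTree (BV O) α, S.FilteredW (bvWeight O) k → S.Mono →
        assembleFree η ((c, f) :: L) S =
        (treeEval η ((S.cutAt p₁).map (Quot.mk (CutStep p₁)))).bind ψ' := by
      intro S hS hSm
      rw [assembleFree_cons hSm, treeEval, treeEval, freeEval_map, FreeAlg.bind_assoc]
      refine treeEval_bind_congr ((hS.forallLabel_cutAt h10 h11).imp fun S' hS' => ?_)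
      rw [FreeAlg.pure_bind, hψ']
      exact (if_pos hS').symm
    rw [hψ T hF hT, hψ T' ((filteredW_iff_of_locally hT hT' h).1 hF) hT']
    -- The relation takes place either above the first gap, or in this gap.
    rcases cutAt_of_locally hp₁ hT hT' h with h6 | h6
    · rw [h6]
    · rw [treeEval_eq_of_locally η h6]

end invariance

/-! ### The maps obtained by assembling -/

section assembled

open DTree

variable {O O' : TopOperad.{u}} {η : O.Hom O'} {α : Type v} {k : ℕ∞}

theorem pieceEval_congr {f g : ∀ q, WB O q → O'.obj q}
    (h : ∀ (q : ℕ) (z : WB O q), (q : ℕ∞) ≤ k → z.IsFiltered k → f q z = g q z)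
    {T : DTree (BV O) α} (hF : T.FilteredW (bvWeight O) k) (hk : (T.numLeaves : ℕ∞) ≤ k) :
    pieceEval η f T = pieceEval η g T := by
  by_cases hT : T.Mono
  · rw [pieceEval_of_mono f hT, pieceEval_of_mono g hT, h _ _ hk]
    exact filteredW_planar.2 hF
  · rw [pieceEval, pieceEval, dif_neg hT, dif_neg hT]

/-- The pieces of a filtered tree, rescaled to `[0,1]`. -/
theorem forallLabel_piece (c : LittleInterval) {T : DTree (BV O) α}
    (hF : T.FilteredW (bvWeight O) k) :
    (T.cutAt fun t => (t : ℝ) ≤ c.left).ForallLabel fun S =>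
      ((S.cutAt fun t => (t : ℝ) < c.right).mapParam c.inv).FilteredW (bvWeight O) k ∧
      (((S.cutAt fun t => (t : ℝ) < c.right).mapParam c.inv).numLeaves : ℕ∞) ≤ k ∧
      ((S.cutAt fun t => (t : ℝ) < c.right).mapParam c.inv).ForallLabel fun S' =>
        S'.FilteredW (bvWeight O) k := by
  have hW : ∀ (n : ℕ) (x : BV O n), 1 ≤ bvWeight O n x + n := fun _ x => x.one_le_univalents_add
  have h1 : ¬((1 : unitInterval) : ℝ) < c.right := not_lt.2 c.right_le_one
  refine (hF.forallLabel_cutAt (p := fun t => (t : ℝ) ≤ c.left) c.left_nonneg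
    (not_le.2 c.left_lt_one)).imp fun S hS => ⟨?_, ?_, ?_⟩
  · exact filteredW_of_inputsW_le (le_trans (Nat.cast_le.2 (inputsW_mapParam_cutAt_le hW h1
      (fun t ht => ((c.inv_lt_one_iff t).2 ht).ne) S)) hS)
  · rw [(exists_cast_mapParam (γ := ℕ) _ c.inv).1]
    exact le_trans (Nat.cast_le.2 (numLeaves_cutAt_le hW h1 S)) hS
  · exact forallLabel_mapParam.2 ((forallLabel_cutAt_inputsW_le h1 hS).imp
      fun S' hS' => filteredW_of_inputsW_le hS')

/-- Only the values on points of the filtration term of small arity matter. -/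
theorem assembleFree_congr {L L' : List (IntervalMap O O')}
    (h : List.Forall₂ (fun d d' : IntervalMap O O' => d.1 = d'.1 ∧
      ∀ (q : ℕ) (z : WB O q), (q : ℕ∞) ≤ k → z.IsFiltered k → d.2 q z = d'.2 q z) L L')
    {T : DTree (BV O) α} (hF : T.FilteredW (bvWeight O) k) :
    assembleFree η L T = assembleFree η L' T := by
  by_cases hT : T.Mono
  · induction h generalizing T with
    | nil => rfl
    | @cons d d' L L' hd _ ih =>
      obtain ⟨c, f⟩ := d
      obtain ⟨c', f'⟩ := d'
      obtain ⟨rfl, hff⟩ := hd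
      rw [assembleFree_cons hT, assembleFree_cons hT]
      refine treeEval_bind_congr (((forallLabel_piece c hF).and hT.forallLabel_cutAt).imp ?_)
      rintro S ⟨⟨h1, h2, h3⟩, h4⟩
      rw [pieceEval_congr hff h1 h2]
      exact pieceEval_bind_congr ((h3.and (forallLabel_mapParam.2 h4.forallLabel_cutAt)).imp
        fun S' hS' => ih hS'.1 hS'.2)
  · rw [assembleFree_of_not_mono _ hT, assembleFree_of_not_mono _ hT]

/-- Every input of a labelled tree is an input of the assembled element exactly once, so this
element is an operation. -/
theorem exists_assembleFree_eq (η : O.Hom O') (L : List (IntervalMap O O')) {n : ℕ}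
    {T : DTree (BV O) (Fin n)} (hT : T.IsLabelled) :
    ∃ y : O'.obj n, assembleFree η L T = FreeAlg.op y FreeAlg.pure := by
  refine FreeAlg.exists_eq_op_pure _ fun a => ?_
  rw [labelSum_assembleFree, ← mult_eq_labelSum]
  exact (isLabelled_iff T).1 hT a

/-- The function on `WB(O)` given by assembling. -/
noncomputable def assembled (η : O.Hom O') (L : List (IntervalMap O O')) (q : ℕ) (z : WB O q) :
    O'.obj q :=
  (exists_assembleFree_eq η L (Quot.out z).2.1).choose

/-- The value on any representative. -/
theorem assembleFree_eq_assembled {L : List (IntervalMap O O')}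
    (hL : ∀ d ∈ L, IsBimodMapOn η k d.2) {n : ℕ} {T : DTree (BV O) (Fin n)}
    (hT : T.IsLabelled ∧ T.Mono) (hF : T.FilteredW (bvWeight O) k) :
    assembleFree η L T = FreeAlg.op (assembled η L n (WB.mk ⟨T, hT⟩)) FreeAlg.pure := by
  classical
  rw [assembled, ← (exists_assembleFree_eq η L (Quot.out (WB.mk ⟨T, hT⟩)).2.1).choose_spec]
  -- Outside the filtered trees, `treeEval` is a value which is invariant under the relations.
  have h := congrArg (Quot.lift (fun X : PreWB O n =>
    if X.1.FilteredW (bvWeight O) k then assembleFree η L X.1 else treeEval η X.1) (by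
      intro X Y h
      have := filteredW_iff_of_locally (k := k) X.2.2 Y.2.2 h
      simp only [← this]
      split_ifs with hX
      · exact assembleFree_eq_of_locally hL X.2.2 Y.2.2 hX h
      · exact treeEval_eq_of_locally η h)) (Quot.out_eq (WB.mk ⟨T, hT⟩)).symm
  have hF' : (Quot.out (WB.mk ⟨T, hT⟩)).1.FilteredW (bvWeight O) k := by
    have := WB.isFiltered_mk (k := k) (Quot.out (WB.mk ⟨T, hT⟩))
    rw [← this]
    exact (congrArg (WB.IsFiltered k) (Quot.out_eq (WB.mk ⟨T, hT⟩))).mpr hF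
  exact (if_pos hF).symm.trans (h.trans (if_pos hF'))

/-- Assembling is the evaluation of a function on `WB(O)`, also for arbitrary labels of the leaves.
-/
theorem assembleFree_eq_pieceEval {L : List (IntervalMap O O')}
    (hL : ∀ d ∈ L, IsBimodMapOn η k d.2) {T : DTree (BV O) α} (hT : T.Mono)
    (hF : T.FilteredW (bvWeight O) k) :
    assembleFree η L T = pieceEval η (assembled η L) T := by
  have h := assembleFree_eq_assembled hL (T := T.planar) ⟨T.isLabelled_planar, hT.relabel _⟩
    (filteredW_planar.2 hF)
  conv_lhs => rw [← planar_map_label T]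
  rw [assembleFree_map, h, pieceEval_of_mono _ hT]
  exact FreeAlg.op_pure_bind _ (fun i => i) _

/-- The map given by assembling is a map of bimodules: the left operation adds vertices to the first
gap, the right one adds vertices to the last gap. -/
theorem isBimodMapOn_assembled {L : List (IntervalMap O O')}
    (hL : ∀ d ∈ L, IsBimodMapOn η k d.2) : IsBimodMapOn η k (assembled η L) where
  act {m n} e z _ hz := by
    obtain ⟨⟨T, hT⟩, rfl⟩ := WB.mk_surjective z
    apply FreeAlg.op_pure_injective
    refine (assembleFree_eq_assembled hL (PreWB.act e ⟨T, hT⟩).2 (filteredW_map.2 hz)).symm.trans ?_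
    refine (assembleFree_map L T e.symm).trans ?_
    rw [assembleFree_eq_assembled hL hT hz, ← FreeAlg.op_act e]
    refine (FreeAlg.op_pure_bind _ (fun i => e i) _).trans ?_
    simp only [Equiv.symm_apply_apply]
  right {n m} z a _ hz _ := by
    obtain ⟨⟨T, hT⟩, rfl⟩ := WB.mk_surjective z
    apply FreeAlg.op_pure_injective
    have h1 : ∀ i, ((corolla (BV.ι (a i)) 1).map fun k => finSigmaFinEquiv
        (⟨i, k⟩ : Σ i, Fin (m i))).Mono ∧ ((corolla (BV.ι (a i)) 1).map fun k => finSigmaFinEquiv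
        (⟨i, k⟩ : Σ i, Fin (m i))).RootGE 1 := fun i => ⟨(mono_corolla _ _).map _, le_rfl⟩
    have hF : (PreWB.right ⟨T, hT⟩ a).1.FilteredW (bvWeight O) k :=
      FilteredW.bind hz (.of_forall (fun i => (h1 i).2) _)
    refine (assembleFree_eq_assembled hL (PreWB.right ⟨T, hT⟩ a).2 hF).symm.trans ?_
    refine (assembleFree_bind_one hT.2 (.of_forall h1 _)).trans ?_
    rw [assembleFree_eq_assembled hL hT hz, FreeAlg.op_comp]
    refine (FreeAlg.op_pure_bind _ (fun i => i) _).trans ?_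
    congr 1
    funext i
    refine (freeEval_node _ _ _).trans ?_
    simp only [BV.μ_ι]
    rfl
  left {n m} a y hy _ := by
    choose Y hY using fun i => WB.mk_surjective (y i)
    obtain rfl : (fun i => WB.mk (Y i)) = y := funext hY
    apply FreeAlg.op_pure_injective
    have hF : (PreWB.left a Y).1.FilteredW (bvWeight O) k :=
      (filteredW_zero _ _).2 fun i => filteredW_map.2 (hy i)
    rw [WB.left_mk]
    refine (assembleFree_eq_assembled hL (PreWB.left a Y).2 hF).symm.trans ?_
    refine (assembleFree_zero L _ _ (PreWB.left a Y).2.2).trans ?_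
    rw [FreeAlg.op_comp, BV.μ_ι]
    congr 1
    funext i
    refine (assembleFree_map L (Y i).1 _).trans ?_
    rw [assembleFree_eq_assembled hL (Y i).2 (hy i)]
    exact FreeAlg.op_pure_bind _ (fun i => i) _

theorem assembled_congr {L L' : List (IntervalMap O O')} (hL : ∀ d ∈ L, IsBimodMapOn η k d.2)
    (hL' : ∀ d ∈ L', IsBimodMapOn η k d.2)
    (h : ∀ (q : ℕ) (T : DTree (BV O) (Fin q)), T.Mono → T.FilteredW (bvWeight O) k →
      assembleFree η L T = assembleFree η L' T) {q : ℕ} {z : WB O q} (hz : z.IsFiltered k) :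
    assembled η L q z = assembled η L' q z := by
  obtain ⟨⟨T, hT⟩, rfl⟩ := WB.mk_surjective z
  apply FreeAlg.op_pure_injective
  rw [← assembleFree_eq_assembled hL hT hz, ← assembleFree_eq_assembled hL' hT hz]
  exact h q T hT.2 hz

/-- Assembling for the identity interval. -/
theorem assembleFree_id {f : ∀ q, WB O q → O'.obj q} (hf : IsBimodMapOn η k f)
    {T : DTree (BV O) α} (hT : T.Mono) (hF : T.FilteredW (bvWeight O) k)
    (hk : (T.numLeaves : ℕ∞) ≤ k) :
    assembleFree η [(LittleInterval.id, f)] T = pieceEval η f T := by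
  have hid : LittleInterval.id.inv = fun t => t := by
    funext t
    rw [LittleInterval.inv]
    simp [LittleInterval.id, LittleInterval.left, LittleInterval.right]
  rw [assembleFree_cons hT, hf.pieceEval_eq_bind hT hF hk,
    cutAt_congr (q := (· ≤ 0)) fun t => Iff.rfl]
  congr 1
  funext S
  rw [hid, mapParam_id, cutAt_congr (q := (· < 1)) fun t => Iff.rfl]
  congr 1
  funext S'
  exact assembleFree_nil S'

/-- Assembling is compatible with the composition of configurations of intervals. -/
theorem assembleFree_flatMap {K : List (LittleInterval × List (IntervalMap O O'))}
    (hK : ∀ e ∈ K, ∀ d ∈ e.2, IsBimodMapOn η k d.2)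
    (hs : K.Pairwise fun e e' => e.1.right ≤ e'.1.left) {T : DTree (BV O) α} (hT : T.Mono)
    (hF : T.FilteredW (bvWeight O) k) :
    assembleFree η (K.flatMap fun e => e.2.map fun d => (e.1.comp d.1, d.2)) T =
      assembleFree η (K.map fun e => (e.1, assembled η e.2)) T := by
  induction K generalizing T with
  | nil => rfl
  | cons e K ih =>
    obtain ⟨c, D⟩ := e
    have hD := hK _ (List.mem_cons_self ..)
    have ih' := fun {T : DTree (BV O) α} => ih (T := T)
      (fun e he => hK e (List.mem_cons_of_mem _ he)) hs.of_cons
    rw [List.flatMap_cons, List.map_cons, assembleFree_cons hT,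
      assembleFree_append (r := c.right) ?_ ?_ hT, assembleFree_map_comp c D hT.cutAt]
    -- Split the list of intervals at the right end of `c`. The intervals inside `c` are assembled
    -- for the rescaled part of the tree, where the vertices in the first gap have parameter `0`.
    · have h1 : T.cutAt (fun t => (t : ℝ) < c.right) =
          (T.cutAt fun t => (t : ℝ) ≤ c.left).bind fun S =>
            S.cutAt fun t => (t : ℝ) < c.right := by
        rw [← cutAt_bind_id (p := fun t => (t : ℝ) ≤ c.left) (T.cutAt _),
          cutAt_cutAt (fun t ht => lt_of_le_of_lt ht c.left_lt_right), map_bind]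
      have hm : (((T.cutAt fun t => (t : ℝ) ≤ c.left).mapParam c.inv).bind fun S =>
          (S.cutAt fun t => (t : ℝ) < c.right).mapParam c.inv).Mono := by
        rw [← mapParam_bind, ← h1]
        exact hT.cutAt.mapParam c.inv_mono
      rw [h1, mapParam_bind, assembleFree_bind_of_le hm, treeEval, freeEval_mapParam,
        FreeAlg.bind_assoc]
      · refine treeEval_bind_congr (((forallLabel_piece c hF).and hT.forallLabel_cutAt).imp ?_)
        rintro S ⟨⟨h2, -, h3⟩, h4⟩
        rw [assembleFree_eq_pieceEval hD (h4.cutAt.mapParam c.inv_mono) h2]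
        exact pieceEval_bind_congr ((h3.and (forallLabel_mapParam.2 h4.forallLabel_cutAt)).imp
          fun S' hS' => ih' hS'.2 hS'.1)
      · intro d _
        rw [forallParam_mapParam]
        refine (forallParam_cutAt T).imp fun t ht => ?_
        rw [le_antisymm ((c.inv_le_zero_iff t).2 ht) unitInterval.nonneg']
        exact d.1.left_nonneg
    · intro d hd
      obtain ⟨d, -, rfl⟩ := List.mem_map.1 hd
      exact c.right_comp_le_right d.1
    · intro d hd
      obtain ⟨e, he, hd⟩ := List.mem_flatMap.1 hd
      obtain ⟨d, -, rfl⟩ := List.mem_map.1 hd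
      exact ((List.pairwise_cons.1 hs).1 e he).trans (e.1.left_le_left_comp d.1)

end assembled

/-! ### Continuous families of trees -/

/-- For maps from a compact space, the compactly generated refinement makes no difference. -/
theorem continuous_compactlyGenerated {X : Type v} {M : Type u} [TopologicalSpace X]
    [TopologicalSpace M] [CompactSpace M] [T2Space M] {g : M → X} (hg : Continuous g) :
    @Continuous M X _ (compactlyGenerated.{u} X) g := by
  let f : (Σ i : (S : CompHaus.{u}) × C(S, X), i.fst) → X := fun p => p.1.2 p.2
  exact @Continuous.comp _ _ _ _ _ (compactlyGenerated.{u} X) _ f (continuous_coinduced_rng)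
    (continuous_sigmaMk (σ := fun i : (S : CompHaus.{u}) × C(S, X) => i.fst)
      (i := ⟨CompHaus.of M, ⟨g, hg⟩⟩))

theorem KContinuous.comp_continuous {X : Type v} {Y : Type w} {M : Type u} [TopologicalSpace X]
    [TopologicalSpace Y] [TopologicalSpace M] [CompactSpace M] [T2Space M] {f : X → Y}
    (hf : KContinuous.{u} f) {g : M → X} (hg : Continuous g) : Continuous fun m => f (g m) :=
  @Continuous.comp _ _ _ _ (compactlyGenerated.{u} X) _ _ _ hf (continuous_compactlyGenerated hg)

/-- A family which agrees, on each set of a finite cover, with a family satisfying `Q`. -/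
def IsPiecewise {M : Type u} {X : Type v} (Q : (M → X) → Prop) (φ : M → X) : Prop :=
  ∃ (ι : Type) (_ : Finite ι) (E : ι → Set M) (b : ι → M → X), (∀ m, ∃ i, m ∈ E i) ∧
    (∀ i, Q (b i)) ∧ ∀ i, ∀ m ∈ E i, φ m = b i m

/-- Covers for the subtrees give a cover for a tree which is a vertex with these subtrees under the
condition `D`, and another piecewise family otherwise. -/
theorem IsPiecewise.node {A : ℕ → Type u} {M : Type u} {α : Type v} {n : ℕ} {x : M → A n}
    {t : M → unitInterval}
    {φ : Fin n → M → DTree A α} {φ₀ ψ : M → DTree A α} {Q' : Fin n → (M → DTree A α) → Prop}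
    {Q : (M → DTree A α) → Prop} {D : M → Prop} (h : ∀ i, IsPiecewise (Q' i) (φ i))
    (h₀ : IsPiecewise Q φ₀) (h1 : ∀ m, D m → ψ m = DTree.node (x m) (t m) fun i => φ i m)
    (h2 : ∀ m, ¬D m → ψ m = φ₀ m) (hQ : ∀ b : Fin n → M → DTree A α, (∀ i, Q' i (b i)) →
      Q fun m => DTree.node (x m) (t m) fun i => b i m) : IsPiecewise Q ψ := by
  choose ι hι E b hE hb hφ using h
  obtain ⟨ι₀, hι₀, E₀, b₀, hE₀, hb₀, hφ₀⟩ := h₀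
  refine ⟨ι₀ ⊕ (∀ i, ι i), inferInstance,
    Sum.elim (fun k => {m | ¬D m} ∩ E₀ k) (fun κ => {m | D m ∧ ∀ i, m ∈ E i (κ i)}),
    Sum.elim b₀ (fun κ m => DTree.node (x m) (t m) fun i => b i (κ i) m), fun m => ?_, ?_, ?_⟩
  · by_cases hD : D m
    · choose κ hκ using fun i => hE i m
      exact ⟨.inr κ, hD, hκ⟩
    · obtain ⟨k, hk⟩ := hE₀ m
      exact ⟨.inl k, hD, hk⟩
  · rintro (k | κ)
    · exact hb₀ k
    · exact hQ _ fun i => hb i (κ i)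
  · rintro (k | κ) m hm
    · exact (h2 m hm.1).trans (hφ₀ k m hm.2)
    · refine (h1 m hm.1).trans ?_
      simp only [hφ _ _ m (hm.2 _)]
      rfl

theorem IsPiecewise.of {M : Type u} {X : Type v} {Q : (M → X) → Prop} {φ : M → X} (h : Q φ) :
    IsPiecewise Q φ :=
  ⟨Unit, inferInstance, fun _ => Set.univ, fun _ => φ, fun _ => ⟨(), trivial⟩, fun _ => h,
    fun _ _ _ => rfl⟩

namespace DTree

variable {A : ℕ → Type u} [∀ n, TopologicalSpace (A n)] {M : Type u} [TopologicalSpace M]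
  {α : Type v} {β : Type w}

/-- Continuous families of trees of a fixed shape; the labels of a leaf are given by a family which
satisfies `P`. -/
inductive Fam (P : (M → α) → Prop) : (M → DTree A α) → Prop
  | leaf (a : M → α) : P a → Fam P fun m => leaf (a m)
  | node {n : ℕ} (x : M → A n) (t : M → unitInterval) (c : Fin n → M → DTree A α) :
      Continuous x → Continuous t → (∀ i, Fam P (c i)) →
        Fam P fun m => node (x m) (t m) fun i => c i m

variable {P Q : (M → α) → Prop}

theorem Fam.comp {M' : Type u} [TopologicalSpace M'] {P' : (M' → α) → Prop} {T : M → DTree A α}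
    (h : Fam P T) {a : M' → M} (ha : Continuous a) (hP : ∀ l, P l → P' fun m => l (a m)) :
    Fam P' fun m => T (a m) := by
  induction h with
  | leaf l hl => exact .leaf _ (hP l hl)
  | node x t c hx ht _ ih =>
    exact .node (fun m => x (a m)) (fun m => t (a m)) _ (hx.comp ha) (ht.comp ha) ih

theorem Fam.and_forallLabel {T : M → DTree A α} (h : Fam P T) {C : M → α → Prop}
    (hC : ∀ m, (T m).ForallLabel (C m)) : Fam (fun l => P l ∧ ∀ m, C m (l m)) T := by
  induction h with
  | leaf l hl => exact .leaf l ⟨hl, hC⟩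
  | node x t c hx ht _ ih => exact .node x t c hx ht fun i => ih i fun m => hC m i

theorem Fam.mapParam {T : M → DTree A α} (h : Fam P T) {r : M → unitInterval → unitInterval}
    (hr : ∀ t : M → unitInterval, Continuous t → Continuous fun m => r m (t m)) :
    Fam P fun m => (T m).mapParam (r m) := by
  induction h with
  | leaf l hl => exact .leaf l hl
  | node x t c hx ht _ ih => exact .node x (fun m => r m (t m)) _ hx (hr t ht) ih

theorem Fam.map {P : (M → α) → Prop} {P' : (M → β) → Prop} {T : M → DTree A α} (h : Fam P T)
    {f : M → α → β} (hf : ∀ l, P l → P' fun m => f m (l m)) :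
    Fam P' fun m => (T m).map (f m) := by
  induction h with
  | leaf l hl => exact .leaf _ (hf l hl)
  | node x t c hx ht _ ih => exact .node x t _ hx ht ih

theorem Fam.numLeaves_eq {T : M → DTree A α} (h : Fam P T) (m m' : M) :
    (T m).numLeaves = (T m').numLeaves := by
  induction h with
  | leaf l hl => rfl
  | node x t c hx ht _ ih => exact Finset.sum_congr rfl fun i _ => ih i

/-- Number the leaves of a family of trees of a fixed shape. -/
theorem Fam.exists_labelled {T : M → DTree A α} (h : Fam P T) :
    ∃ (r : ℕ) (T' : M → DTree A (Fin r)) (l : Fin r → M → α),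
      Fam (fun l => ∃ j, l = fun _ => j) T' ∧ (∀ m, (T' m).IsLabelled) ∧ (∀ j, P (l j)) ∧
      ∀ m, T m = (T' m).map fun j => l j m := by
  induction h with
  | leaf l hl =>
    exact ⟨1, fun _ => DTree.leaf (0 : Fin 1), fun _ => l, .leaf _ ⟨0, rfl⟩,
      fun m => ⟨fun _ _ _ => Subsingleton.elim (α := Fin 1) _ _,
        fun j => ⟨(0 : Fin 1), (Subsingleton.elim j 0).symm⟩⟩, fun _ => hl, fun m => rfl⟩
  | node x t c hx ht _ ih =>
    choose r T' l h1 h2 h3 h4 using ih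
    refine ⟨∑ i, r i, fun m => (DTree.node (x m) (t m) DTree.leaf).graft fun i => T' i m, fun j m =>
      blockFun (fun i k => l i k m) j, .node x t _ hx ht fun i => (h1 i).map ?_,
      fun m => (isLabelled_corolla (x m) (t m)).graft fun i => h2 i m, fun j => h3 _ _, fun m => ?_⟩
    · rintro _ ⟨j, rfl⟩
      exact ⟨_, rfl⟩
    · change DTree.node _ _ _ = DTree.node _ _ fun i => ((T' i m).map _).map _
      congr 1
      funext i
      rw [h4, map_map]
      simp only [blockFun_apply]

/-- The cut of a continuous family of trees is a continuous family, on each set of a finite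
cover. -/
theorem Fam.isPiecewise_cutAt {T : M → DTree A α} (h : Fam P T)
    (p : M → unitInterval → Prop) :
    IsPiecewise (fun B => Fam (Fam P) B ∧ ∀ m, (B m).bind (fun S => S) = T m)
      fun m => (T m).cutAt (p m) := by
  induction h with
  | leaf l hl => exact .of ⟨.leaf _ (.leaf l hl), fun m => rfl⟩
  | node x t c hx ht hc ih =>
    refine IsPiecewise.node (D := fun m => p m (t m)) ih (.of (φ := fun m =>
      DTree.leaf (DTree.node (x m) (t m) fun i => c i m)) ⟨.leaf _ (.node x t c hx ht hc),
        fun m => rfl⟩) (fun m hm => cutAt_pos hm) (fun m hm => cutAt_neg hm) fun b hb =>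
        ⟨.node x t b hx ht fun i => (hb i).1, fun m => ?_⟩
    simp only [bind, (hb _).2]

/-- The same for two successive cuts. -/
theorem Fam.isPiecewise_cutAt_cutAt {T : M → DTree A α} (h : Fam P T)
    (p q : M → unitInterval → Prop) :
    IsPiecewise (fun B => Fam (Fam (Fam P)) B ∧
      ∀ m, ((B m).bind fun B' => B'.bind fun S => S) = T m)
      fun m => ((T m).cutAt (p m)).map fun S => S.cutAt (q m) := by
  induction h with
  | leaf l hl => exact .of ⟨.leaf _ (.leaf _ (.leaf l hl)), fun m => rfl⟩
  | node x t c hx ht hc ih =>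
    have h₀ : IsPiecewise (fun B : M → DTree A (DTree A (DTree A α)) => Fam (Fam (Fam P)) B ∧
        ∀ m, ((B m).bind fun B' => B'.bind fun S => S) = DTree.node (x m) (t m) fun i => c i m)
        (fun m => DTree.leaf ((DTree.node (x m) (t m) fun i => c i m).cutAt (q m))) := by
      obtain ⟨ι, hι, E, b, hE, hb, hφ⟩ := (Fam.node x t c hx ht hc).isPiecewise_cutAt q
      exact ⟨ι, hι, E, fun i m => DTree.leaf (b i m), hE,
        fun i => ⟨.leaf _ (hb i).1, fun m => (hb i).2 m⟩, fun i m hm => congrArg _ (hφ i m hm)⟩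
    refine IsPiecewise.node (D := fun m => p m (t m)) ih h₀
      (fun m hm => by rw [cutAt_pos hm, map_node]) (fun m hm => by rw [cutAt_neg hm]; rfl)
      fun b hb => ⟨.node x t b hx ht fun i => (hb i).1, fun m => ?_⟩
    simp only [bind, (hb _).2]

theorem Fam.isClosed_forallLabel {T : M → DTree A α} (h : Fam P T) {C : M → α → Prop}
    (hC : ∀ l, P l → IsClosed {m | C m (l m)}) : IsClosed {m | (T m).ForallLabel (C m)} := by
  induction h with
  | leaf l hl => exact hC l hl
  | node x t c hx ht _ ih =>
    have : {m | (DTree.node (x m) (t m) fun i => c i m).ForallLabel (C m)} =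
      ⋂ i, {m | (c i m).ForallLabel (C m)} := by ext m; simp [ForallLabel]
    rw [this]
    exact isClosed_iInter ih

theorem Fam.isClosed_forallParam {T : M → DTree A α} (h : Fam P T) {C : M → unitInterval → Prop}
    (hC : ∀ t : M → unitInterval, Continuous t → IsClosed {m | C m (t m)}) :
    IsClosed {m | (T m).ForallParam (C m)} := by
  induction h with
  | leaf l hl => exact isClosed_univ
  | node x t c hx ht _ ih =>
    have : {m | (DTree.node (x m) (t m) fun i => c i m).ForallParam (C m)} =
      {m | C m (t m)} ∩ ⋂ i, {m | (c i m).ForallParam (C m)} := by ext m; simp [ForallParam]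
    rw [this]
    exact (hC t ht).inter (isClosed_iInter ih)

end DTree

/-! ### Continuous families in free algebras -/

section IsContFamily

variable {P' : TopOperad.{u}} {M : Type u} [TopologicalSpace M] {α : Type v} {β : Type w}

/-- Families of elements of a free algebra given by continuous families of operations; the labels
are given by families which satisfy `P`. -/
def IsContFamily (P : (M → α) → Prop) (φ : M → FreeAlg P' α) : Prop :=
  ∃ (n : ℕ) (v : M → P'.obj n) (l : Fin n → M → α), Continuous v ∧ (∀ j, P (l j)) ∧
    ∀ m, φ m = FreeAlg.op (v m) fun j => FreeAlg.pure (l j m)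

theorem IsContFamily.pure {P : (M → α) → Prop} {l : M → α} (h : P l) :
    IsContFamily P fun m => (FreeAlg.pure (l m) : FreeAlg P' α) :=
  ⟨1, fun _ => P'.unit, fun _ => l, continuous_const, fun _ => h,
    fun _ => (FreeAlg.op_unit _).symm⟩

/-- The labels being constant, such a family is given by a continuous family of operations. -/
theorem IsContFamily.continuous {q : ℕ} {φ : M → FreeAlg P' (Fin q)}
    (h : IsContFamily (fun l => ∃ j, l = fun _ => j) φ) {y : M → P'.obj q}
    (hy : ∀ m, φ m = FreeAlg.op (y m) FreeAlg.pure) : Continuous y := by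
  rcases isEmpty_or_nonempty M with hM | ⟨⟨m₀⟩⟩
  · exact continuous_of_const fun m => hM.elim m
  · obtain ⟨n, v, l, h1, h2, h3⟩ := h
    choose a ha using h2
    simp only [ha] at h3
    have hr : ∀ m, LabelledPoint.Represents ⟨n, v m, a⟩ (y m) := fun m => by
      rw [FreeAlg.represents_iff, ← hy, h3, FreeAlg.op_eq_mk]
    -- The renumbering is determined by the labels, so it does not depend on the parameter `m`.
    obtain ⟨e, he, -⟩ := hr m₀
    have : y = fun m => P'.act e (v m) := by
      funext m
      obtain ⟨e', he', h'⟩ := hr m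
      obtain rfl : e' = e := by
        refine Equiv.ext fun j => ?_
        have hb : Function.Injective a := by
          intro i i' hi
          rw [← e.apply_symm_apply i, ← e.apply_symm_apply i']
          refine congrArg e ((he _).symm.trans (Eq.trans ?_ (he _)))
          simpa using hi
        exact hb ((he' j).trans (he j).symm)
      exact h'
    rw [this]
    exact (P'.continuous_act e).comp h1

variable [CompactSpace M] [T2Space M]

theorem IsContFamily.op {P : (M → α) → Prop} {n : ℕ} {v : M → P'.obj n} (hv : Continuous v)
    {φ : Fin n → M → FreeAlg P' α} (h : ∀ i, IsContFamily P (φ i)) :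
    IsContFamily P fun m => FreeAlg.op (v m) fun i => φ i m := by
  choose r w l h1 h2 h3 using h
  refine ⟨∑ i, r i, fun m => P'.comp (v m) fun i => w i m,
    fun j m => blockFun (fun i k => l i k m) j,
    P'.continuous_comp.comp_continuous (g := fun m => (v m, fun i => w i m))
      (hv.prodMk (continuous_pi h1)), fun j => h2 _ _, fun m => ?_⟩
  simp only [FreeAlg.op_comp, h3, blockFun_apply]

theorem IsContFamily.bind {P : (M → α) → Prop} {Q : (M → β) → Prop} {φ : M → FreeAlg P' α}
    (h : IsContFamily P φ) {ψ : M → α → FreeAlg P' β}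
    (hψ : ∀ l, P l → IsContFamily Q fun m => ψ m (l m)) :
    IsContFamily Q fun m => (φ m).bind (ψ m) := by
  obtain ⟨n, v, l, h1, h2, h3⟩ := h
  simp only [h3, FreeAlg.op_pure_bind]
  exact .op h1 fun j => hψ _ (h2 j)

theorem DTree.Fam.isContFamily_freeEval {A : ℕ → Type u} [∀ n, TopologicalSpace (A n)]
    {P : (M → α) → Prop} {T : M → DTree A α} (h : Fam P T) {g : ∀ n, A n → P'.obj n}
    (hg : ∀ n, Continuous (g n)) : IsContFamily P fun m => freeEval P' g (T m) := by
  induction h with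
  | leaf l hl => exact .pure hl
  | node x t c hx ht _ ih =>
    simp only [freeEval_node]
    exact .op ((hg _).comp hx) ih

end IsContFamily

/-! ### Continuity of assembling -/

section core

open DTree

variable {O O' : TopOperad.{u}} {η : O.Hom O'} {α : Type v} {β : Type w} {A : ℕ → Type u}
  [∀ n, TopologicalSpace (A n)] (g : ∀ n, A n → BV O n) (W : ∀ n, A n → ℕ) (k : ℕ∞)

/-- Families `F` of functions on `WB(O)` such that `F m (z m)` is continuous for the families `z` of
points represented by continuous families of trees with labels in `A`. -/
def IsTestContinuous {M : Type u} [TopologicalSpace M] (F : M → ∀ q, WB O q → O'.obj q) : Prop :=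
  ∀ (M' : Type u) [TopologicalSpace M'] [CompactSpace M'] [T2Space M'] (a : M' → M),
    Continuous a → ∀ (q : ℕ) (T : M' → DTree A (Fin q)), Fam (fun l => ∃ j, l = fun _ => j) T →
    (q : ℕ∞) ≤ k → (∀ m, (T m).FilteredW W k) →
    ∀ hT : ∀ m, ((T m).mapVert g).IsLabelled ∧ ((T m).mapVert g).Mono,
      Continuous fun m => F (a m) q (WB.mk ⟨(T m).mapVert g, hT m⟩)

variable {g W k}

theorem IsTestContinuous.comp {M M' : Type u} [TopologicalSpace M] [TopologicalSpace M']
    {F : M → ∀ q, WB O q → O'.obj q} (h : IsTestContinuous g W k F) {a : M' → M}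
    (ha : Continuous a) : IsTestContinuous g W k fun m => F (a m) :=
  fun M'' _ _ _ b hb => h M'' (fun m => a (b m)) (ha.comp hb)

omit [∀ n, TopologicalSpace (A n)] in
/-- A tree which is filtered with respect to the weights `W` represents a point of the filtration
term. -/
theorem FilteredW.mapVert_bvWeight (hgW : ∀ n x, (g n x).univalents ≤ W n x) {T : DTree A α}
    (h : T.FilteredW W k) : (T.mapVert g).FilteredW (bvWeight O) k :=
  (filteredW_mapVert _ _ _).2 (h.of_le hgW)

variable {M : Type u} [TopologicalSpace M] [CompactSpace M] [T2Space M]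

/-- Families which are continuous on numbered trees send families of trees with arbitrary labels of
the leaves to continuous families. -/
theorem IsTestContinuous.isContFamily_pieceEval {F : M → ∀ q, WB O q → O'.obj q}
    (h : IsTestContinuous g W k F) (hF : ∀ m, IsBimodMapOn η k (F m))
    (hgW : ∀ n x, (g n x).univalents ≤ W n x) {P : (M → α) → Prop} {T : M → DTree A α}
    (hT : Fam P T) (hm : ∀ m, (T m).Mono) (hf : ∀ m, (T m).FilteredW W k)
    (hk : ∀ m, ((T m).numLeaves : ℕ∞) ≤ k) :
    IsContFamily P fun m => pieceEval η (F m) ((T m).mapVert g) := by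
  rcases isEmpty_or_nonempty M with hM | ⟨⟨m₀⟩⟩
  · exact ⟨0, fun m => hM.elim m, fun j => j.elim0, continuous_of_const fun m => hM.elim m,
      fun j => j.elim0, fun m => hM.elim m⟩
  obtain ⟨r, T', l, h1, h2, h3, h4⟩ := hT.exists_labelled
  have hX : ∀ m, ((T' m).mapVert g).IsLabelled ∧ ((T' m).mapVert g).Mono := fun m =>
    ⟨(h2 m).mapVert g, ((mono_map_iff _).1 (h4 m ▸ hm m)).mapVert g⟩
  have hf' : ∀ m, (T' m).FilteredW W k := fun m => filteredW_map.1 (h4 m ▸ hf m)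
  have hr : (r : ℕ∞) ≤ k := by
    have := hk m₀
    rwa [h4, numLeaves_map, (h2 m₀).numLeaves_eq] at this
  refine ⟨r, fun m => F m r (WB.mk ⟨_, hX m⟩), l,
    h M (fun m => m) continuous_id r T' h1 hr hf' hX, h3, fun m => ?_⟩
  exact (congrArg (pieceEval η (F m))
    ((congrArg (mapVert g) (h4 m)).trans (mapVert_map g _ _))).trans
    ((hF m).pieceEval_map_eq_op (hX m) hr (FilteredW.mapVert_bvWeight hgW (hf' m)) _)

theorem numLeaves_mapVert {A B : ℕ → Type u} (g : ∀ n, A n → B n) (T : DTree A α) :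
    (T.mapVert g).numLeaves = T.numLeaves := by
  induction T with
  | leaf a => rfl
  | node x t c ih => exact Finset.sum_congr rfl fun i _ => ih i

/-! #### Conditions on the pieces -/

theorem DTree.Mono.of_bind {A : ℕ → Type u} {T : DTree A α} {S : α → DTree A β}
    (h : (T.bind S).Mono) : T.Mono := by
  induction T with
  | leaf a => trivial
  | node x t c ih =>
    refine fun i => ⟨?_, ih i (h i).2⟩
    have : RootGE t ((c i).bind S) := (h i).1
    generalize c i = T at this
    cases T with
    | leaf a => trivial
    | node y s d => exact this

theorem DTree.FilteredW.forallLabel_of_bind {A : ℕ → Type u} {W : ∀ n, A n → ℕ} {T : DTree A α}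
    {S : α → DTree A β} (h : (T.bind S).FilteredW W k) (hT : T.ForallParam (· ≠ 1)) :
    T.ForallLabel fun a => (S a).FilteredW W k := by
  induction T with
  | leaf a => exact h
  | node x t c ih =>
    refine fun i => ih i ?_ (hT.2 i)
    by_cases ht : t = 0
    · subst ht
      exact (filteredW_zero x _).1 h i
    · exact filteredW_of_inputsW_le (le_trans
        (Nat.cast_le.2 (inputsW_child_le x hT.1 (fun i => (c i).bind S) i))
        ((filteredW_of_ne_zero x ht _).1 h))

theorem DTree.inputsW_mapParam_le_of_bind {A : ℕ → Type u} {W : ∀ n, A n → ℕ}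
    (hW : ∀ n x, 1 ≤ W n x + n) {r : unitInterval → unitInterval} (hr : r 1 = 1) (T : DTree A α)
    (S : α → DTree A β) : (T.mapParam r).inputsW W ≤ (T.bind S).inputsW W := by
  induction T with
  | leaf a => exact one_le_inputsW hW _
  | node x t c ih =>
    rw [DTree.mapParam]
    by_cases ht : r t = 1
    · rw [ht, inputsW_one]
      exact one_le_inputsW hW _
    · rw [inputsW_of_ne_one x ht, bind, inputsW_of_ne_one x fun h => ht (by rw [h, hr])]
      exact add_le_add_right (Finset.sum_le_sum fun i _ => ih i) _

/-- A part at the root remains filtered when its parameters are rescaled, provided that all vertices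
with parameter `0` belong to this part. -/
theorem DTree.FilteredW.mapParam_of_bind {A : ℕ → Type u} {W : ∀ n, A n → ℕ}
    (hW : ∀ n x, 1 ≤ W n x + n) {r : unitInterval → unitInterval} (hr : r 1 = 1) (hr0 : r 0 = 0)
    {T : DTree A α} {S : α → DTree A β} (h : (T.bind S).FilteredW W k)
    (hS : T.ForallLabel fun a => (S a).ForallParam (· ≠ 0)) :
    (T.mapParam r).FilteredW W k := by
  induction T with
  | leaf a =>
    change ((1 : ℕ) : ℕ∞) ≤ k
    refine le_trans (Nat.cast_le.2 (one_le_inputsW hW (S a))) ?_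
    change (S a).FilteredW W k at h
    change (S a).ForallParam (· ≠ 0) at hS
    generalize S a = T at h hS
    cases T with
    | leaf b => simpa [inputsW, FilteredW] using h
    | node x t c => exact (filteredW_of_ne_zero x hS.1 c).1 h
  | node x t c ih =>
    by_cases ht : t = 0
    · subst ht
      rw [DTree.mapParam, hr0, filteredW_zero]
      exact fun i => ih i ((filteredW_zero x _).1 h i) (hS i)
    · exact filteredW_of_inputsW_le (le_trans
        (Nat.cast_le.2 (inputsW_mapParam_le_of_bind hW hr (node x t c) S))
        ((filteredW_of_ne_zero x ht _).1 h))

/-! #### The induction on the number of intervals -/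

variable (O O' M) in
/-- Families of intervals and of functions on `WB(O)`. -/
abbrev IntervalMapFamily : Type u := (M → LittleInterval) × (M → ∀ q, WB O q → O'.obj q)

/-- The members of the families in a list. -/
def membersAt {M : Type u} (L : List (IntervalMapFamily O O' M)) (m : M) :
    List (IntervalMap O O') :=
  L.map fun d => (d.1 m, d.2 m)

theorem membersAt_restrict {M : Type u} {L : List (IntervalMapFamily O O' M)} {Z : Set M} (m : Z) :
    membersAt (M := Z) (L.map fun d => (fun m => d.1 m, fun m => d.2 m)) m = membersAt L m.1 :=
  List.map_map

theorem continuous_of_closure_cover {X : Type*} [TopologicalSpace X] {ι : Type} [Finite ι]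
    {M : Type u} [TopologicalSpace M]
    {E : ι → Set M} (hE : ∀ m, ∃ i, m ∈ E i) {y : M → X}
    (h : ∀ i, Continuous fun m : closure (E i) => y m) : Continuous y :=
  (locallyFinite_of_finite fun i => closure (E i)).continuous
    (Set.eq_univ_of_forall fun m =>
      let ⟨i, hi⟩ := hE m
      Set.mem_iUnion.2 ⟨i, subset_closure hi⟩)
    (fun _ => isClosed_closure) fun i => continuousOn_iff_continuous_domRestrict.2 (h i)

theorem LittleInterval.continuous_left : Continuous LittleInterval.left :=
  continuous_fst.comp continuous_subtype_val

theorem LittleInterval.continuous_right : Continuous LittleInterval.right :=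
  continuous_snd.comp continuous_subtype_val

theorem LittleInterval.continuous_inv {M : Type u} [TopologicalSpace M] {c : M → LittleInterval}
    (hc : Continuous c) {t : M → unitInterval} (ht : Continuous t) :
    Continuous fun m => (c m).inv (t m) := by
  refine continuous_projIcc.comp (Continuous.div ?_ ?_ fun m =>
    (sub_pos.2 (c m).left_lt_right).ne')
  · exact (continuous_subtype_val.comp ht).sub (continuous_left.comp hc)
  · exact (continuous_right.comp hc).sub (continuous_left.comp hc)

/-- By monotonicity, all vertices above the cut have parameter at least `r`. -/
theorem DTree.Mono.forallLabel_cutAt_lt {A : ℕ → Type u} {r : ℝ} {T : DTree A α} (h : T.Mono) :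
    (T.cutAt fun t => (t : ℝ) < r).ForallLabel fun S => S.ForallParam fun t => r ≤ (t : ℝ) := by
  induction T with
  | leaf a => trivial
  | node x t c ih =>
    by_cases ht : (t : ℝ) < r
    · rw [cutAt_pos (p := fun t : unitInterval => (t : ℝ) < r) ht]
      exact fun i => ih i (h i).2
    · rw [cutAt_neg (p := fun t : unitInterval => (t : ℝ) < r) ht]
      exact (h.forallParam_ge (s := t) le_rfl).imp fun s hs =>
        (not_lt.1 ht).trans (Subtype.coe_le_coe.2 hs)

variable (η g W k) in
/-- Assembling continuous families of trees gives continuous families. -/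
def AssemblesContinuously (L : List (IntervalMapFamily O O' M)) : Prop :=
  ∀ (q : ℕ) (T : M → DTree A (Fin q)), Fam (fun l => ∃ j, l = fun _ => j) T →
    (∀ m, (T m).Mono) → (∀ m, (T m).FilteredW W k) → ∀ y : M → O'.obj q,
    (∀ m, assembleFree η (membersAt L m) ((T m).mapVert g) =
      FreeAlg.op (y m) FreeAlg.pure) → Continuous y

omit [CompactSpace M] [T2Space M] in
/-- Passage from numbered leaves to arbitrary constant labels. -/
theorem AssemblesContinuously.isContFamily {L : List (IntervalMapFamily O O' M)}
    (h : AssemblesContinuously η g W k L) {T : M → DTree A α}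
    (hT : Fam (fun l => ∃ j, l = fun _ => j) T) (hm : ∀ m, (T m).Mono)
    (hf : ∀ m, (T m).FilteredW W k) : IsContFamily (fun l => ∃ j, l = fun _ => j) fun m =>
      assembleFree η (membersAt L m) ((T m).mapVert g) := by
  obtain ⟨r, T', l, h1, h2, h3, h4⟩ := hT.exists_labelled
  have hT' := fun m => exists_assembleFree_eq η (membersAt L m) ((h2 m).mapVert g)
  choose y hy using hT'
  refine ⟨r, y, l, h r T' h1 (fun m => (mono_map_iff _).1 (h4 m ▸ hm m))
    (fun m => filteredW_map.1 (h4 m ▸ hf m)) y hy, h3, fun m => ?_⟩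
  refine (congrArg (assembleFree η _)
    ((congrArg (mapVert g) (h4 m)).trans (mapVert_map g _ _))).trans
    ((assembleFree_map _ _ _).trans ?_)
  rw [hy]
  exact FreeAlg.op_pure_bind _ (fun i => i) _

/-- The conditions satisfied by the piece which belongs to the first interval, and by the trees on
top of it. -/
structure IsPiece (W : ∀ n, A n → ℕ) (k : ℕ∞) (r : ℝ) (B : DTree A (DTree A α)) : Prop where
  mono : (B.bind fun S => S).Mono
  filteredW : (B.bind fun S => S).FilteredW W k
  numLeaves : (B.numLeaves : ℕ∞) ≤ k
  le : B.ForallParam fun t => (t : ℝ) ≤ r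
  ge : B.ForallLabel fun S => S.ForallParam fun t => r ≤ (t : ℝ)

omit [∀ n, TopologicalSpace (A n)] in
theorem IsPiece.forallLabel_filteredW {c : LittleInterval} {B : DTree A (DTree A α)}
    (h : IsPiece W k c.right B) : B.ForallLabel fun S => S.FilteredW W k := by
  rcases c.right_le_one.lt_or_eq with hc | hc
  · refine h.filteredW.forallLabel_of_bind (h.le.imp fun t ht h1 => ?_)
    rw [h1] at ht
    exact absurd ht (not_le.2 hc)
  -- If the interval ends at `1`, all vertices above the piece have parameter `1`, and a single
  -- input is allowed since the piece has an input.
  · have h1 := h.ge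
    rw [forallLabel_iff] at h1 ⊢
    intro j
    refine filteredW_of_inputsW_le ?_
    rw [inputsW_of_rootGE_one (((h1 j).imp fun t ht => (?_ : (1 : unitInterval) ≤ t)).rootGE)]
    · exact le_trans (Nat.cast_le.2 (Nat.succ_le_of_lt j.pos)) h.numLeaves
    · rw [hc] at ht
      exact ht

omit [∀ n, TopologicalSpace (A n)] in
theorem IsPiece.filteredW_mapParam (hW : ∀ n x, 1 ≤ W n x + n) {c : LittleInterval}
    {B : DTree A (DTree A α)} (h : IsPiece W k c.right B) :
    (B.mapParam c.inv).FilteredW W k := by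
  refine h.filteredW.mapParam_of_bind hW c.inv_one c.inv_zero (h.ge.imp fun S hS =>
    hS.imp fun t ht h0 => ?_)
  rw [h0] at ht
  exact absurd ht (not_le.2 (c.left_nonneg.trans_lt c.left_lt_right))

omit [CompactSpace M] [T2Space M] in
theorem forall_mem_closure {C : M → Prop} (hC : IsClosed {m | C m}) {E : Set M}
    (h : ∀ m ∈ E, C m) : ∀ m ∈ closure E, C m :=
  fun _ hm => closure_minimal (fun _ hm => h _ hm : E ⊆ {m | C m}) hC hm

omit [CompactSpace M] [T2Space M] in
/-- Cover the space of parameters by the closures of the sets where the pieces at the root, in the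
gap below the first interval and in the first interval, have constant shape. The conditions on
these pieces, in a weak form, hold on these closures. -/
theorem exists_pieces (hW : ∀ n (x : A n), 1 ≤ W n x + n) {c : M → LittleInterval}
    (hc : Continuous c) {P : (M → α) → Prop} {T : M → DTree A α} (hT : Fam P T)
    (hm : ∀ m, (T m).Mono) (hf : ∀ m, (T m).FilteredW W k) :
    ∃ (ι : Type) (_ : Finite ι) (E : ι → Set M) (B : ι → M → DTree A (DTree A (DTree A α))),
      (∀ m, ∃ i, m ∈ E i) ∧ ∀ i, Fam (Fam (Fam P)) (B i) ∧
        (∀ m, ((B i m).bind fun B' => B'.bind fun S => S) = T m) ∧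
        ∀ m ∈ closure (E i), ((B i m).ForallParam fun t => (t : ℝ) ≤ (c m).left) ∧
          (B i m).ForallLabel (IsPiece W k (c m).right) := by
  have hleft := LittleInterval.continuous_left.comp hc
  have hright := LittleInterval.continuous_right.comp hc
  obtain ⟨ι, hι, E, B, hE, hb, hφ⟩ := hT.isPiecewise_cutAt_cutAt
    (fun m t => (t : ℝ) ≤ (c m).left) (fun m t => (t : ℝ) < (c m).right)
  refine ⟨ι, hι, E, B, hE, fun i => ⟨(hb i).1, (hb i).2, ?_⟩⟩
  obtain ⟨hB, hBT⟩ := hb i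
  have hex := hφ i
  generalize B i = B at hB hBT hex
  generalize E i = E at hex
  -- On `E`, the pieces are those of the cuts. The strict inequalities for their parameters become
  -- weak ones on the closure of `E`.
  have h1 : ∀ m ∈ closure E, (B m).ForallParam fun t => (t : ℝ) ≤ (c m).left := by
    refine forall_mem_closure (hB.isClosed_forallParam
      (C := fun m t => (t : ℝ) ≤ (c m).left)
      fun t ht => isClosed_le (continuous_subtype_val.comp ht) hleft) fun m hmE => ?_
    rw [← hex m hmE, forallParam_map]
    exact forallParam_cutAt _
  have h2 : ∀ m ∈ closure E, (B m).ForallLabel fun B' => (B'.numLeaves : ℕ∞) ≤ k := by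
    refine forall_mem_closure (hB.isClosed_forallLabel
      (C := fun m B' => (B'.numLeaves : ℕ∞) ≤ k) fun l hl => ?_) fun m hmE => ?_
    · by_cases h : ∃ m, ((l m).numLeaves : ℕ∞) ≤ k
      · obtain ⟨m, h⟩ := h
        simp only [hl.numLeaves_eq _ m, h]
        exact isClosed_univ
      · simp only [not_exists.1 h]
        exact isClosed_empty
    · rw [← hex m hmE, forallLabel_map]
      refine ((hf m).forallLabel_cutAt (p := fun t => (t : ℝ) ≤ (c m).left) (c m).left_nonneg
        (not_le.2 (c m).left_lt_one)).imp fun S hS => le_trans (Nat.cast_le.2 ?_) hS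
      exact numLeaves_cutAt_le (p := fun t => (t : ℝ) < (c m).right) hW
        (not_lt.2 (c m).right_le_one) S
  have h3 : ∀ m ∈ closure E, (B m).ForallLabel fun B' =>
      B'.ForallParam fun t => (t : ℝ) ≤ (c m).right := by
    refine forall_mem_closure (hB.isClosed_forallLabel
      (C := fun m B' => B'.ForallParam fun t => (t : ℝ) ≤ (c m).right)
      fun l hl => hl.isClosed_forallParam (C := fun m t => (t : ℝ) ≤ (c m).right) fun t ht =>
        isClosed_le (continuous_subtype_val.comp ht) hright) fun m hmE => ?_
    rw [← hex m hmE, forallLabel_map]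
    exact .of_forall (fun S => (forallParam_cutAt S).imp fun t ht => le_of_lt ht) _
  have h4 : ∀ m ∈ closure E, (B m).ForallLabel fun B' => B'.ForallLabel fun S =>
      S.ForallParam fun t => (c m).right ≤ (t : ℝ) := by
    refine forall_mem_closure (hB.isClosed_forallLabel
      (C := fun m B' => B'.ForallLabel fun S => S.ForallParam fun t => (c m).right ≤ (t : ℝ))
      fun l hl => hl.isClosed_forallLabel
      (C := fun m S => S.ForallParam fun t => (c m).right ≤ (t : ℝ)) fun l' hl' =>
        hl'.isClosed_forallParam (C := fun m t => (c m).right ≤ (t : ℝ)) fun t ht =>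
        isClosed_le hright (continuous_subtype_val.comp ht)) fun m hmE => ?_
    rw [← hex m hmE, forallLabel_map]
    exact (hm m).forallLabel_cutAt.imp fun S hS => hS.forallLabel_cutAt_lt
  intro m hmE
  have hmT := hm m
  have hfT := hf m
  rw [← hBT m] at hmT hfT
  have h6 := FilteredW.forallLabel_of_bind hfT ((h1 m hmE).imp fun t ht h => by
    rw [h] at ht
    exact absurd ht (not_le.2 (c m).left_lt_one))
  exact ⟨h1 m hmE, ((forallLabel_mono_of_bind hmT).and (h6.and ((h2 m hmE).and
    ((h3 m hmE).and (h4 m hmE))))).imp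
    fun B' h => ⟨h.1, h.2.1, h.2.2.1, h.2.2.2.1, h.2.2.2.2⟩⟩

omit [∀ n, TopologicalSpace (A n)] in
/-- The value of assembling in terms of pieces which satisfy the weak conditions. -/
theorem assembleFree_eq_of_pieces (hgW : ∀ n x, (g n x).univalents ≤ W n x)
    {c : LittleInterval} {f : ∀ q, WB O q → O'.obj q} (hf : IsBimodMapOn η k f)
    {L : List (IntervalMap O O')} (hL : ∀ d ∈ L, c.right ≤ d.1.left)
    {B : DTree A (DTree A (DTree A α))} (hm : (B.bind fun B' => B'.bind fun S => S).Mono)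
    (h1 : B.ForallParam fun t => (t : ℝ) ≤ c.left) (h2 : B.ForallLabel (IsPiece W k c.right)) :
    assembleFree η ((c, f) :: L) ((B.bind fun B' => B'.bind fun S => S).mapVert g) =
      (freeEval O' (fun n x => η.toFun n (BV.μ (g n x))) B).bind fun B' =>
        (pieceEval η f ((B'.mapParam c.inv).mapVert g)).bind fun S =>
          assembleFree η L (S.mapVert g) := by
  have hW : ∀ n (x : A n), 1 ≤ W n x + n := fun n x =>
    (g n x).one_le_univalents_add.trans (Nat.add_le_add_right (hgW n x) n)
  have hm' := hm.mapVert g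
  rw [mapVert_bind] at hm' ⊢
  rw [assembleFree_bind_of_le hm', treeEval, freeEval_mapVert]
  · refine freeEval_bind_congr (h2.imp fun B' hB' => ?_)
    have hmono := hB'.mono.mapVert g
    rw [mapVert_bind] at hmono ⊢
    have hF : ((B'.mapVert g).mapParam c.inv).FilteredW (bvWeight O) k := by
      rw [mapVert_mapParam]
      exact FilteredW.mapVert_bvWeight hgW (hB'.filteredW_mapParam hW)
    rw [← mapVert_mapParam]
    refine assembleFree_cons_bind hf hL hmono hmono.of_bind
      (forallParam_mapVert.2 hB'.le) (forallLabel_mapVert.2 (hB'.ge.imp fun S hS =>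
        forallParam_mapVert.2 hS)) hF ?_
    rw [numLeaves_mapVert]
    exact hB'.numLeaves
  · intro d hd
    rw [forallParam_mapVert]
    rcases List.mem_cons.1 hd with rfl | hd
    · exact h1
    · exact h1.imp fun t ht => ht.trans (c.left_lt_right.le.trans (hL d hd))

/-- The induction step: on each of finitely many closed sets, the pieces are continuous families of
fixed shape, and assembling is given by a composite of continuous operations. -/
theorem AssemblesContinuously.cons (hμ : ∀ n, Continuous fun x : A n => BV.μ (g n x))
    (hgW : ∀ n x, (g n x).univalents ≤ W n x) {c : M → LittleInterval}
    {F : M → ∀ q, WB O q → O'.obj q} {L : List (IntervalMapFamily O O' M)} (hc : Continuous c)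
    (hF : IsTestContinuous g W k F) (hf : ∀ m, IsBimodMapOn η k (F m))
    (hL : ∀ m, ∀ d ∈ membersAt L m, (c m).right ≤ d.1.left)
    (ih : ∀ Z : Set M, CompactSpace Z → AssemblesContinuously (M := Z) η g W k
      (L.map fun d => (fun m => d.1 m, fun m => d.2 m))) :
    AssemblesContinuously η g W k ((c, F) :: L) := by
  intro q T hT hm hTf y hy
  have hW : ∀ n (x : A n), 1 ≤ W n x + n := fun n x =>
    (g n x).one_le_univalents_add.trans (Nat.add_le_add_right (hgW n x) n)
  obtain ⟨ι, hι, E, b, hE, hb⟩ := exists_pieces hW hc hT hm hTf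
  refine continuous_of_closure_cover hE fun i => ?_
  obtain ⟨hB, hBT, hcl⟩ := hb i
  generalize b i = B at hB hBT hcl
  generalize E i = E at hcl
  have hZ : CompactSpace (closure E) := isCompact_iff_compactSpace.1 isClosed_closure.isCompact
  have hval : ∀ m : closure E, FreeAlg.op (y m) FreeAlg.pure =
      (freeEval O' (fun n x => η.toFun n (BV.μ (g n x))) (B m)).bind fun B' =>
        (pieceEval η (F m) ((B'.mapParam (c m).inv).mapVert g)).bind fun S =>
          assembleFree η (membersAt L m.1) (S.mapVert g) := by
    intro m
    have hmT := hm m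
    rw [← hBT m] at hmT
    rw [← hy m, ← hBT m]
    exact assembleFree_eq_of_pieces hgW (hf m) (hL m) hmT (hcl m m.2).1 (hcl m m.2).2
  refine IsContFamily.continuous (φ := fun m : closure E => FreeAlg.op (y m) FreeAlg.pure) ?_
    fun m => rfl
  simp only [hval]
  have hBZ := (hB.comp (P' := Fam (Fam fun l => ∃ j, l = fun _ => j))
    (continuous_subtype_val (p := (· ∈ closure E))) fun l hl =>
    hl.comp continuous_subtype_val fun l hl => hl.comp continuous_subtype_val fun l hl =>
      hl.imp fun j hj => by rw [hj]).and_forallLabel fun m => (hcl m m.2).2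
  refine (hBZ.isContFamily_freeEval fun n => (η.continuous n).comp (hμ n)).bind
    (ψ := fun m B' => (pieceEval η (F m) ((B'.mapParam (c m).inv).mapVert g)).bind fun S =>
          assembleFree η (membersAt L m.1) (S.mapVert g)) fun B' hB' => ?_
  obtain ⟨hB'1, hB'2⟩ := hB'
  have hB'3 := (hB'1.and_forallLabel (C := fun _ S => S.Mono ∧ S.FilteredW W k) fun m =>
    (forallLabel_mono_of_bind (hB'2 m).mono).and (hB'2 m).forallLabel_filteredW).mapParam
    (r := fun m => (c m).inv) fun t ht =>
      LittleInterval.continuous_inv (hc.comp continuous_subtype_val) ht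
  refine ((hF.comp continuous_subtype_val).isContFamily_pieceEval (fun m => hf m) hgW hB'3
    (fun m => (hB'2 m).mono.of_bind.mapParam (c m).inv_mono)
    (fun m => (hB'2 m).filteredW_mapParam hW) fun m => ?_).bind
    (ψ := fun m S => assembleFree η (membersAt L m.1) (S.mapVert g)) fun S hS => ?_
  · rw [(exists_cast_mapParam (γ := ℕ) _ (c m).inv).1]
    exact (hB'2 m).numLeaves
  · have := (ih (closure E) hZ).isContFamily hS.1 (fun m => (hS.2 m).1) fun m => (hS.2 m).2
    simpa only [membersAt_restrict] using this

/-- Assembling is continuous. -/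
theorem assemblesContinuously (hμ : ∀ n, Continuous fun x : A n => BV.μ (g n x))
    (hgW : ∀ n x, (g n x).univalents ≤ W n x) {L : List (IntervalMapFamily O O' M)}
    (hL : ∀ d ∈ L, Continuous d.1 ∧ IsTestContinuous g W k d.2 ∧ ∀ m, IsBimodMapOn η k (d.2 m))
    (hs : ∀ m, (membersAt L m).Pairwise fun d d' => d.1.right ≤ d'.1.left) :
    AssemblesContinuously η g W k L := by
  obtain ⟨N, hN⟩ : ∃ N, L.length = N := ⟨_, rfl⟩
  induction N generalizing M with
  | zero =>
    obtain rfl := List.length_eq_zero_iff.1 hN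
    intro q T hT hm hf y hy
    refine IsContFamily.continuous ?_ hy
    simp only [membersAt, List.map_nil, assembleFree_nil, treeEval, freeEval_mapVert]
    exact hT.isContFamily_freeEval fun n => (η.continuous n).comp (hμ n)
  | succ N ih =>
    cases L with
    | nil => cases hN
    | cons d L =>
      obtain ⟨h1, h2, h3⟩ := hL _ (List.mem_cons_self ..)
      refine AssemblesContinuously.cons (c := d.1) (F := d.2) hμ hgW h1 h2 h3
        (fun m d' hd' => (List.pairwise_cons.1 (hs m)).1 d' hd')
        fun Z hZ => ih ?_ ?_ (by simpa using hN)
      · intro e' he'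
        obtain ⟨e, he, rfl⟩ := List.mem_map.1 he'
        have he := hL _ (List.mem_cons_of_mem _ he)
        exact ⟨he.1.comp continuous_subtype_val, he.2.1.comp continuous_subtype_val,
          fun m => he.2.2 m⟩
      · intro m
        have : (membersAt L m.1).Pairwise fun d d' => d.1.right ≤ d'.1.left :=
          (List.pairwise_cons.1 (hs m)).2
        rwa [membersAt_restrict]

end core

/-! ### Test families and the topology on spaces of trees -/

namespace DTree

variable {A : ℕ → Type u} [∀ n, TopologicalSpace (A n)] {α : Type v}

/-- Continuous families of trees of a fixed shape, with fixed labels of the leaves. -/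
abbrev IsFam {M : Type u} [TopologicalSpace M] (T : M → DTree A α) : Prop :=
  Fam (fun l => ∃ j, l = fun _ => j) T

theorem isFam_tree {M : Type u} [TopologicalSpace M] (S : Shape α)
    {x : M → ∀ v : S.Vert, A (S.arity v)} {t : M → S.Vert → unitInterval}
    (hx : Continuous x) (ht : Continuous t) : IsFam fun m => S.tree (x m) (t m) := by
  induction S with
  | leaf a => exact .leaf _ ⟨a, rfl⟩
  | node n c ih =>
    have hx' := continuous_pi_iff.1 hx
    have ht' := continuous_pi_iff.1 ht
    refine .node (fun m => x m none) (fun m => t m none)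
      (fun i m => (c i).tree (fun v => x m (some ⟨i, v⟩)) (fun v => t m (some ⟨i, v⟩)))
      (hx' none) (ht' none) fun i => ih i ?_ ?_
    · exact continuous_pi fun v => hx' (some ⟨i, v⟩)
    · exact continuous_pi fun v => ht' (some ⟨i, v⟩)

theorem IsFam.exists_tree {M : Type u} [TopologicalSpace M] {T : M → DTree A α} (h : IsFam T) :
    ∃ (S : Shape α) (x : M → ∀ v : S.Vert, A (S.arity v)) (t : M → S.Vert → unitInterval),
      Continuous x ∧ Continuous t ∧ ∀ m, T m = S.tree (x m) (t m) := by
  induction h with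
  | leaf l hl =>
    obtain ⟨j, rfl⟩ := hl
    exact ⟨.leaf j, fun _ v => v.elim, fun _ v => v.elim, continuous_pi fun v => v.elim,
      continuous_pi fun v => v.elim, fun _ => rfl⟩
  | @node n x t c hx ht _ ih =>
    choose S y s hy hs h using ih
    refine ⟨.node n S, fun m v => match v with
      | none => x m
      | some ⟨i, v⟩ => y i m v, fun m v => match v with
      | none => t m
      | some ⟨i, v⟩ => s i m v, continuous_pi fun v => ?_, continuous_pi fun v => ?_, fun m => ?_⟩
    · match v with
      | none => exact hx
      | some ⟨i, v⟩ => exact (continuous_apply v).comp (hy i)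
    · match v with
      | none => exact ht
      | some ⟨i, v⟩ => exact (continuous_apply v).comp (hs i)
    · simp only [h]
      rfl

theorem IsFam.continuous {M : Type u} [TopologicalSpace M] [CompactSpace M] [T2Space M]
    {T : M → DTree A α} (h : IsFam T) : Continuous T := by
  obtain ⟨S, x, t, hx, ht, hT⟩ := h.exists_tree
  rw [show T = (fun p : (∀ v : S.Vert, A (S.arity v)) × (S.Vert → unitInterval) =>
    S.tree p.1 p.2) ∘ fun m => (x m, t m) from funext hT]
  refine @Continuous.comp _ _ _ _ (compactlyGenerated.{u} _) _ _ _ ?_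
    (continuous_compactlyGenerated (hx.prodMk ht))
  exact continuous_iff_coinduced_le.2 (le_iSup (fun S : Shape α => coinduced
    (fun p : (∀ v : S.Vert, A (S.arity v)) × (S.Vert → unitInterval) => S.tree p.1 p.2)
      (compactlyGenerated.{u} _)) S)

theorem IsFam.const (M : Type u) [TopologicalSpace M] (T : DTree A α) : IsFam fun _ : M => T := by
  induction T with
  | leaf a => exact .leaf _ ⟨a, rfl⟩
  | node x t c ih =>
    exact .node (fun _ => x) (fun _ => t) (fun i _ => c i) continuous_const continuous_const ih

/-- A subset is closed if its preimages under all test families are closed. -/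
theorem isClosed_of_isFam {C : Set (DTree A α)}
    (h : ∀ (K : Type u) [TopologicalSpace K] [CompactSpace K] [T2Space K] (T : K → DTree A α),
      IsFam T → IsClosed (T ⁻¹' C)) : IsClosed C := by
  refine isClosed_iSup_iff.2 fun S => ?_
  rw [isClosed_coinduced, compactlyGenerated, isClosed_coinduced, isClosed_sigma_iff]
  rintro ⟨K, f⟩
  exact h K (fun m => S.tree (f m).1 (f m).2) (isFam_tree S
    (continuous_fst.comp f.continuous) (continuous_snd.comp f.continuous))

/-- A function on a subset which is closed under limits of test families is continuous if it is
continuous on test families. -/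
theorem continuous_of_isFam {Q : DTree A α → Prop}
    (hQ : ∀ (K : Type u) [TopologicalSpace K] [CompactSpace K] [T2Space K] (T : K → DTree A α),
      IsFam T → IsClosed {m | Q (T m)}) {Y : Type w} [TopologicalSpace Y] {f : {T // Q T} → Y}
    (hf : ∀ (K : Type u) [TopologicalSpace K] [CompactSpace K] [T2Space K]
      (T : K → {T : DTree A α // Q T}), (IsFam fun m => (T m).1) → Continuous fun m => f (T m)) :
    Continuous f := by
  rw [continuous_iff_isClosed]
  intro C hC
  -- The condition `Q` is closed, so closed subsets of the subspace are detected in the whole space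
  -- of trees.
  have h : IsClosed (Subtype.val '' (f ⁻¹' C)) := by
    refine isClosed_of_isFam fun K _ _ _ T hT => ?_
    have hK : IsClosed {m | Q (T m)} := hQ K T hT
    have : CompactSpace {m | Q (T m)} := isCompact_iff_compactSpace.1 hK.isCompact
    have h1 := hf {m | Q (T m)} (fun m => ⟨T m, m.2⟩)
      (hT.comp continuous_subtype_val fun l hl => hl.imp fun j hj => by rw [hj])
    convert hK.isClosedEmbedding_subtypeVal.isClosedMap _ (hC.preimage h1) using 1
    ext m
    constructor
    · rintro ⟨T', hT', h⟩
      have hm : Q (T m) := h ▸ T'.2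
      refine ⟨⟨m, hm⟩, ?_, rfl⟩
      obtain rfl : T' = ⟨T m, hm⟩ := Subtype.ext h
      exact hT'
    · rintro ⟨m, hm, rfl⟩
      exact ⟨_, hm, rfl⟩
  convert h.preimage continuous_subtype_val
  rw [Set.preimage_image_eq _ Subtype.val_injective]

/-- A function on the product of a compact space and of a quotient of such a subset is continuous
if it is continuous on test families. -/
theorem continuous_prod_of_isFam {Q : DTree A α → Prop}
    (hQ : ∀ (K : Type u) [TopologicalSpace K] [CompactSpace K] [T2Space K] (T : K → DTree A α),
      IsFam T → IsClosed {m | Q (T m)}) {X : Type u} [TopologicalSpace X] {π : {T // Q T} → X}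
    (hπ : Topology.IsQuotientMap π) {Y : Type u} [TopologicalSpace Y] {N : Type u}
    [TopologicalSpace N] [CompactSpace N] [T2Space N] {f : N → X → Y}
    (hf : ∀ (K : Type u) [TopologicalSpace K] [CompactSpace K] [T2Space K] (a : K → N)
      (T : K → {T : DTree A α // Q T}), Continuous a → (IsFam fun m => (T m).1) →
        Continuous fun m => f (a m) (π (T m))) :
    Continuous fun p : N × X => f p.1 p.2 := by
  have h1 : ∀ x, Continuous fun n => f n x := by
    intro x
    obtain ⟨T, rfl⟩ := hπ.surjective x
    exact hf N (fun n => n) (fun _ => T) continuous_id (IsFam.const N T.1)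
  -- The product of a quotient map with the identity of a compact space is a quotient map; here this
  -- is expressed by passing to the adjoint map.
  let F : X → C(N, Y) := fun x => ⟨fun n => f n x, h1 x⟩
  have hF : Continuous F := by
    refine hπ.continuous_iff.2 (continuous_of_isFam hQ fun K _ _ _ T hT => ?_)
    refine ContinuousMap.continuous_of_continuous_uncurry _ ?_
    exact hf (K × N) Prod.snd (fun p => T p.1) continuous_snd (hT.comp continuous_fst
      fun l hl => hl.imp fun j hj => by rw [hj])
  have := ContinuousMap.continuous_uncurry_of_continuous ⟨F, hF⟩
  exact this.comp continuous_swap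

/-! #### Closed conditions -/

section closed

variable {M : Type u} [TopologicalSpace M] {T : M → DTree A α}

theorem IsFam.mult_eq [DecidableEq α] (h : IsFam T) (a : α) (m m' : M) :
    (T m).mult a = (T m').mult a := by
  induction h with
  | leaf l hl => obtain ⟨j, rfl⟩ := hl; rfl
  | node x t c hx ht _ ih => exact Finset.sum_congr rfl fun i _ => ih i

theorem IsFam.univalents_eq (h : IsFam T) (m m' : M) :
    (T m).univalents = (T m').univalents := by
  induction h with
  | leaf l hl => rfl
  | node x t c hx ht _ ih =>
    simp only [univalents]
    rw [Finset.sum_congr rfl fun i _ => ih i]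

theorem IsFam.isClosed_isLabelled {n : ℕ} {T : M → DTree A (Fin n)} (h : IsFam T) :
    IsClosed {m | (T m).IsLabelled} := by
  by_cases hm : ∃ m, (T m).IsLabelled
  · obtain ⟨m, hm⟩ := hm
    simp only [isLabelled_iff, h.mult_eq _ _ m] at hm ⊢
    simp [hm]
  · simp only [not_exists.1 hm]
    exact isClosed_empty

theorem IsFam.isClosed_rootGE (h : IsFam T) {s : M → unitInterval} (hs : Continuous s) :
    IsClosed {m | (T m).RootGE (s m)} := by
  cases h with
  | leaf l hl => exact isClosed_univ
  | node x t c hx ht _ => exact isClosed_le hs ht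

theorem IsFam.isClosed_rootOne (h : IsFam T) : IsClosed {m | (T m).RootOne} := by
  cases h with
  | leaf l hl => exact isClosed_univ
  | node x t c hx ht _ => exact isClosed_eq ht continuous_const

theorem IsFam.isClosed_mono (h : IsFam T) : IsClosed {m | (T m).Mono} := by
  induction h with
  | leaf l hl => exact isClosed_univ
  | node x t c hx ht hc ih =>
    simp only [Mono, Set.ofPred_forall, Set.ofPred_and]
    exact isClosed_iInter fun i => (IsFam.isClosed_rootGE (hc i) ht).inter (ih i)

/-- The number of geometrical inputs can only drop in the limit: when a parameter tends to `1`, the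
subtree above is replaced by a single input. -/
theorem IsFam.lowerSemicontinuous_inputsW {W : ∀ n, A n → ℕ} (hW : ∀ n x, 1 ≤ W n x + n)
    (hWc : ∀ n, Continuous (W n)) (h : IsFam T) :
    LowerSemicontinuous fun m => (T m).inputsW W := by
  induction h with
  | leaf l hl => exact lowerSemicontinuous_const
  | node x t c hx ht hc ih =>
    have hs : LowerSemicontinuous fun m => W _ (x m) + ∑ i, (c i m).inputsW W :=
      ((hWc _).comp hx).lowerSemicontinuous.add (lowerSemicontinuous_sum fun i _ => ih i)
    rw [lowerSemicontinuous_iff_isOpen_preimage] at hs ⊢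
    intro a
    by_cases ha : a = 0
    · subst ha
      convert isOpen_univ
      refine Set.eq_univ_of_forall fun m => ?_
      exact one_le_inputsW hW _
    · have : (fun m => (DTree.node (x m) (t m) fun i => c i m).inputsW W) ⁻¹' Set.Ioi a =
          {m | t m ≠ 1} ∩ (fun m => W _ (x m) + ∑ i, (c i m).inputsW W) ⁻¹' Set.Ioi a := by
        ext m
        by_cases h1 : t m = 1
        · simp [h1, inputsW_one]; omega
        · simp [h1, inputsW_of_ne_one]
      rw [this]
      exact (isOpen_ne_fun ht continuous_const).inter (hs a)

/-- The filtration condition is closed: when a parameter tends to `0`, a component is split into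
components with fewer inputs. -/
theorem IsFam.isClosed_filteredW {W : ∀ n, A n → ℕ} (hW : ∀ n x, 1 ≤ W n x + n)
    (hWc : ∀ n, Continuous (W n)) (k : ℕ) (h : IsFam T) :
    IsClosed {m | (T m).FilteredW W k} := by
  induction h with
  | leaf l hl => exact isClosed_const
  | node x t c hx ht hc ih =>
    have hl : IsClosed {m | (DTree.node (x m) (t m) fun i => c i m).inputsW W ≤ k} :=
      (IsFam.lowerSemicontinuous_inputsW hW hWc (.node x t c hx ht hc)).isClosed_preimage k
    have : {m | (DTree.node (x m) (t m) fun i => c i m).FilteredW W k} =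
        ({m | t m = 0} ∩ ⋂ i, {m | (c i m).FilteredW W k}) ∪
        {m | (DTree.node (x m) (t m) fun i => c i m).inputsW W ≤ k} := by
      ext m
      simp only [Set.mem_union, Set.mem_inter_iff, Set.mem_iInter, Set.mem_ofPred_eq]
      constructor
      · intro h
        by_cases h0 : t m = 0
        · rw [h0, filteredW_zero] at h
          exact .inl ⟨h0, h⟩
        · rw [filteredW_of_ne_zero _ h0] at h
          exact .inr (by exact_mod_cast h)
      · rintro (⟨h0, h⟩ | h)
        · rw [h0, filteredW_zero]
          exact h
        · exact filteredW_of_inputsW_le (by exact_mod_cast h)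
    rw [this]
    exact ((isClosed_eq ht continuous_const).inter (isClosed_iInter ih)).union hl

end closed

end DTree

/-! ### Continuity of the composition of labels -/

section

open DTree

variable {O : TopOperad.{u}}

theorem isClosed_preBV {n : ℕ} (K : Type u) [TopologicalSpace K] [CompactSpace K] [T2Space K]
    (T : K → DTree O.obj (Fin n)) (hT : IsFam T) :
    IsClosed {m | (T m).IsLabelled ∧ (T m).RootOne} :=
  hT.isClosed_isLabelled.inter hT.isClosed_rootOne

theorem BV.continuous_μ_mk {n : ℕ} : Continuous fun X : PreBV O n => BV.μ (BV.mk X) := by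
  refine continuous_of_isFam isClosed_preBV fun K _ _ _ T hT => ?_
  refine (hT.isContFamily_freeEval (P' := O) (g := fun _ x => x) fun n => continuous_id).continuous
    fun m => ?_
  exact (op_value _).symm

theorem BV.continuous_μ {n : ℕ} : Continuous (BV.μ : BV O n → O.obj n) :=
  isQuotientMap_quot_mk.continuous_iff.2 BV.continuous_μ_mk

theorem continuous_preWeight {n : ℕ} : Continuous (preWeight O n) := by
  refine continuous_of_isFam isClosed_preBV fun K _ _ _ T hT => ?_
  refine continuous_of_const fun m m' => ?_
  exact hT.univalents_eq m m'

end

/-! ### Configurations of intervals in increasing order -/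

namespace LittleIntervals

/-- Disjoint intervals are ordered by their left ends. -/
theorem right_le_left_of_left_le {n : ℕ} (c : LittleIntervals n) {i j : Fin n} (hij : i ≠ j)
    (h : (c.1 i).left ≤ (c.1 j).left) : (c.1 i).right ≤ (c.1 j).left := by
  have h1 := Set.Ioo_disjoint_Ioo.1 (c.2 i j hij)
  rw [max_eq_right h, min_le_iff] at h1
  exact h1.resolve_right (not_le.2 (c.1 j).2.2.1)

/-- Every configuration can be renumbered from left to right. -/
theorem exists_isOrdered_act {n : ℕ} (c : LittleIntervals n) :
    ∃ σ : Equiv.Perm (Fin n), (littleIntervals.act σ c : LittleIntervals n).IsOrdered := by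
  refine ⟨Tuple.sort fun i => (c.1 i).left, fun i j hij => ?_⟩
  exact c.right_le_left_of_left_le ((Equiv.injective _).ne hij.ne)
    (Tuple.monotone_sort (fun i => (c.1 i).left) hij.le)

end LittleIntervals

variable {X : Type v}

/-- The list `l` consists of the intervals of `c`, from left to right, together with the
corresponding components of `x`. -/
def IsSorting {n : ℕ} (c : LittleIntervals n) (x : Fin n → X) (l : List (LittleInterval × X)) :
    Prop :=
  (l : Multiset (LittleInterval × X)) = Finset.univ.val.map (fun i => (c.1 i, x i)) ∧
    l.Pairwise fun d d' => d.1.right ≤ d'.1.left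

/-- The order of the intervals is unique because they have positive length. -/
theorem IsSorting.unique {n : ℕ} {c : LittleIntervals n} {x : Fin n → X}
    {l l' : List (LittleInterval × X)} (h : IsSorting c x l) (h' : IsSorting c x l') : l = l' := by
  refine List.Perm.eq_of_pairwise (fun a b _ _ h1 h2 => ?_) h.2 h'.2
    (Multiset.coe_eq_coe.1 (h.1.trans h'.1.symm))
  have ha : a.1.left < a.1.right := a.1.2.2.1
  have hb : b.1.left < b.1.right := b.1.2.2.1
  exact absurd ha (by linarith)

theorem isSorting_ofFn {n : ℕ} {c : LittleIntervals n} (h : c.IsOrdered) (x : Fin n → X) :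
    IsSorting c x (List.ofFn fun i => (c.1 i, x i)) :=
  ⟨(Fin.univ_val_map _).symm, List.pairwise_ofFn.2 h⟩

theorem isSorting_act {m n : ℕ} (e : Fin m ≃ Fin n) {c : LittleIntervals n} {x : Fin n → X}
    {l : List (LittleInterval × X)} :
    IsSorting (littleIntervals.act e c : LittleIntervals m) (fun j => x (e j)) l ↔
      IsSorting c x l := by
  refine and_congr_left' ?_
  rw [← Multiset.map_univ_val_equiv e, Multiset.map_map]
  rfl

theorem exists_isSorting {n : ℕ} (c : LittleIntervals n) (x : Fin n → X) :
    ∃ l, IsSorting c x l := by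
  obtain ⟨σ, hσ⟩ := c.exists_isOrdered_act
  exact ⟨_, (isSorting_act σ).1 (isSorting_ofFn hσ fun i => x (σ i))⟩

/-- The sorted list of a composite configuration: the sorted lists of the configurations are
inserted at the places of the sorted list of the outer one. -/
theorem IsSorting.flatMap {n : ℕ} {m : Fin n → ℕ} {c : LittleIntervals n}
    {d : ∀ i, LittleIntervals (m i)} {x : Fin (∑ i, m i) → X}
    {l : Fin n → List (LittleInterval × X)}
    (hl : ∀ i, IsSorting (d i) (fun k => x (finSigmaFinEquiv ⟨i, k⟩)) (l i))
    {K : List (LittleInterval × List (LittleInterval × X))} (hK : IsSorting c l K) :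
    IsSorting (LittleIntervals.comp c d) x
      (K.flatMap fun e => e.2.map fun d => (e.1.comp d.1, d.2)) := by
  have hmem : ∀ e ∈ K, ∃ i, (c.1 i, l i) = e := by
    intro e he
    have : e ∈ (K : Multiset _) := he
    rw [hK.1] at this
    simpa using this
  constructor
  · rw [← Multiset.coe_bind, hK.1, Multiset.bind_map, ← Multiset.map_univ_val_equiv
      (finSigmaFinEquiv (m := n) (n := m)), Multiset.map_map, ← Finset.univ_sigma_univ]
    change _ = Multiset.map _ (Multiset.bind (Finset.univ : Finset (Fin n)).val fun i =>
      Multiset.map (Sigma.mk i) (Finset.univ : Finset (Fin (m i))).val)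
    rw [Multiset.map_bind]
    refine congrArg (Multiset.bind _) (funext fun i => ?_)
    rw [← Multiset.map_coe, (hl i).1, Multiset.map_map, Multiset.map_map]
    refine congrArg (fun f => Multiset.map f _) (funext fun k => ?_)
    exact Prod.ext (LittleIntervals.comp_apply c d ⟨i, k⟩).symm rfl
  · rw [List.pairwise_flatMap]
    constructor
    · intro e he
      obtain ⟨i, rfl⟩ := hmem e he
      refine List.pairwise_map.2 ((hl i).2.imp fun {a b} h => ?_)
      have hc : (c.1 i).left < (c.1 i).right := (c.1 i).2.2.1
      change (c.1 i).toFun _ ≤ (c.1 i).toFun _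
      simp only [LittleInterval.toFun]
      have : a.1.right ≤ b.1.left := h
      nlinarith
    · refine hK.2.imp fun {e e'} h a ha b hb => ?_
      obtain ⟨a, -, rfl⟩ := List.mem_map.1 ha
      obtain ⟨b, -, rfl⟩ := List.mem_map.1 hb
      have h1 : e.1.left < e.1.right := e.1.2.2.1
      have h2 : e'.1.left < e'.1.right := e'.1.2.2.1
      have h3 : a.1.right ≤ 1 := a.1.2.2.2
      have h4 : 0 ≤ b.1.left := b.1.2.1
      have h5 : e.1.right ≤ e'.1.left := h
      change e.1.toFun _ ≤ e'.1.toFun _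
      simp only [LittleInterval.toFun]
      nlinarith

/-! ### Spaces of maps and the action of the little intervals -/

section

open DTree

variable {O O' : TopOperad.{u}} {A : ℕ → Type u} [∀ n, TopologicalSpace (A n)]

/-- Equality of functions on the points of arity and filtration at most `k`. -/
def AgreeOn (k : ℕ∞) (f f' : ∀ q, WB O q → O'.obj q) : Prop :=
  ∀ (q : ℕ) (z : WB O q), (q : ℕ∞) ≤ k → z.IsFiltered k → f q z = f' q z

/-- A space `X` whose points are the maps of bimodules which are defined on the points of arity and
filtration at most `k` and are continuous on families of trees with labels in `A`, and whose
topology is determined by the same families: a map to `X` from a compact space is continuous when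
its adjoint is continuous on these families. The points of `X` are extended in some way to
functions on all of `WB(O)`. -/
structure MapSpace (η : O.Hom O') (g : ∀ n, A n → BV O n) (W : ∀ n, A n → ℕ) (k : ℕ∞)
    (X : Type u) [TopologicalSpace X] where
  maps : X → ∀ q, WB O q → O'.obj q
  isBimodMapOn : ∀ x, IsBimodMapOn η k (maps x)
  ext : ∀ {x x'}, AgreeOn k (maps x) (maps x') → x = x'
  exists_agreeOn : ∀ {F : ∀ q, WB O q → O'.obj q}, IsBimodMapOn η k F →
    IsTestContinuous g W k (fun _ : PUnit.{u + 1} => F) → ∃ x, AgreeOn k (maps x) F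
  continuous_iff : ∀ {M : Type u} [TopologicalSpace M] [CompactSpace M] [T2Space M] {x : M → X},
    Continuous x ↔ IsTestContinuous g W k fun m => maps (x m)

variable {η : O.Hom O'} {g : ∀ n, A n → BV O n} {W : ∀ n, A n → ℕ} {k : ℕ∞}

/-- Assembling depends continuously on the intervals, as long as their order is fixed, and on the
functions. -/
theorem isTestContinuous_assembled (hμ : ∀ n, Continuous fun x : A n => BV.μ (g n x))
    (hgW : ∀ n x, (g n x).univalents ≤ W n x) {M : Type u} [TopologicalSpace M]
    {L : List (IntervalMapFamily O O' M)}
    (hL : ∀ d ∈ L, Continuous d.1 ∧ IsTestContinuous g W k d.2 ∧ ∀ m, IsBimodMapOn η k (d.2 m))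
    (hs : ∀ m, (membersAt L m).Pairwise fun d d' => d.1.right ≤ d'.1.left) :
    IsTestContinuous g W k fun m => assembled η (membersAt L m) := by
  intro M' _ _ _ a ha q T hT hq hf hX
  have hm : ∀ m, membersAt (M := M') (L.map fun d => (fun m => d.1 (a m), fun m => d.2 (a m))) m =
      membersAt L (a m) := fun m => List.map_map
  refine assemblesContinuously (η := η) (k := k)
    (L := L.map fun d => (fun m => d.1 (a m), fun m => d.2 (a m))) hμ hgW ?_ ?_ q T hT
    (fun m => (mono_mapVert_iff g).1 (hX m).2) hf _ fun m => ?_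
  · intro d' hd'
    obtain ⟨d, hd, rfl⟩ := List.mem_map.1 hd'
    exact ⟨(hL d hd).1.comp ha, (hL d hd).2.1.comp ha, fun m => (hL d hd).2.2 (a m)⟩
  · exact fun m => (hm m).symm ▸ hs (a m)
  · rw [hm]
    refine assembleFree_eq_assembled (k := k) (fun d' hd' => ?_) (hX m)
      (FilteredW.mapVert_bvWeight hgW (hf m))
    obtain ⟨d, hd, rfl⟩ := List.mem_map.1 hd'
    exact (hL d hd).2.2 (a m)

variable {X : Type u} [TopologicalSpace X]

namespace MapSpace

/-- The list of intervals together with the functions given by the points of `X`, ready to be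
assembled. -/
def members (Φ : MapSpace η g W k X) (l : List (LittleInterval × X)) : List (IntervalMap O O') :=
  l.map fun d => (d.1, Φ.maps d.2)

theorem isBimodMapOn_members (Φ : MapSpace η g W k X) (l : List (LittleInterval × X)) :
    ∀ d ∈ Φ.members l, IsBimodMapOn η k d.2 := by
  intro d' hd'
  obtain ⟨d, -, rfl⟩ := List.mem_map.1 hd'
  exact Φ.isBimodMapOn d.2

theorem exists_agreeOn_assembled (Φ : MapSpace η g W k X)
    (hμ : ∀ n, Continuous fun x : A n => BV.μ (g n x))
    (hgW : ∀ n x, (g n x).univalents ≤ W n x) {l : List (LittleInterval × X)}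
    (hl : l.Pairwise fun d d' => d.1.right ≤ d'.1.left) :
    ∃ y, AgreeOn k (Φ.maps y) (assembled η (Φ.members l)) := by
  refine Φ.exists_agreeOn (isBimodMapOn_assembled (Φ.isBimodMapOn_members l)) ?_
  have h := isTestContinuous_assembled (η := η) (k := k) (M := PUnit.{u + 1})
    (L := l.map fun d => (fun _ => d.1, fun _ => Φ.maps d.2)) hμ hgW ?_ ?_
  · have hm : ∀ m : PUnit.{u + 1}, membersAt (O := O) (O' := O')
        (l.map fun d => (fun _ => d.1, fun _ => Φ.maps d.2)) m = Φ.members l :=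
      fun m => List.map_map
    simpa only [hm] using h
  · intro d' hd'
    obtain ⟨d, -, rfl⟩ := List.mem_map.1 hd'
    exact ⟨continuous_const, Φ.continuous_iff.1 continuous_const, fun _ => Φ.isBimodMapOn d.2⟩
  · intro m
    refine List.pairwise_map.2 (List.pairwise_map.2 hl)

variable (Φ : MapSpace η g W k X) (hμ : ∀ n, Continuous fun x : A n => BV.μ (g n x))
  (hgW : ∀ n x, (g n x).univalents ≤ W n x)

include hμ hgW in
theorem exists_algMap {n : ℕ} (c : LittleIntervals n) (x : Fin n → X) :
    ∃ y, ∀ l, IsSorting c x l → AgreeOn k (Φ.maps y) (assembled η (Φ.members l)) := by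
  obtain ⟨l, hl⟩ := exists_isSorting c x
  obtain ⟨y, hy⟩ := Φ.exists_agreeOn_assembled hμ hgW hl.2
  exact ⟨y, fun l' hl' => hl.unique hl' ▸ hy⟩

/-- The action of a configuration of intervals: the functions are assembled in the order in which
the intervals are met from left to right. -/
noncomputable def algMap {n : ℕ} (c : LittleIntervals n) (x : Fin n → X) : X :=
  (Φ.exists_algMap hμ hgW c x).choose

theorem agreeOn_algMap {n : ℕ} {c : LittleIntervals n} {x : Fin n → X}
    {l : List (LittleInterval × X)} (hl : IsSorting c x l) :
    AgreeOn k (Φ.maps (Φ.algMap hμ hgW c x)) (assembled η (Φ.members l)) :=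
  (Φ.exists_algMap hμ hgW c x).choose_spec l hl

/-- Assembling only depends on the values of the functions on the filtration term. -/
theorem agreeOn_assembled {L L' : List (IntervalMap O O')} (hL : ∀ d ∈ L, IsBimodMapOn η k d.2)
    (hL' : ∀ d ∈ L', IsBimodMapOn η k d.2)
    (h : List.Forall₂ (fun d d' : IntervalMap O O' => d.1 = d'.1 ∧ AgreeOn k d.2 d'.2) L L') :
    AgreeOn k (assembled η L) (assembled η L') := fun _ _ _ hz =>
  assembled_congr hL hL' (fun _ _ _ hF => assembleFree_congr h hF) hz

theorem algMap_unit (x : Fin 1 → X) :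
    Φ.algMap hμ hgW (littleIntervals.unit : LittleIntervals 1) x = x 0 := by
  refine Φ.ext fun q z hq hz => ?_
  have hl : IsSorting (littleIntervals.unit : LittleIntervals 1) x [(LittleInterval.id, x 0)] :=
    ⟨rfl, List.pairwise_singleton _ _⟩
  rw [Φ.agreeOn_algMap hμ hgW hl q z hq hz]
  obtain ⟨⟨T, hT⟩, rfl⟩ := WB.mk_surjective z
  apply FreeAlg.op_pure_injective
  rw [← assembleFree_eq_assembled (Φ.isBimodMapOn_members _) hT hz,
    ← (Φ.isBimodMapOn (x 0)).pieceEval_eq_op_pure hT hq hz]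
  exact assembleFree_id (Φ.isBimodMapOn (x 0)) hT.2 hz (by rwa [hT.1.numLeaves_eq])

theorem algMap_act {m n : ℕ} (e : Fin m ≃ Fin n) (c : LittleIntervals n) (x : Fin n → X) :
    Φ.algMap hμ hgW (littleIntervals.act e c : LittleIntervals m) (fun j => x (e j)) =
      Φ.algMap hμ hgW c x := by
  obtain ⟨l, hl⟩ := exists_isSorting c x
  refine Φ.ext fun q z hq hz => ?_
  rw [Φ.agreeOn_algMap hμ hgW hl q z hq hz,
    Φ.agreeOn_algMap hμ hgW ((isSorting_act e).2 hl) q z hq hz]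

theorem algMap_comp {n : ℕ} {m : Fin n → ℕ} (c : LittleIntervals n)
    (d : ∀ i, LittleIntervals (m i)) (x : Fin (∑ i, m i) → X) :
    Φ.algMap hμ hgW (LittleIntervals.comp c d) x = Φ.algMap hμ hgW c fun i =>
      Φ.algMap hμ hgW (d i) fun k => x (finSigmaFinEquiv ⟨i, k⟩) := by
  choose l hl using fun i => exists_isSorting (d i) fun k => x (finSigmaFinEquiv ⟨i, k⟩)
  -- Both sides are assembled from sorted lists, which are built from the sorted lists of the
  -- configurations `d i` arranged in the order of the intervals of `c`.
  obtain ⟨σ, hσ⟩ := c.exists_isOrdered_act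
  have hK := (isSorting_act σ).1 (isSorting_ofFn hσ fun i => l (σ i))
  have hy := (isSorting_act σ (x := fun i => Φ.algMap hμ hgW (d i) fun k =>
    x (finSigmaFinEquiv ⟨i, k⟩))).1 (isSorting_ofFn hσ fun i =>
      Φ.algMap hμ hgW (d (σ i)) fun k => x (finSigmaFinEquiv ⟨σ i, k⟩))
  set K := List.ofFn fun i => ((littleIntervals.act σ c : LittleIntervals n).1 i, l (σ i)) with hKd
  have hKm : ∀ e ∈ K.map fun e => (e.1, Φ.members e.2), ∀ d ∈ e.2, IsBimodMapOn η k d.2 := by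
    intro e he
    obtain ⟨e, -, rfl⟩ := List.mem_map.1 he
    exact Φ.isBimodMapOn_members e.2
  have hKa : ∀ d ∈ (K.map fun e => (e.1, Φ.members e.2)).map fun e => (e.1, assembled η e.2),
      IsBimodMapOn η k d.2 := by
    intro e' he'
    obtain ⟨e, he, rfl⟩ := List.mem_map.1 he'
    exact isBimodMapOn_assembled (hKm e he)
  refine Φ.ext fun q z hq hz => ?_
  rw [Φ.agreeOn_algMap hμ hgW (IsSorting.flatMap hl hK) q z hq hz,
    Φ.agreeOn_algMap hμ hgW hy q z hq hz]
  have h1 : Φ.members (K.flatMap fun e => e.2.map fun d => (e.1.comp d.1, d.2)) =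
      (K.map fun e => (e.1, Φ.members e.2)).flatMap fun e =>
        e.2.map fun d => (e.1.comp d.1, d.2) := by
    simp only [members, List.map_flatMap, List.flatMap_map, List.map_map]
    rfl
  refine (assembled_congr (Φ.isBimodMapOn_members _) hKa (fun q T hT hF => ?_) hz).trans
    (agreeOn_assembled hKa (Φ.isBimodMapOn_members _) ?_ q z hq hz)
  · rw [h1]
    exact assembleFree_flatMap hKm (List.pairwise_map.2 hK.2) hT hF
  · rw [hKd, members, List.map_ofFn, List.map_ofFn, List.map_ofFn, List.forall₂_iff_get]
    refine ⟨by simp, fun i hi hi' => ?_⟩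
    simp only [List.get_eq_getElem, List.getElem_ofFn, Function.comp_apply]
    exact ⟨trivial, fun q z hq hz => ((Φ.agreeOn_algMap hμ hgW (hl _)) q z hq hz).symm⟩

theorem continuous_algMap (n : ℕ) :
    KContinuous.{u} fun p : LittleIntervals n × (Fin n → X) => Φ.algMap hμ hgW p.1 p.2 := by
  refine continuous_from_compactlyGenerated _ fun M p => Φ.continuous_iff.2 ?_
  intro M' _ _ _ a ha q T hT hq hf hX
  have hc : ∀ i, Continuous fun m : M' => (p (a m)).1.1 i := fun i => (continuous_apply i).comp
    (continuous_subtype_val.comp (continuous_fst.comp (p.continuous.comp ha)))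
  have hx : ∀ i, Continuous fun m : M' => (p (a m)).2 i := fun i => (continuous_apply i).comp
    (continuous_snd.comp (p.continuous.comp ha))
  -- The configurations with a given order of the intervals form closed sets, which cover the space
  -- of configurations. On each of them the sorted list varies continuously.
  let Z : Equiv.Perm (Fin n) → Set M' := fun σ =>
    {m | (littleIntervals.act σ (p (a m)).1 : LittleIntervals n).IsOrdered}
  have hZ : ∀ σ, IsClosed (Z σ) := by
    intro σ
    simp only [Z, LittleIntervals.IsOrdered, Set.ofPred_forall]
    exact isClosed_iInter fun i => isClosed_iInter fun j => isClosed_iInter fun _ =>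
      isClosed_le (LittleInterval.continuous_right.comp (hc (σ i)))
        (LittleInterval.continuous_left.comp (hc (σ j)))
  refine continuous_of_closure_cover (E := Z)
    (fun m => (p (a m)).1.exists_isOrdered_act) fun σ => ?_
  rw [(hZ σ).closure_eq]
  have hZc : CompactSpace (Z σ) := isCompact_iff_compactSpace.1 (hZ σ).isCompact
  let L : List (IntervalMapFamily O O' (Z σ)) := List.ofFn fun i =>
    (fun m => (p (a m)).1.1 (σ i), fun m => Φ.maps ((p (a m)).2 (σ i)))
  have hm : ∀ m : Z σ, membersAt L m = Φ.members (List.ofFn fun i =>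
      ((littleIntervals.act σ (p (a m)).1 : LittleIntervals n).1 i, (p (a m)).2 (σ i))) := by
    intro m
    simp only [L, membersAt, members, List.map_ofFn]
    rfl
  have h := isTestContinuous_assembled (η := η) (k := k) (L := L) hμ hgW ?_ ?_
    (Z σ) (fun m => m) continuous_id q (fun m => T m)
    (hT.comp continuous_subtype_val fun l hl => hl.imp fun j hj => by rw [hj]) hq
    (fun m => hf m) fun m => hX m
  · refine h.congr fun m => ?_
    refine (congrArg (fun L => assembled η L q _) (hm m)).trans ?_
    refine (Φ.agreeOn_algMap hμ hgW ((isSorting_act σ).1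
      (isSorting_ofFn m.2 fun i => (p (a m)).2 (σ i))) q _ hq ?_).symm
    exact (WB.isFiltered_mk _).2 (FilteredW.mapVert_bvWeight hgW (hf m))
  · intro d hd
    obtain ⟨i, rfl⟩ := List.mem_ofFn.1 hd
    exact ⟨(hc _).comp continuous_subtype_val,
      Φ.continuous_iff.1 ((hx _).comp continuous_subtype_val), fun m => Φ.isBimodMapOn _⟩
  · intro m
    rw [hm]
    exact List.pairwise_map.2 (isSorting_ofFn m.2 fun i => (p (a m)).2 (σ i)).2

/-- The algebra structure. -/
noncomputable def algebra : OperadAlgebra littleIntervals X where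
  map _ c x := Φ.algMap hμ hgW c x
  continuous_map := Φ.continuous_algMap hμ hgW
  map_act := Φ.algMap_act hμ hgW
  map_unit := Φ.algMap_unit hμ hgW
  map_comp := Φ.algMap_comp hμ hgW

include hμ hgW in
/-- Equivariance determines the action from its values for the intervals numbered from left to
right, where the formula prescribes it. -/
theorem existsUnique_algebra : ∃! alg : OperadAlgebra littleIntervals X,
    ∀ (n : ℕ) (c : LittleIntervals n), c.IsOrdered → ∀ x : Fin n → X,
      AgreeOn k (Φ.maps (alg.map n c x))
        (assembled η (Φ.members (List.ofFn fun i => (c.1 i, x i)))) := by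
  refine ⟨Φ.algebra hμ hgW, fun n c hc x => Φ.agreeOn_algMap hμ hgW (isSorting_ofFn hc x),
    fun alg h => ?_⟩
  have hmap : ∀ (n : ℕ) (c : LittleIntervals n) (x : Fin n → X),
      alg.map n c x = (Φ.algebra hμ hgW).map n c x := by
    intro n c x
    obtain ⟨σ, hσ⟩ := c.exists_isOrdered_act
    rw [← alg.map_act σ c x, ← (Φ.algebra hμ hgW).map_act σ c x]
    refine Φ.ext fun q z hq hz => ?_
    exact (h n _ hσ (fun i => x (σ i)) q z hq hz).trans
      (Φ.agreeOn_algMap hμ hgW (isSorting_ofFn hσ fun i => x (σ i)) q z hq hz).symm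
  obtain ⟨map, _, _, _, _⟩ := alg
  obtain rfl : map = fun n => (Φ.algebra hμ hgW).map n :=
    funext fun n => funext fun c => funext fun x => hmap n c x
  rfl

end MapSpace

end

/-! ### The mapping spaces of bimodules -/

section

open DTree

/-- A space of maps carries the compactly generated refinement of the topology induced by an
injection in a product of mapping spaces; maps from compact spaces can be tested after this
injection. -/
theorem continuous_iff_of_induced {X : Type u} {Y : Type w} [TopologicalSpace Y] (i : X → Y)
    {M : Type u} [TopologicalSpace M] [CompactSpace M] [T2Space M] {x : M → X} :
    (@Continuous M X _ (@compactlyGenerated.{u} X (induced i inferInstance)) x) ↔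
      Continuous fun m => i (x m) := by
  let _ : TopologicalSpace X := induced i inferInstance
  constructor
  · intro h
    exact @Continuous.comp _ _ _ _ (compactlyGenerated.{u} X) _ _ _
      (KContinuous.of_continuous continuous_induced_dom) h
  · exact fun h => continuous_compactlyGenerated (continuous_induced_rng.2 h)

/-- Continuity of families of maps on a quotient of a space of trees is tested on families of
trees. -/
theorem continuous_iff_of_isFam {A : ℕ → Type u} [∀ n, TopologicalSpace (A n)] {α : Type v}
    {Q : DTree A α → Prop}
    (hQ : ∀ (K : Type u) [TopologicalSpace K] [CompactSpace K] [T2Space K] (T : K → DTree A α),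
      IsFam T → IsClosed {m | Q (T m)}) {Z : Type u} [TopologicalSpace Z] {π : {T // Q T} → Z}
    (hπ : Topology.IsQuotientMap π) {Y : Type u} [TopologicalSpace Y] {M : Type u}
    [TopologicalSpace M] [CompactSpace M] [T2Space M] {F : M → C(Z, Y)} :
    Continuous F ↔ ∀ (K : Type u) [TopologicalSpace K] [CompactSpace K] [T2Space K] (a : K → M)
      (T : K → {T : DTree A α // Q T}), Continuous a → (IsFam fun m => (T m).1) →
        Continuous fun m => F (a m) (π (T m)) := by
  constructor
  · intro h K _ _ _ a T ha hT
    let z : C(K, Z) := ⟨fun m => π (T m), hπ.continuous.comp (hT.continuous.subtype_mk _)⟩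
    have h1 : Continuous fun m => (F (a m)).comp z :=
      (ContinuousMap.continuous_precomp z).comp (h.comp ha)
    exact continuous_eval.comp (h1.prodMk continuous_id)
  · intro h
    exact ContinuousMap.continuous_of_continuous_uncurry _
      (continuous_prod_of_isFam hQ hπ (f := fun m z => F m z) h)

theorem continuous_of_isQuotientMap_isFam {A : ℕ → Type u} [∀ n, TopologicalSpace (A n)]
    {α : Type v} {Q : DTree A α → Prop}
    (hQ : ∀ (K : Type u) [TopologicalSpace K] [CompactSpace K] [T2Space K] (T : K → DTree A α),
      IsFam T → IsClosed {m | Q (T m)}) {Z : Type u} [TopologicalSpace Z] {π : {T // Q T} → Z}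
    (hπ : Topology.IsQuotientMap π) {Y : Type u} [TopologicalSpace Y] {f : Z → Y}
    (hf : ∀ (K : Type u) [TopologicalSpace K] [CompactSpace K] [T2Space K]
      (T : K → {T : DTree A α // Q T}), (IsFam fun m => (T m).1) →
        Continuous fun m => f (π (T m))) : Continuous f :=
  hπ.continuous_iff.2 (continuous_of_isFam hQ hf)

variable {O O' : TopOperad.{u}} {η : O.Hom O'}

/-- The points of the operad which are represented by an assembled tree. -/
theorem represents_assemble_iff {k : ℕ∞} {L : List (IntervalMap O O')}
    (hL : ∀ d ∈ L, IsBimodMapOn η k d.2) {n : ℕ} (T : PreWB O n)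
    (hF : (WB.mk T).IsFiltered k) (y : O'.obj n) :
    (assemble η L ⟨T.1, T.2.2⟩).Represents y ↔ y = assembled η L n (WB.mk T) := by
  have h : FreeAlg.mk (assemble η L ⟨T.1, T.2.2⟩) =
      FreeAlg.op (assembled η L n (WB.mk T)) FreeAlg.pure := by
    refine Eq.trans ?_ (assembleFree_eq_assembled hL T.2 hF)
    rw [assembleFree, dif_pos T.2.2]
  rw [FreeAlg.represents_iff, h]
  exact ⟨fun h => (FreeAlg.op_pure_injective h).symm, fun h => h ▸ rfl⟩

/-! #### Maps defined on all of `WB(O)` -/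

theorem DTree.mapVert_id {A : ℕ → Type u} {α : Type v} (T : DTree A α) :
    T.mapVert (fun _ x => x) = T := by
  induction T with
  | leaf a => rfl
  | node x t c ih => simp only [mapVert, ih]

theorem DTree.isLabelled_mapVert_iff {A B : ℕ → Type u} {α : Type v} [DecidableEq α]
    (g : ∀ n, A n → B n) {T : DTree A α} : (T.mapVert g).IsLabelled ↔ T.IsLabelled := by
  simp only [isLabelled_iff, mult_mapVert]

theorem isClosed_preWB {n : ℕ} (K : Type u) [TopologicalSpace K] [CompactSpace K] [T2Space K]
    (T : K → DTree (BV O) (Fin n)) (hT : IsFam T) :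
    IsClosed {m | (T m).IsLabelled ∧ (T m).Mono} :=
  hT.isClosed_isLabelled.inter hT.isClosed_mono

theorem isQuotientMap_wbMk {n : ℕ} : Topology.IsQuotientMap (WB.mk : PreWB O n → WB O n) :=
  isQuotientMap_quot_mk

variable (η) in
/-- The space of maps of bimodules from `WB(O)` to `O'`. -/
noncomputable def bimodMapSpace : MapSpace η (fun _ (x : BV O _) => x) (bvWeight O) ⊤
    (BimodHom (wbBimod O) η.bimod) where
  maps f q z := f.toFun q z
  isBimodMapOn f :=
    ⟨fun e z _ _ => f.map_act e z, fun z a _ _ _ => f.map_right z a,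
      fun a y _ _ => f.map_left a y⟩
  ext {f f'} h := by
    obtain ⟨f, _, _, _⟩ := f
    obtain ⟨f', _, _, _⟩ := f'
    obtain rfl : f = f' := funext fun q => ContinuousMap.ext fun z =>
      h q z le_top (WB.isFiltered_top z)
    rfl
  exists_agreeOn {F} hF hc := by
    have h : ∀ q, Continuous (F q) := fun q =>
      continuous_of_isQuotientMap_isFam isClosed_preWB isQuotientMap_wbMk fun K _ _ _ T hT => by
        have := hc K (fun _ => PUnit.unit) continuous_const q (fun m => (T m).1) hT le_top
          (fun m => filteredW_top _) fun m => by simpa only [mapVert_id] using (T m).2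
        simpa only [mapVert_id] using this
    exact ⟨⟨fun q => ⟨F q, h q⟩, fun e z => hF.act e z le_top (WB.isFiltered_top z),
      fun z a => hF.right z a le_top (WB.isFiltered_top z) le_top,
      fun a y => hF.left a y (fun i => WB.isFiltered_top _) le_top⟩, fun _ _ _ _ => rfl⟩
  continuous_iff {M _ _ _ x} := by
    refine (continuous_iff_of_induced BimodHom.toFun).trans (continuous_pi_iff.trans ?_)
    have h : ∀ q, (Continuous fun m => (x m).toFun q) ↔ _ := fun q =>
      continuous_iff_of_isFam (F := fun m => (x m).toFun q) (isClosed_preWB (O := O) (n := q))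
        isQuotientMap_wbMk
    rw [forall_congr' h]
    constructor
    · intro h K _ _ _ a ha q T hT _ _ hX
      simp only [mapVert_id] at hX ⊢
      exact h q K a (fun m => ⟨T m, hX m⟩) ha hT
    · intro h q K _ _ _ a T ha hT
      have := h K a ha q (fun m => (T m).1) hT le_top (fun m => filteredW_top _)
        fun m => by simpa only [mapVert_id] using (T m).2
      simp only [mapVert_id] at this
      exact this

/-! #### Truncated maps -/

variable {k : ℕ}

theorem isClosed_preWBk {n : ℕ} (K : Type u) [TopologicalSpace K] [CompactSpace K] [T2Space K]
    (T : K → DTree (PreBV O) (Fin n)) (hT : IsFam T) :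
    IsClosed {m | (T m).IsLabelled ∧ (T m).Mono ∧ (T m).Filtered k} := by
  simp only [← filteredW_preWeight]
  refine hT.isClosed_isLabelled.inter (hT.isClosed_mono.inter
    (hT.isClosed_filteredW (fun n X => ?_) (fun n => continuous_preWeight) k))
  exact (BV.one_le_univalents_add (BV.mk X)).trans
    (Nat.add_le_add_right (BV.univalents_mk_le X) n)

theorem isQuotientMap_wbkMk {n : ℕ} :
    Topology.IsQuotientMap (WBk.mk : PreWBk O k n → WBk O k n) :=
  ⟨⟨rfl⟩, fun ⟨_, D, hD⟩ => ⟨D, Subtype.ext hD⟩⟩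

open Classical in
/-- The extension of a truncated map by the values of `η` on the composites of all labels. -/
noncomputable def truncMaps (f : TruncBimodHom ((wbkBimod O k).trunc k) (η.bimod.trunc k)) (q : ℕ)
    (z : WB O q) : O'.obj q :=
  if h : q ≤ k ∧ ∃ D : PreWBk O k q, D.toWB = z then f.toFun ⟨q, h.1⟩ ⟨z, h.2⟩
  else assembled η [] q z

theorem truncMaps_val (f : TruncBimodHom ((wbkBimod O k).trunc k) (η.bimod.trunc k)) {q : ℕ}
    (hq : q ≤ k) (z : WBk O k q) : truncMaps f q z.1 = f.toFun ⟨q, hq⟩ z :=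
  dif_pos ⟨hq, z.2⟩

theorem isBimodMapOn_truncMaps (f : TruncBimodHom ((wbkBimod O k).trunc k) (η.bimod.trunc k)) :
    IsBimodMapOn η k (truncMaps f) where
  act {m n} e z hn hz := by
    have hn : n ≤ k := by exact_mod_cast hn
    have hm : m ≤ k := (Fin.equiv_iff_eq.1 ⟨e⟩).trans_le hn
    have hz := (exists_toWB_iff z).2 hz
    refine (truncMaps_val f hm (WBk.act e ⟨z, hz⟩)).trans ?_
    refine (f.map_act (m := ⟨m, hm⟩) (n := ⟨n, hn⟩) e ⟨z, hz⟩).trans ?_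
    exact congrArg (O'.act e) (truncMaps_val f hn ⟨z, hz⟩).symm
  right {n m} z a hn hz hs := by
    have hn : n ≤ k := by exact_mod_cast hn
    have hs : ∑ i, m i ≤ k := by exact_mod_cast hs
    have hz := (exists_toWB_iff z).2 hz
    refine (truncMaps_val f hs (WBk.right ⟨z, hz⟩ a)).trans ?_
    refine (f.map_right (n := ⟨n, hn⟩) hs ⟨z, hz⟩ a).trans ?_
    exact congrArg (fun y => O'.comp y fun i => η.toFun _ (a i)) (truncMaps_val f hn ⟨z, hz⟩).symm
  left {n m} a y hy hs := by
    have hs : ∑ i, m i ≤ k := by exact_mod_cast hs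
    have hm : ∀ i, m i ≤ k := fun i =>
      (Finset.single_le_sum (f := m) (fun _ _ => Nat.zero_le _) (Finset.mem_univ i)).trans hs
    have hy := fun i => (exists_toWB_iff (y i)).2 (hy i)
    refine (truncMaps_val f hs (WBk.left a fun i => ⟨y i, hy i⟩)).trans ?_
    refine (f.map_left (m := fun i => ⟨m i, hm i⟩) hs a fun i => ⟨y i, hy i⟩).trans ?_
    exact congrArg (O'.comp (η.toFun _ a))
      (funext fun i => (truncMaps_val f (hm i) ⟨y i, hy i⟩).symm)

variable (η k) in
/-- The space of truncated maps of bimodules. -/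
noncomputable def truncBimodMapSpace : MapSpace η (fun _ => (BV.mk : PreBV O _ → BV O _))
    (preWeight O) k (TruncBimodHom ((wbkBimod O k).trunc k) (η.bimod.trunc k)) where
  maps := truncMaps
  isBimodMapOn := isBimodMapOn_truncMaps
  ext {f f'} h := by
    have h' : ∀ q, f.toFun q = f'.toFun q := fun q => ContinuousMap.ext fun z =>
      (truncMaps_val f q.2 z).symm.trans ((h q z.1 (by exact_mod_cast q.2)
        ((exists_toWB_iff _).1 z.2)).trans (truncMaps_val f' q.2 z))
    obtain ⟨f, _, _, _⟩ := f
    obtain ⟨f', _, _, _⟩ := f'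
    obtain rfl : f = f' := funext h'
    rfl
  exists_agreeOn {F} hF hc := by
    have h : ∀ q : Set.Iic k, Continuous fun z : WBk O k q => F q z.1 := fun q =>
      continuous_of_isQuotientMap_isFam isClosed_preWBk isQuotientMap_wbkMk fun K _ _ _ T hT =>
        hc K (fun _ => PUnit.unit) continuous_const q (fun m => (T m).1) hT
          (by exact_mod_cast q.2) (fun m => filteredW_preWeight.2 (T m).2.2.2)
          fun m => ⟨(T m).2.1.mapVert _, (T m).2.2.1.mapVert _⟩
    have hle : ∀ q : Set.Iic k, ((q : ℕ) : ℕ∞) ≤ k := fun q => by exact_mod_cast q.2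
    have hfil : ∀ {q : ℕ} (z : WBk O k q), z.1.IsFiltered k := fun z =>
      (exists_toWB_iff _).1 z.2
    refine ⟨⟨fun q => ⟨fun z => F q z.1, h q⟩, fun {m n} e z => hF.act e z.1 (hle n) (hfil z),
      fun {n m} hs z a => hF.right z.1 a (hle n) (hfil z) (hle ⟨_, hs⟩),
      fun {n m} hs a y => hF.left a (fun i => (y i).1) (fun i => hfil (y i)) (hle ⟨_, hs⟩)⟩,
      fun q z hq hz => ?_⟩
    exact truncMaps_val _ (by exact_mod_cast hq) ⟨z, (exists_toWB_iff z).2 hz⟩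
  continuous_iff {M _ _ _ x} := by
    refine (continuous_iff_of_induced TruncBimodHom.toFun).trans (continuous_pi_iff.trans ?_)
    have h : ∀ q : Set.Iic k, (Continuous fun m => (x m).toFun q) ↔ _ := fun q =>
      continuous_iff_of_isFam (F := fun m => (x m).toFun q)
        (isClosed_preWBk (O := O) (k := k) (n := q)) isQuotientMap_wbkMk
    rw [forall_congr' h]
    constructor
    · intro h K _ _ _ a ha q T hT hq hf hX
      have hq : q ≤ k := by exact_mod_cast hq
      refine (h ⟨q, hq⟩ K a (fun m => ⟨T m, (isLabelled_mapVert_iff _).1 (hX m).1,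
        (mono_mapVert_iff _).1 (hX m).2, filteredW_preWeight.1 (hf m)⟩) ha hT).congr fun m => ?_
      exact (truncMaps_val (x (a m)) hq (WBk.mk ⟨T m, _⟩)).symm
    · intro h q K _ _ _ a T ha hT
      refine (h K a ha q (fun m => (T m).1) hT (by exact_mod_cast q.2)
        (fun m => filteredW_preWeight.2 (T m).2.2.2)
        fun m => ⟨(T m).2.1.mapVert _, (T m).2.2.1.mapVert _⟩).congr fun m => ?_
      exact truncMaps_val (x (a m)) q.2 (WBk.mk (T m))

/-! ### The algebra structures -/

variable (η k)

theorem existsUnique_algebra_bimodHom :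
    ∃! alg : OperadAlgebra littleIntervals (BimodHom (wbBimod O) η.bimod),
      ∀ (n : ℕ) (c : LittleIntervals n), c.IsOrdered →
        ∀ (f : Fin n → BimodHom (wbBimod O) η.bimod) (m : ℕ) (T : PreWB O m),
          (assemble η (List.ofFn fun i => (c.1 i, fun q => (f i).toFun q))
            ⟨T.1, T.2.2⟩).Represents ((alg.map n c f).toFun m (WB.mk T)) := by
  refine (existsUnique_congr fun alg => ?_).1 ((bimodMapSpace η).existsUnique_algebra
    (fun n => BV.continuous_μ) fun n x => le_rfl)
  refine forall_congr' fun n => forall_congr' fun c => forall_congr' fun hc =>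
    forall_congr' fun f => ?_
  have hL : (bimodMapSpace η).members (List.ofFn fun i => (c.1 i, f i)) =
      List.ofFn fun i => (c.1 i, fun q => ⇑((f i).toFun q)) := List.map_ofFn
  have hb := hL ▸ (bimodMapSpace η).isBimodMapOn_members (List.ofFn fun i => (c.1 i, f i))
  rw [hL]
  refine forall_congr' fun m => ?_
  refine Iff.trans ⟨fun h T => ?_, fun h z _ _ => ?_⟩ (forall_congr' fun T =>
    (represents_assemble_iff hb T (WB.isFiltered_top _) _).symm)
  · exact h (WB.mk T) le_top (WB.isFiltered_top _)
  · obtain ⟨T, rfl⟩ := WB.mk_surjective z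
    exact h T

theorem existsUnique_algebra_truncBimodHom :
    ∃! alg : OperadAlgebra littleIntervals
        (TruncBimodHom ((wbkBimod O k).trunc k) (η.bimod.trunc k)),
      ∀ (n : ℕ) (c : LittleIntervals n), c.IsOrdered →
        ∀ (f : Fin n → TruncBimodHom ((wbkBimod O k).trunc k) (η.bimod.trunc k))
          (F : Fin n → ∀ q, WB O q → O'.obj q),
          (∀ i (q : Set.Iic k) (z : WBk O k q), F i q z.1 = (f i).toFun q z) →
          ∀ (m : Set.Iic k) (T : PreWB O m) (hT : ∃ D : PreWBk O k m, D.toWB = WB.mk T),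
            (assemble η (List.ofFn fun i => (c.1 i, F i)) ⟨T.1, T.2.2⟩).Represents
              ((alg.map n c f).toFun m ⟨WB.mk T, hT⟩) := by
  refine (existsUnique_congr fun alg => ?_).1 ((truncBimodMapSpace η k).existsUnique_algebra
    (fun n => BV.continuous_μ_mk) fun n x => BV.univalents_mk_le x)
  refine forall_congr' fun n => forall_congr' fun c => forall_congr' fun hc =>
    forall_congr' fun f => ?_
  have hL : (truncBimodMapSpace η k).members (List.ofFn fun i => (c.1 i, f i)) =
      List.ofFn fun i => (c.1 i, truncMaps (f i)) := List.map_ofFn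
  have hb := hL ▸ (truncBimodMapSpace η k).isBimodMapOn_members
    (List.ofFn fun i => (c.1 i, f i))
  rw [hL]
  constructor
  · intro h F hF m T hT
    have hz := (exists_toWB_iff _).1 hT
    have hm : ((m : ℕ) : ℕ∞) ≤ k := by exact_mod_cast m.2
    have hy := (FreeAlg.represents_iff _ _).1
      ((represents_assemble_iff hb T hz _).2 (h m (WB.mk T) hm hz))
    refine (FreeAlg.represents_iff _ _).2 ?_
    refine Eq.trans ?_ (hy.trans (congrArg (fun y => FreeAlg.op y FreeAlg.pure)
      (truncMaps_val (alg.map n c f) m.2 ⟨WB.mk T, hT⟩)))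
    -- Any two extensions of the maps agree on the points which matter.
    have := assembleFree_congr (η := η) (k := k) (L := List.ofFn fun i => (c.1 i, F i))
      (L' := List.ofFn fun i => (c.1 i, truncMaps (f i))) (T := T.1) ?_ hz
    · simpa only [assembleFree, dif_pos T.2.2] using this
    · rw [List.forall₂_iff_get]
      refine ⟨by simp, fun i hi hi' => ?_⟩
      simp only [List.get_eq_getElem, List.getElem_ofFn]
      refine ⟨trivial, fun q z hq hz => ?_⟩
      have hq : q ≤ k := by exact_mod_cast hq
      have hz := (exists_toWB_iff z).2 hz
      exact (hF _ ⟨q, hq⟩ ⟨z, hz⟩).trans (truncMaps_val (f _) hq ⟨z, hz⟩).symm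
  · intro h q z hq hz
    obtain ⟨T, rfl⟩ := WB.mk_surjective z
    have hT := (exists_toWB_iff _).2 hz
    have hq : q ≤ k := by exact_mod_cast hq
    exact (truncMaps_val (alg.map n c f) hq ⟨WB.mk T, hT⟩).trans
      ((represents_assemble_iff hb T hz _).1 (h (fun i => truncMaps (f i))
        (fun i q z => truncMaps_val (f i) q.2 z) ⟨q, hq⟩ T hT))

end

end OperadBimod

theorem mainTheorem3 (O O' : TopOperad.{u}) (η : O.Hom O') :
    (∃! alg : OperadAlgebra littleIntervals (BimodHom (wbBimod O) η.bimod),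
      ∀ (n : ℕ) (c : LittleIntervals n), c.IsOrdered →
        ∀ (f : Fin n → BimodHom (wbBimod O) η.bimod) (m : ℕ) (T : PreWB O m),
          (assemble η (List.ofFn fun i => (c.1 i, fun q => (f i).toFun q))
            ⟨T.1, T.2.2⟩).Represents ((alg.map n c f).toFun m (WB.mk T))) ∧
    ∀ k : ℕ, ∃! alg : OperadAlgebra littleIntervals
        (TruncBimodHom ((wbkBimod O k).trunc k) (η.bimod.trunc k)),
      ∀ (n : ℕ) (c : LittleIntervals n), c.IsOrdered →
        ∀ (f : Fin n → TruncBimodHom ((wbkBimod O k).trunc k) (η.bimod.trunc k))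
          (F : Fin n → ∀ q, WB O q → O'.obj q),
          (∀ i (q : Set.Iic k) (z : WBk O k q), F i q z.1 = (f i).toFun q z) →
          ∀ (m : Set.Iic k) (T : PreWB O m) (hT : ∃ D : PreWBk O k m, D.toWB = WB.mk T),
            (assemble η (List.ofFn fun i => (c.1 i, F i)) ⟨T.1, T.2.2⟩).Represents
              ((alg.map n c f).toFun m ⟨WB.mk T, hT⟩) :=
  ⟨existsUnique_algebra_bimodHom η, existsUnique_algebra_truncBimodHom η⟩
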